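/- **Setting.** Let $\mathcal B$ be a finite set of real numbers, $\gamma=\min\mathcal B\ge 1$, $\Gamma=\max\mathcal B>\gamma$, and $\theta_\beta(x)=1/(x+\beta)$ for $\beta\in\mathcal B$. Put $\mathfrak a_0=0$, $\mathfrak b_0=1/\gamma$, $\mathfrak a_{k+1}=\theta_\Gamma(\mathfrak b_k)$, $\mathfrak b_{k+1}=\theta_\gamma(\mathfrak a_k)$, $\mathfrak a_\infty=\lim\mathfrak a_k$, $\mathfrak b_\infty=\lim\mathfrak b_k$, $S=[\mathfrak a_\infty,\mathfrak b_\infty]$ (so $\theta_\beta(S)\subset S$) and $\chi=2\mathfrak a_\infty+\gamma$. Let $\lambda_s$ be the spectral radius of the operator $(L_sf)(x)=\sum_{\beta\in\mathcal B}|\theta_\beta'(x)|^s f(\theta_\beta(x))$ on $C(S)$. For $\omega=(\beta_1,\dots,\beta_\nu)\in\Omega_\nu=\mathcal B^\nu$ let $\theta_\omega=\theta_{\beta_1}\circ\cdots\circ\theta_{\beta_\nu}$ and $g_\omega=|\theta_\omega'|$. *Cones.* For a set $X\subset\mathbb R$ and a real $M$, $K(M;X)$ is the set of all $F:X\to\mathbb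 R$ with $F(\xi)\le e^{M|\xi-\eta|}F(\eta)$ for all $\xi,\eta\in X$. *Mesh.* Let $[a_i,b_i]\subset S$, $1\le i\le I$, be pairwise disjoint intervals with $a_i<b_i$ such that for every $\omega\in\Omega_\nu$ there is an $i$ with $\theta_\omega(S)\subset[a_i,b_i]$. Let $N_i\ge1$ be integers, $h_i=(b_i-a_i)/N_i$, $h=\max_i h_i$, $\mu=h/\min_i h_i$. Divide $[a_i,b_i]$ into the $N_i$ cells $[t^i_{j-1},t^i_j]$, $t^i_j=a_i+jh_i$, and put $$c^i_{j,k}=t^i_{j-1}+\tfrac{h_i}{2}(1+\hat c_k),\qquad \hat c_k=-\cos\Big(\frac{2k+1}{2r+2}\pi\Big)\Big/\cos\Big(\frac{\pi}{2r+2}\Big),\qquad 0\le k\le r,$$ and $T=\{c^i_{j,k}\}$. For $F:T\to\mathbb R$ let $\mathcal F:\bigcup_i[a_i,b_i]\to\mathbb R$ be the function that on each cell is the polynomial of degree $\le r$ interpolating $F$ at the $r+1$ points $c^i_{j,k}$ of this cell, and let $$(\mathbf L_{s,\nu}F)(\xi)=\sum_{\omega\in\Omega_\nu}g_\omega(\xi)^s\,\mathcal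 F(\theta_\omega(\xi)),\qquad \xi\in T.$$ Let $R(\mathbf L_{s,\nu})$ be the spectral radius of this real matrix (the largest modulus of a complex eigenvalue). *Constants.* Let $\psi(r)=\frac2\pi\ln(r+1)+\frac34$; $\eta(r)=\frac12$ for even $r$ and $\eta(r)=\frac12\big[1+\tan\frac{\pi}{2r+2}\big]$ for odd $r$; $\tilde B_0=1$, $\tilde B_1=\gamma$, $\tilde B_{j+1}=\tilde B_{j-1}+\gamma\tilde B_j$; $c(\nu)=[\tilde B_{\nu-1}\mathfrak a_\infty+\tilde B_\nu]^{-2}$. Let $M_0(\nu)$ be any constant such that $g_\omega\in K(M_0(\nu);S)$ for all $\omega\in\Omega_\nu$. Put $$G_{r+1}=2\exp\Big(\frac{2sh}{\chi}\Big)\Big[\prod_{j=0}^{r}\frac{2s+j}{2j+2}\Big]\Big[\frac1\chi\Big]^{r+1}\Big[\frac{1}{2\cos(\pi/(2r+2))}\Big]^{r+1},\quad D_{r+1}=\frac{G_{r+1}}{\sin^2(\pi/(2r+2))},\quad H=H_{r+1}=\mu D_{r+1}\frac{\chi}{2s},$$ $$M_1=\frac{\mu D_{r+1}h^r}{1-G_{r+1}^2h^{2r+2}}+\frac{2s}{\chi},\qquad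 M_2=M_1+\frac{G_{r+1}}{H_{r+1}}\,\frac{\mu}{1-[(G_{r+1}/H_{r+1})h]^2}\,\frac{1}{\sin^2(\pi/(2r+2))}.$$ **Theorem.** Assume $r\ge2$, $\chi\ge1$ and $0<s\le 3/2$. Let the integer $\nu\ge1$ be such that $$\kappa_1:=c(\nu)\,[2\eta(r)r^2\psi(r)]<1,$$ let $\kappa_1<\kappa_2<1$, and let $$M=\frac{4s}{\mathfrak a_\infty+\mathfrak a_{\nu-1}+\gamma}\cdot\frac{1}{\kappa_2-\kappa_1}.$$ Let $h_0$ be such that, for every mesh size $h'$ with $0<h'\le h_0$, the two inequalities $$\text{(i)}\ \ \psi(r)\,u\,e^{u}<1,\qquad\qquad \text{(ii)}\ \ \frac{\kappa_1e^{u}}{1-\psi(r)\,u\,e^{u}}<\kappa_2-\frac{sM_0(\nu)}{M}$$ hold with $u=M\eta(r)h'$, and let $h_1$ be such that, for every $h'$ with $0<h'\le h_1$, $$2+H_{r+1}h'^{\,r}(1+h'^{\,2r+2})+h'^{\,2}\le\frac{2}{\kappa_2-\kappa_1},$$ where $H_{r+1}$ is formed with $h'$ in place of $h$ and with the given $\mu$.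 Suppose that the mesh satisfies $h\le\min(h_0,h_1,0.2)$. Then (i) and (ii) hold with $u=M\eta(r)h$, and $M>M_2$. Furthermore $$\mathbf L_{s,\nu}(K(M;T))\subset K(M';T),\qquad\text{where } M'=\kappa_2M<M,$$ and, with $H=H_{r+1}$, $$\lambda_s^{\nu}(1-Hh^r)\le R(\mathbf L_{s,\nu})\le\lambda_s^{\nu}(1+Hh^r).$$ -/

import Mathlib

open Set Filter Topology

noncomputable section

namespace ContFrac

/-- The map `θ_β(x) = 1 / (x + β)`. -/
def theta (β x : ℝ) : ℝ := 1 / (x + β)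

/-- A finite set `𝓑` of real numbers `≥ 1` having at least two elements. -/
structure Alphabet where
  digits : Finset ℝ
  nontrivial : digits.Nontrivial
  one_le : ∀ β ∈ digits, 1 ≤ β

namespace Alphabet

variable (A : Alphabet)

/-- `γ = min 𝓑`. -/
def gmin : ℝ := A.digits.min' A.nontrivial.nonempty

/-- `Γ = max 𝓑`. -/
def gmax : ℝ := A.digits.max' A.nontrivial.nonempty

/-- The pairs `(𝔞_k, 𝔟_k)`: `𝔞_0 = 0`, `𝔟_0 = 1 / γ`, `𝔞_{k+1} = θ_Γ(𝔟_k)`,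
`𝔟_{k+1} = θ_γ(𝔞_k)`. -/
def ends : ℕ → ℝ × ℝ
  | 0 => (0, 1 / A.gmin)
  | k + 1 => (theta A.gmax (ends k).2, theta A.gmin (ends k).1)

/-- `𝔞_k`. -/
def a (k : ℕ) : ℝ := (A.ends k).1

/-- `𝔟_k`. -/
def b (k : ℕ) : ℝ := (A.ends k).2

/-- `𝔞_∞ = lim 𝔞_k` (the limit exists: `tendsto_a`). -/
def aInf : ℝ := limUnder atTop A.a

/-- `𝔟_∞ = lim 𝔟_k` (the limit exists: `tendsto_b`). -/
def bInf : ℝ := limUnder atTop A.b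

theorem one_le_gmin : 1 ≤ A.gmin := A.one_le _ (Finset.min'_mem _ _)

theorem gmin_le {β : ℝ} (h : β ∈ A.digits) : A.gmin ≤ β := Finset.min'_le _ _ h

theorem le_gmax {β : ℝ} (h : β ∈ A.digits) : β ≤ A.gmax := Finset.le_max' _ _ h

theorem gmin_lt_gmax : A.gmin < A.gmax := by
  obtain ⟨x, hx, y, hy, hxy⟩ := A.nontrivial
  exact Finset.min'_lt_max' _ hx hy hxy

theorem theta_le {β₁ β₂ x₁ x₂ : ℝ} (hβ : 1 ≤ β₁) (hx : 0 ≤ x₁) (h₁ : β₁ ≤ β₂)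
    (h₂ : x₁ ≤ x₂) : theta β₂ x₂ ≤ theta β₁ x₁ := by
  unfold theta
  exact one_div_le_one_div_of_le (by linarith) (by linarith)

theorem ends_aux (k : ℕ) :
    0 ≤ A.a k ∧ A.a k ≤ A.b k ∧ A.a k ≤ A.a (k + 1) ∧ A.b (k + 1) ≤ A.b k := by
  have hγ := A.one_le_gmin
  have hΓ := A.gmin_lt_gmax
  induction k with
  | zero =>
    have h0 : 0 ≤ 1 / A.gmin := by positivity
    refine ⟨le_rfl, h0, ?_, ?_⟩
    · change 0 ≤ 1 / (1 / A.gmin + A.gmax)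
      exact one_div_nonneg.2 (by linarith)
    · change 1 / (0 + A.gmin) ≤ 1 / A.gmin
      simp
  | succ k ih =>
    obtain ⟨h1, h2, h3, h4⟩ := ih
    have h5 : A.a (k + 1) ≤ A.b (k + 1) := theta_le hγ h1 hΓ.le h2
    exact ⟨h1.trans h3, h5, theta_le (hγ.trans hΓ.le) ((h1.trans h3).trans h5) le_rfl h4,
      theta_le hγ h1 le_rfl h3⟩

theorem tendsto_a : Tendsto A.a atTop (𝓝 A.aInf) := by
  have hm : Monotone A.a := monotone_nat_of_le_succ fun k => (A.ends_aux k).2.2.1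
  have hb : Antitone A.b := antitone_nat_of_succ_le fun k => (A.ends_aux k).2.2.2
  have hbd : BddAbove (range A.a) := by
    refine ⟨A.b 0, ?_⟩
    rintro _ ⟨k, rfl⟩
    exact (A.ends_aux k).2.1.trans (hb (Nat.zero_le k))
  exact tendsto_nhds_limUnder ⟨_, tendsto_atTop_ciSup hm hbd⟩

theorem tendsto_b : Tendsto A.b atTop (𝓝 A.bInf) := by
  have hb : Antitone A.b := antitone_nat_of_succ_le fun k => (A.ends_aux k).2.2.2
  have hbd : BddBelow (range A.b) := by
    refine ⟨0, ?_⟩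
    rintro _ ⟨k, rfl⟩
    exact (A.ends_aux k).1.trans (A.ends_aux k).2.1
  exact tendsto_nhds_limUnder ⟨_, tendsto_atTop_ciInf hb hbd⟩

theorem aInf_nonneg : 0 ≤ A.aInf :=
  ge_of_tendsto' A.tendsto_a fun k => (A.ends_aux k).1

theorem aInf_le_bInf : A.aInf ≤ A.bInf :=
  le_of_tendsto_of_tendsto' A.tendsto_a A.tendsto_b fun k => (A.ends_aux k).2.1

theorem theta_gmax_bInf : theta A.gmax A.bInf = A.aInf := by
  have h : A.bInf + A.gmax ≠ 0 := by
    have := A.aInf_nonneg; have := A.aInf_le_bInf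
    have := A.one_le_gmin; have := A.gmin_lt_gmax
    linarith
  have h1 : Tendsto (fun k => A.a (k + 1)) atTop (𝓝 (theta A.gmax A.bInf)) :=
    Tendsto.div tendsto_const_nhds (A.tendsto_b.add_const _) h
  exact tendsto_nhds_unique h1 (A.tendsto_a.comp (tendsto_add_atTop_nat 1))

theorem theta_gmin_aInf : theta A.gmin A.aInf = A.bInf := by
  have h : A.aInf + A.gmin ≠ 0 := by
    have := A.aInf_nonneg
    have := A.one_le_gmin
    linarith
  have h1 : Tendsto (fun k => A.b (k + 1)) atTop (𝓝 (theta A.gmin A.aInf)) :=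
    Tendsto.div tendsto_const_nhds (A.tendsto_a.add_const _) h
  exact tendsto_nhds_unique h1 (A.tendsto_b.comp (tendsto_add_atTop_nat 1))

/-- The reduced interval `S = [𝔞_∞, 𝔟_∞]`. -/
abbrev S : Set ℝ := Icc A.aInf A.bInf

theorem theta_mem {β x : ℝ} (hβ : β ∈ A.digits) (hx : x ∈ A.S) : theta β x ∈ A.S := by
  have h1 := A.one_le_gmin
  have h2 := A.aInf_nonneg
  have h3 := A.gmin_le hβ
  have h4 := A.le_gmax hβ
  constructor
  · rw [← A.theta_gmax_bInf]
    exact theta_le (h1.trans h3) (h2.trans hx.1) h4 hx.2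
  · rw [← A.theta_gmin_aInf]
    exact theta_le h1 h2 h3 hx.1

theorem deriv_theta {β x : ℝ} (h : x + β ≠ 0) : deriv (theta β) x = -1 / (x + β) ^ 2 := by
  have h1 : HasDerivAt (fun y : ℝ => y + β) 1 x := (hasDerivAt_id x).add_const β
  have h2 : HasDerivAt (theta β) ((0 * (x + β) - 1 * 1) / (x + β) ^ 2) x :=
    (hasDerivAt_const x (1 : ℝ)).fun_div h1 h
  simpa using h2.deriv

theorem add_pos_of_mem {β x : ℝ} (hβ : β ∈ A.digits) (hx : x ∈ A.S) : 0 < x + β := by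
  have := A.one_le β hβ
  have := A.aInf_nonneg
  have := hx.1
  linarith

/-- `θ_β` as a continuous map of `S` into itself. -/
def thetaMap (β : A.digits) : C(A.S, A.S) where
  toFun x := ⟨theta β x, A.theta_mem β.2 x.2⟩
  continuous_toFun := by
    refine Continuous.subtype_mk ?_ _
    exact continuous_const.div (by fun_prop) fun x => (A.add_pos_of_mem β.2 x.2).ne'

/-- The weight `|θ_β'(x)|^s`, as a continuous function on `S` with values in `𝕜 = ℝ` or `ℂ`. -/
def weight (𝕜 : Type*) [RCLike 𝕜] (s : ℝ) (β : A.digits) : C(A.S, 𝕜) where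
  toFun x := ((|deriv (theta β) x| ^ s : ℝ) : 𝕜)
  continuous_toFun := by
    have h : ∀ x : A.S, deriv (theta β) x = -1 / ((x : ℝ) + β) ^ 2 := fun x =>
      deriv_theta (A.add_pos_of_mem β.2 x.2).ne'
    simp_rw [h]
    refine RCLike.continuous_ofReal.comp (Continuous.rpow_const ?_ fun x => Or.inl ?_)
    · exact (continuous_const.div (by fun_prop)
        fun x => pow_ne_zero 2 (A.add_pos_of_mem β.2 x.2).ne').abs
    · have := (A.add_pos_of_mem β.2 x.2).ne'
      positivity

/-- The transfer operator `(L_s f)(x) = ∑_{β ∈ 𝓑} |θ_β'(x)|^s f(θ_β(x))` on `C(S)`, for real or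
complex valued functions. -/
def transfer (𝕜 : Type*) [RCLike 𝕜] (s : ℝ) : C(A.S, 𝕜) →L[𝕜] C(A.S, 𝕜) where
  toFun f := ∑ β : A.digits, A.weight 𝕜 s β * f.comp (A.thetaMap β)
  map_add' f g := by
    ext x
    simp [mul_add, Finset.sum_add_distrib]
  map_smul' c f := by
    ext x
    simp [Finset.mul_sum]
  cont := by
    refine continuous_finsetSum _ fun β _ => continuous_const.mul ?_
    exact ContinuousMap.continuous_precomp _

/-- `λ_s = R(L_s)`, the spectral radius of `L_s` on `C(S)`. As usual for an operator on a real
Banach space, the spectrum is that of the complexification, which is `L_s` on `C(S, ℂ)`. -/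
def lam (s : ℝ) : ℝ := (spectralRadius ℂ (A.transfer ℂ s)).toReal

/-- `Ω_ν`: words of length `ν` over `𝓑`. -/
abbrev Word (ν : ℕ) : Type := Fin ν → A.digits

variable {A} in
/-- `θ_ω = θ_{β_1} ∘ ⋯ ∘ θ_{β_ν}` for `ω = (β_1, …, β_ν)`. -/
def thetaWord {ν : ℕ} (ω : A.Word ν) (x : ℝ) : ℝ :=
  (List.ofFn fun j => (ω j : ℝ)).foldr theta x

variable {A} in
/-- `g_ω(x) = |θ_ω'(x)|`. -/
def gWord {ν : ℕ} (ω : A.Word ν) (x : ℝ) : ℝ := |deriv (thetaWord ω) x|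

/-- `χ = 2 𝔞_∞ + γ`. -/
def chi : ℝ := 2 * A.aInf + A.gmin

/-- `B̃_0 = 1`, `B̃_1 = γ`, `B̃_{j+2} = B̃_j + γ B̃_{j+1}`. -/
def Btilde : ℕ → ℝ
  | 0 => 1
  | 1 => A.gmin
  | j + 2 => Btilde j + A.gmin * Btilde (j + 1)

/-- `c(ν) = (B̃_{ν-1} 𝔞_∞ + B̃_ν)^{-2}` (used for `ν ≥ 1`). -/
def c (ν : ℕ) : ℝ := ((A.Btilde (ν - 1) * A.aInf + A.Btilde ν) ^ 2)⁻¹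

/-- `M₀` is an admissible value of `M₀(ν)`: every `g_ω`, `ω ∈ Ω_ν`, lies in the cone
`K(M₀; S)`. -/
def IsM0 (ν : ℕ) (M₀ : ℝ) : Prop :=
  ∀ ω : A.Word ν, ∀ x ∈ A.S, ∀ y ∈ A.S, gWord ω x ≤ Real.exp (M₀ * |x - y|) * gWord ω y

end Alphabet

/-- `ψ(r) = (2/π) ln(r+1) + 3/4`. -/
def psi (r : ℕ) : ℝ := 2 / Real.pi * Real.log (r + 1) + 3 / 4

/-- `η(r) = 1/2` for even `r`, and `(1 + tan(π/(2r+2)))/2` for odd `r`. -/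
def eta (r : ℕ) : ℝ :=
  if Even r then 1 / 2 else 1 / 2 * (1 + Real.tan (Real.pi / (2 * r + 2)))

/-- The extended Chebyshev points `ĉ_k`, `0 ≤ k ≤ r`, in `[-1, 1]`. -/
def chat (r k : ℕ) : ℝ :=
  -Real.cos ((2 * k + 1) / (2 * r + 2) * Real.pi) / Real.cos (Real.pi / (2 * r + 2))

theorem cos_ne_zero {r : ℕ} (hr : 0 < r) : Real.cos (Real.pi / (2 * r + 2)) ≠ 0 := by
  have h1 : (1 : ℝ) ≤ r := by exact_mod_cast hr
  have hpi := Real.pi_pos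
  refine (Real.cos_pos_of_mem_Ioo ⟨?_, ?_⟩).ne'
  · have : 0 < Real.pi / (2 * r + 2) := by positivity
    linarith
  · exact div_lt_div_of_pos_left hpi (by norm_num) (by linarith)

theorem chat_zero {r : ℕ} (hr : 0 < r) : chat r 0 = -1 := by
  have h : (2 * ((0 : ℕ) : ℝ) + 1) / (2 * r + 2) * Real.pi = Real.pi / (2 * r + 2) := by
    push_cast
    ring
  rw [chat, h, neg_div, div_self (cos_ne_zero hr)]

theorem chat_last {r : ℕ} (hr : 0 < r) : chat r r = 1 := by
  have h : (2 * (r : ℝ) + 1) / (2 * r + 2) * Real.pi = Real.pi - Real.pi / (2 * r + 2) := by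
    field_simp
    ring
  rw [chat, h, Real.cos_pi_sub, neg_neg, div_self (cos_ne_zero hr)]

/-- The cone `K(M; T)` of functions on a finite set `T` of reals. -/
def cone (M : ℝ) (T : Finset ℝ) : Set (T → ℝ) :=
  {F | ∀ ξ η : T, F ξ ≤ Real.exp (M * |(ξ : ℝ) - η|) * F η}

/-- The intervals `[a_i, b_i] ⊂ S`, pairwise disjoint, the `i`-th one being divided into `N_i`
equal cells. -/
structure Mesh (A : Alphabet) where
  I : ℕ
  left : Fin I → ℝ
  right : Fin I → ℝ
  N : Fin I → ℕ
  left_lt_right : ∀ i, left i < right i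
  N_pos : ∀ i, 0 < N i
  subset : ∀ i, Icc (left i) (right i) ⊆ A.S
  disjoint : Pairwise fun i j => Disjoint (Icc (left i) (right i)) (Icc (left j) (right j))

namespace Mesh

variable {A : Alphabet} (P : Mesh A)

/-- For every `ω ∈ Ω_ν` the image `θ_ω(S)` is contained in one of the intervals `[a_i, b_i]`. -/
def Covers (ν : ℕ) : Prop :=
  ∀ ω : A.Word ν, ∃ i, Alphabet.thetaWord ω '' A.S ⊆ Icc (P.left i) (P.right i)

/-- `h_i = (b_i - a_i) / N_i`. -/
def step (i : Fin P.I) : ℝ := (P.right i - P.left i) / P.N i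

/-- `h = max h_i`. -/
def h : ℝ := ⨆ i, P.step i

/-- `μ = h / min h_i`. -/
def mu : ℝ := P.h / ⨅ i, P.step i

/-- Indices `(i, j)` of cells; `j` runs from `0` to `N_i - 1`. -/
abbrev Cell : Type := Σ i : Fin P.I, Fin (P.N i)

/-- The left end point `t = a_i + j h_i` of the cell `(i, j)`. -/
def t (p : P.Cell) : ℝ := P.left p.1 + (p.2 : ℕ) * P.step p.1

/-- The cell `(i, j)`, a closed interval of length `h_i`. -/
def cell (p : P.Cell) : Set ℝ := Icc (P.t p) (P.t p + P.step p.1)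

/-- The mesh points `t + h_i (1 + ĉ_k) / 2` of the cell `(i, j)`. -/
def node (r : ℕ) (p : P.Cell) (k : Fin (r + 1)) : ℝ :=
  P.t p + P.step p.1 * (1 + chat r k) / 2

/-- The set `T` of all mesh points. -/
def T (r : ℕ) : Finset ℝ :=
  Finset.univ.image fun q : P.Cell × Fin (r + 1) => P.node r q.1 q.2

theorem node_mem (r : ℕ) (p : P.Cell) (k : Fin (r + 1)) : P.node r p k ∈ P.T r :=
  Finset.mem_image.2 ⟨(p, k), Finset.mem_univ _, rfl⟩

/-- The polynomial of degree `≤ r` that interpolates `F` at the mesh points of the cell `p`. -/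
def cellPoly (r : ℕ) (p : P.Cell) : (P.T r → ℝ) →ₗ[ℝ] Polynomial ℝ :=
  (Lagrange.interpolate Finset.univ (P.node r p)) ∘ₗ
    LinearMap.funLeft ℝ ℝ fun k => ⟨P.node r p k, P.node_mem r p k⟩

theorem step_pos (i : Fin P.I) : 0 < P.step i :=
  div_pos (sub_pos.2 (P.left_lt_right i)) (Nat.cast_pos.2 (P.N_pos i))

theorem cell_subset (p : P.Cell) : P.cell p ⊆ Icc (P.left p.1) (P.right p.1) := by
  have h1 := P.step_pos p.1
  have h2 : ((p.2 : ℕ) : ℝ) + 1 ≤ P.N p.1 := by exact_mod_cast p.2.2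
  have h3 : (P.N p.1 : ℝ) * P.step p.1 = P.right p.1 - P.left p.1 := by
    have : (P.N p.1 : ℝ) ≠ 0 := Nat.cast_ne_zero.2 (P.N_pos p.1).ne'
    unfold step
    field_simp
  have h4 := mul_le_mul_of_nonneg_right h2 h1.le
  have h5 : 0 ≤ ((p.2 : ℕ) : ℝ) * P.step p.1 := by positivity
  apply Icc_subset_Icc <;> unfold t <;> linarith

theorem node_injective (r : ℕ) (p : P.Cell) : Function.Injective (P.node r p) := by
  intro k l hkl
  have h1 := (P.step_pos p.1).ne'
  have h2 : chat r k = chat r l := by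
    unfold node at hkl
    have : P.step p.1 * (chat r k - chat r l) = 0 := by linarith
    linarith [(mul_eq_zero.1 this).resolve_left h1]
  rcases Nat.eq_zero_or_pos r with rfl | hr
  · exact Fin.ext (by omega)
  have hc := cos_ne_zero hr
  unfold chat at h2
  rw [neg_div, neg_div, neg_inj, div_left_inj' hc] at h2
  have hmem : ∀ m : Fin (r + 1),
      (2 * (m : ℕ) + 1) / (2 * r + 2) * Real.pi ∈ Icc (0 : ℝ) Real.pi := by
    intro m
    have hm : ((m : ℕ) : ℝ) ≤ r := by exact_mod_cast Nat.lt_succ_iff.1 m.2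
    refine ⟨by positivity, mul_le_of_le_one_left Real.pi_pos.le ?_⟩
    rw [div_le_one (by positivity)]
    linarith
  have h3 := Real.injOn_cos (hmem k) (hmem l) h2
  have h4 := mul_right_cancel₀ Real.pi_ne_zero h3
  rw [div_left_inj' (by positivity)] at h4
  have h5 : ((k : ℕ) : ℝ) = (l : ℕ) := by linarith
  exact Fin.ext (by exact_mod_cast h5)

theorem eval_node (r : ℕ) (p : P.Cell) (F : P.T r → ℝ) (k : Fin (r + 1)) :
    (P.cellPoly r p F).eval (P.node r p k) = F ⟨P.node r p k, P.node_mem r p k⟩ :=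
  Lagrange.eval_interpolate_at_node _ (P.node_injective r p).injOn (Finset.mem_univ k)

theorem eval_cellPoly_eq {r : ℕ} (hr : 0 < r) {x : ℝ} {p q : P.Cell} (hp : x ∈ P.cell p)
    (hq : x ∈ P.cell q) (F : P.T r → ℝ) :
    (P.cellPoly r p F).eval x = (P.cellPoly r q F).eval x := by
  obtain ⟨i, j⟩ := p
  obtain ⟨i', j'⟩ := q
  obtain rfl : i = i' := by
    by_contra hne
    exact Set.disjoint_left.1 (P.disjoint hne) (P.cell_subset _ hp) (P.cell_subset _ hq)
  wlog hjj : j ≤ j' generalizing j j'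
  · exact (this j' hq j hp (le_of_not_ge hjj)).symm
  rcases hjj.eq_or_lt with rfl | hlt
  · rfl
  have h1 := P.step_pos i
  have h2 : ((j : ℕ) : ℝ) + 1 ≤ (j' : ℕ) := by exact_mod_cast hlt
  have h3 := mul_le_mul_of_nonneg_right h2 h1.le
  have h4 : x ≤ P.left i + (j : ℕ) * P.step i + P.step i := hp.2
  have h5 : P.left i + (j' : ℕ) * P.step i ≤ x := hq.1
  have hx1 : P.node r ⟨i, j⟩ (Fin.last r) = x := by
    simp only [node, t, Fin.val_last, chat_last hr]
    linarith
  have hx2 : P.node r ⟨i, j'⟩ 0 = x := by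
    simp only [node, t, Fin.val_zero, chat_zero hr]
    linarith
  have e1 := P.eval_node r ⟨i, j⟩ F (Fin.last r)
  have e2 := P.eval_node r ⟨i, j'⟩ F 0
  simp only [hx1] at e1
  simp only [hx2] at e2
  rw [e1, e2]

open Classical in
/-- The piecewise polynomial interpolant `𝓕` of `F` on `⋃ [a_i, b_i]`: on each cell it is the
interpolating polynomial of this cell (two cells that share an end point give the same value
there, see `interp_eq`; the value `0` outside `⋃ [a_i, b_i]` is never used). -/
def interp (r : ℕ) (x : ℝ) : (P.T r → ℝ) →ₗ[ℝ] ℝ :=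
  if hx : ∃ p, x ∈ P.cell p then (Polynomial.leval x) ∘ₗ P.cellPoly r hx.choose else 0

theorem interp_eq {r : ℕ} (hr : 0 < r) {x : ℝ} {p : P.Cell} (hp : x ∈ P.cell p)
    (F : P.T r → ℝ) : P.interp r x F = (P.cellPoly r p F).eval x := by
  have hx : ∃ p, x ∈ P.cell p := ⟨p, hp⟩
  rw [interp, dif_pos hx]
  exact P.eval_cellPoly_eq hr hx.choose_spec hp F

/-- The collocation operator
`(𝐋_{s,ν} F)(ξ) = ∑_{ω ∈ Ω_ν} g_ω(ξ)^s 𝓕(θ_ω(ξ))`, `ξ ∈ T`. -/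
def colloc (s : ℝ) (ν r : ℕ) : (P.T r → ℝ) →ₗ[ℝ] (P.T r → ℝ) :=
  LinearMap.pi fun ξ : P.T r =>
    ∑ ω : A.Word ν, (Alphabet.gWord ω ξ ^ s) • P.interp r (Alphabet.thetaWord ω ξ)

/-- `R(𝐋_{s,ν})`, the spectral radius (largest modulus of a complex eigenvalue) of the matrix of
`𝐋_{s,ν}`. -/
def R (s : ℝ) (ν r : ℕ) : ℝ :=
  (spectralRadius ℂ ((LinearMap.toMatrix' (P.colloc s ν r)).map ((↑) : ℝ → ℂ))).toReal

end Mesh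

/-- `G_{r+1}`, as a function of `χ`, `s`, the mesh size `h` and `r`. -/
def G (χ s h : ℝ) (r : ℕ) : ℝ :=
  2 * Real.exp (2 * s * h / χ) *
    (∏ j ∈ Finset.range (r + 1), (2 * s + j) / (2 * j + 2)) *
    (1 / χ) ^ (r + 1) * (1 / (2 * Real.cos (Real.pi / (2 * r + 2)))) ^ (r + 1)

/-- `D_{r+1} = G_{r+1} / sin²(π/(2r+2))`. -/
def D (χ s h : ℝ) (r : ℕ) : ℝ := (1 / Real.sin (Real.pi / (2 * r + 2))) ^ 2 * G χ s h r

/-- `H_{r+1} = μ D_{r+1} χ / (2s)`. -/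
def H (μ χ s h : ℝ) (r : ℕ) : ℝ := μ * D χ s h r * (χ / (2 * s))

/-- The constant `M₁`. -/
def M1 (μ χ s h : ℝ) (r : ℕ) : ℝ :=
  μ * (G χ s h r * h ^ r / (1 - G χ s h r ^ 2 * h ^ (2 * r + 2))) *
    (1 / Real.sin (Real.pi / (2 * r + 2))) ^ 2 + 2 * s / χ

/-- The constant `M₂`, for `H = H_{r+1}`. -/
def M2 (μ χ s h : ℝ) (r : ℕ) : ℝ :=
  M1 μ χ s h r +
    G χ s h r / H μ χ s h r * (μ / (1 - (G χ s h r / H μ χ s h r * h) ^ 2)) *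
      (1 / Real.sin (Real.pi / (2 * r + 2)) ^ 2)

/-- The first cone condition: `ψ(r) u e^u < 1`. -/
def ConeCond1 (r : ℕ) (u : ℝ) : Prop := psi r * u * Real.exp u < 1

/-- The second cone condition: `κ₁ e^u / (1 - ψ(r) u e^u) < κ₂ - s M₀(ν) / M`. -/
def ConeCond2 (r : ℕ) (κ₁ κ₂ s M₀ M u : ℝ) : Prop :=
  κ₁ * Real.exp u / (1 - psi r * u * Real.exp u) < κ₂ - s * M₀ / M

/-- `h₀` is such that the two cone conditions hold for all mesh sizes `0 < h ≤ h₀`. -/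
def IsH0 (r : ℕ) (κ₁ κ₂ s M₀ M h₀ : ℝ) : Prop :=
  ∀ h, 0 < h → h ≤ h₀ →
    ConeCond1 r (M * eta r * h) ∧ ConeCond2 r κ₁ κ₂ s M₀ M (M * eta r * h)

/-- `h₁` is such that `2 + H_{r+1} h^r (1 + h^{2r+2}) + h² ≤ 2 / (κ₂ - κ₁)` holds for all mesh
sizes `0 < h ≤ h₁` (with the given mesh ratio `μ`). -/
def IsH1 (r : ℕ) (κ₁ κ₂ s μ χ h₁ : ℝ) : Prop :=
  ∀ h, 0 < h → h ≤ h₁ →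
    2 + H μ χ s h r * h ^ r * (1 + h ^ (2 * r + 2)) + h ^ 2 ≤ 2 / (κ₂ - κ₁)

end ContFrac

end

/-!
The proof has two halves, both of which measure functions by the log-Lipschitz condition
`F(ξ) ≤ exp(M |ξ - η|) F(η)`.

*Invariance of the cone.* On a cell, an element `F` of `K(M; T)` differs from its value at a central
node by at most a factor `e^u`, `u = M η h`. The Lebesgue constant of the extended Chebyshev points
is at most `ψ(r)` (`abs_eval_cos_le_psi`), so the interpolating polynomial is close to that value, and
by Markov's inequality (`markov`) its derivative is at most a multiple of `r² ψ(r)` of it. Thus the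
piecewise interpolant is log-Lipschitz on each interval `[a_i, b_i]`, possibly with a large constant,
which the contraction `|θ_ω'| ≤ c(ν)` reduces (`Mesh.memCone_sum_words`). This gives
`Mesh.colloc_mem_cone`. The bound for the Lebesgue function compares the sum of
`sin θ_k / |cos θ - cos θ_k|` over the zeros that are not adjacent to `θ` with an integral, by
convexity, and treats the two adjacent zeros directly (`lebesgue_function_le`).

*Spectral radius.* The transfer operator maps each function `x ↦ (x + d)^(-2s)` to a positive
combination of such functions (`Alphabet.rtransfer_pow`), and their interpolation error is explicit: the error has a zero at each node and
its derivative has a zero between any two nodes (`abs_sub_eval_le`, `abs_sub_eval_derivative_le`).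
Consequently, with `ε = H h^r`, both `ε L^ν f ± (L^ν f - 𝐋 f)` lie in `K(M; T)` for every positive
combination `f` of such functions (`Mesh.error_mem_cone`). By Gelfand's formula and a Harnack type
inequality, the normalized iterates `λ^{-νk} L^{νk} f` stay between two positive constants, so that
their Cesàro means are approximate eigenfunctions for `λ^ν`
(`Alphabet.exists_approx_eigenfunctions`); the convergence needed to pass to the limit takes place on
the finite set `T`. The limit is a positive `v` with `λ^ν (1 - ε) v ≤ 𝐋 v ≤ λ^ν (1 + ε) v` in the
order of the invariant cone `K(M; T)`. Since `v` is an order unit of this cone, iteration of these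
inequalities determines the growth of the powers of `𝐋`, hence its spectral radius up to the factors
`1 ± ε` (`Mesh.R_bounds`).
-/

/-! ### Chebyshev polynomials in trigonometric form -/

namespace ContFrac
open Polynomial Polynomial.Chebyshev

/-- The angles `(2k+1)π/(2n)`, whose cosines are the zeros of the Chebyshev polynomial `T_n`. -/
noncomputable def zeroAngle (n k : ℕ) : ℝ := (2 * k + 1) * Real.pi / (2 * n)

theorem zeroAngle_mem {n k : ℕ} (hk : k < n) : zeroAngle n k ∈ Ioo 0 Real.pi := by
  have h1 : (k : ℝ) + 1 ≤ n := by exact_mod_cast hk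
  have h2 : (0 : ℝ) ≤ k := by positivity
  have hpi := Real.pi_pos
  unfold zeroAngle
  constructor
  · apply div_pos <;> nlinarith
  · rw [div_lt_iff₀ (by linarith)]
    nlinarith

theorem sin_zeroAngle_pos {n k : ℕ} (hk : k < n) : 0 < Real.sin (zeroAngle n k) :=
  Real.sin_pos_of_mem_Ioo (zeroAngle_mem hk)

theorem nat_mul_zeroAngle {n : ℕ} (hn : n ≠ 0) (k : ℕ) :
    n * zeroAngle n k = k * Real.pi + Real.pi / 2 := by
  unfold zeroAngle
  field_simp

theorem sin_nat_mul_zeroAngle {n : ℕ} (hn : n ≠ 0) (k : ℕ) :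
    Real.sin (n * zeroAngle n k) = (-1) ^ k := by
  rw [nat_mul_zeroAngle hn, Real.sin_add_pi_div_two, Real.cos_nat_mul_pi]

theorem cos_nat_mul_zeroAngle {n : ℕ} (hn : n ≠ 0) (k : ℕ) :
    Real.cos (n * zeroAngle n k) = 0 := by
  rw [nat_mul_zeroAngle hn, Real.cos_add_pi_div_two, Real.sin_nat_mul_pi, neg_zero]

theorem zeroAngle_strictMono {n : ℕ} (hn : n ≠ 0) : StrictMono (zeroAngle n) := by
  intro k l hkl
  have : (k : ℝ) < l := by exact_mod_cast hkl
  unfold zeroAngle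
  have hpi := Real.pi_pos
  gcongr

theorem injOn_cos_zeroAngle (n : ℕ) :
    Set.InjOn (fun k => Real.cos (zeroAngle n k)) (Finset.range n : Set ℕ) := by
  intro k hk l hl hkl
  have hk' := zeroAngle_mem (Finset.mem_range.1 (Finset.mem_coe.1 hk))
  have hl' := zeroAngle_mem (Finset.mem_range.1 (Finset.mem_coe.1 hl))
  have hn : n ≠ 0 := by
    rintro rfl
    simp at hk
  exact (zeroAngle_strictMono hn).injective
    (Real.injOn_cos (Ioo_subset_Icc_self hk') (Ioo_subset_Icc_self hl') hkl)

/-- `T_n` is `2^(n-1)` times the nodal polynomial of its zeros. -/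
theorem T_eq_nodal (n : ℕ) : T ℝ n = C (2 ^ (n - 1)) *
    Lagrange.nodal (Finset.range n) (fun k => Real.cos (zeroAngle n k)) := by
  have h1 := C_leadingCoeff_mul_prod_multiset_X_sub_C (p := T ℝ n) (by
    rw [roots_T_real, Finset.card_val, Finset.card_image_of_injOn, Finset.card_range, natDegree_T]
    · simp
    · exact injOn_cos_zeroAngle n)
  rw [roots_T_real] at h1
  rw [← h1, leadingCoeff_T, Lagrange.nodal]
  congr 1
  change ∏ x ∈ _, (X - C x) = _
  rw [Finset.prod_image]
  · rfl
  · exact injOn_cos_zeroAngle n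

theorem cos_nat_mul_eq_nodal (n : ℕ) (t : ℝ) : Real.cos (n * t) = 2 ^ (n - 1) *
    (Lagrange.nodal (Finset.range n) (fun k => Real.cos (zeroAngle n k))).eval (Real.cos t) := by
  have := congrArg (eval (Real.cos t)) (T_eq_nodal n)
  rw [T_real_cos, eval_mul, eval_C] at this
  exact_mod_cast this

theorem eval_derivative_T_mul_sin (n : ℕ) (t : ℝ) :
    (derivative (T ℝ n)).eval (Real.cos t) * Real.sin t = n * Real.sin (n * t) := by
  rw [T_derivative_eq_U, eval_mul, mul_assoc, U_real_cos]
  simp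

theorem derivative_T_eq_nodal (n : ℕ) (x : ℝ) :
    (derivative (T ℝ n)).eval x = 2 ^ (n - 1) * (derivative
      (Lagrange.nodal (Finset.range n) (fun k => Real.cos (zeroAngle n k)))).eval x := by
  rw [T_eq_nodal n, derivative_C_mul, eval_mul, eval_C]

theorem abs_eval_derivative_T_zero {n k : ℕ} (hk : k < n) :
    |(derivative (T ℝ n)).eval (Real.cos (zeroAngle n k))| = n / Real.sin (zeroAngle n k) := by
  have hs := sin_zeroAngle_pos hk
  have h := eval_derivative_T_mul_sin n (zeroAngle n k)
  rw [sin_nat_mul_zeroAngle (by omega)] at h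
  rw [eq_div_iff hs.ne']
  nth_rewrite 1 [← abs_of_pos hs]
  rw [← abs_mul, h]
  simp [abs_mul]

theorem abs_nodalWeight_zeroAngle {n k : ℕ} (hk : k < n) :
    |Lagrange.nodalWeight (Finset.range n) (fun k => Real.cos (zeroAngle n k)) k| =
      2 ^ (n - 1) * Real.sin (zeroAngle n k) / n := by
  rw [Lagrange.nodalWeight_eq_eval_derivative_nodal (Finset.mem_range.2 hk), abs_inv]
  have h := abs_eval_derivative_T_zero hk
  rw [derivative_T_eq_nodal, abs_mul, abs_of_pos (by positivity)] at h
  have hs := sin_zeroAngle_pos hk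
  have hn : (0 : ℝ) < n := by exact_mod_cast (by omega : 0 < n)
  rw [inv_eq_iff_eq_inv, inv_div, ← div_div, eq_div_iff hs.ne'] 
  rw [eq_div_iff hs.ne'] at h
  rw [eq_div_iff (by positivity), ← h]
  ring

/-- The Lagrange formula at the zeros of `T_n`, estimated term by term. -/
theorem abs_eval_le_sum_zeroAngle {n : ℕ} {Q : ℝ[X]} (hQ : Q.degree < n) {t : ℝ}
    (ht : ∀ k < n, Real.cos t ≠ Real.cos (zeroAngle n k)) :
    |Q.eval (Real.cos t)| ≤ |Real.cos (n * t)| / n * ∑ k ∈ Finset.range n,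
      Real.sin (zeroAngle n k) / |Real.cos t - Real.cos (zeroAngle n k)| *
        |Q.eval (Real.cos (zeroAngle n k))| := by
  have h1 := Lagrange.eq_interpolate (injOn_cos_zeroAngle n) (f := Q) (by simpa using hQ)
  have h2 := Lagrange.eval_interpolate_not_at_node (s := Finset.range n)
    (v := fun k => Real.cos (zeroAngle n k))
    (fun i => Q.eval (Real.cos (zeroAngle n i))) (fun i hi => ht i (Finset.mem_range.1 hi))
  rw [← h1] at h2
  have h3 : (0 : ℝ) < 2 ^ (n - 1) := by positivity
  rw [h2, abs_mul, cos_nat_mul_eq_nodal n, abs_mul, abs_of_pos h3]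
  have h4 := Finset.abs_sum_le_sum_abs (fun i =>
    Lagrange.nodalWeight (Finset.range n) (fun k => Real.cos (zeroAngle n k)) i *
      (Real.cos t - Real.cos (zeroAngle n i))⁻¹ * Q.eval (Real.cos (zeroAngle n i)))
    (Finset.range n)
  refine (mul_le_mul_of_nonneg_left h4 (abs_nonneg _)).trans (le_of_eq ?_)
  rw [Finset.mul_sum, Finset.mul_sum]
  refine Finset.sum_congr rfl fun k hk => ?_
  rw [abs_mul, abs_mul, abs_nodalWeight_zeroAngle (Finset.mem_range.1 hk), abs_inv]
  ring

end ContFrac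

/-! ### The inequalities of Bernstein and Markov -/

namespace ContFrac
open Polynomial Polynomial.Chebyshev

/-- The weights `1 / (4 n sin²(φ/2))`, `φ = (2k+1)π/(2n)`, of the interpolation formula of M. Riesz
for the derivative of a trigonometric polynomial of degree at most `n`. -/
noncomputable def rieszWeight (n k : ℕ) : ℝ := 1 / (4 * n * Real.sin (zeroAngle n k / 2) ^ 2)

theorem rieszWeight_nonneg (n k : ℕ) : 0 ≤ rieszWeight n k := by
  unfold rieszWeight
  positivity

theorem zeroAngle_mem_two {n k : ℕ} (hk : k < 2 * n) : zeroAngle n k ∈ Ioo 0 (2 * Real.pi) := by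
  have h1 : (k : ℝ) + 1 ≤ 2 * n := by exact_mod_cast hk
  have h2 : (0 : ℝ) ≤ k := by positivity
  have hpi := Real.pi_pos
  unfold zeroAngle
  constructor
  · apply div_pos <;> nlinarith
  · rw [div_lt_iff₀ (by linarith)]
    nlinarith

theorem zeroAngle_reflect {n k : ℕ} (hk : k < 2 * n) :
    zeroAngle n (2 * n - 1 - k) = 2 * Real.pi - zeroAngle n k := by
  have hn : (n : ℝ) ≠ 0 := by exact_mod_cast (by omega : n ≠ 0)
  have : ((2 * n - 1 - k : ℕ) : ℝ) = 2 * n - 1 - k := by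
    rw [Nat.cast_sub (by omega), Nat.cast_sub (by omega)]
    push_cast
    ring
  unfold zeroAngle
  rw [this]
  field_simp
  ring

theorem sum_riesz_cos (n m : ℕ) :
    ∑ k ∈ Finset.range (2 * n), (-1) ^ k * rieszWeight n k * Real.cos (m * zeroAngle n k) = 0 := by
  have h := Finset.sum_range_reflect
    (fun k => (-1) ^ k * rieszWeight n k * Real.cos (m * zeroAngle n k)) (2 * n)
  have h2 : ∑ k ∈ Finset.range (2 * n), ((-1) ^ (2 * n - 1 - k) * rieszWeight n (2 * n - 1 - k) *
      Real.cos (m * zeroAngle n (2 * n - 1 - k))) =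
      - ∑ k ∈ Finset.range (2 * n), (-1) ^ k * rieszWeight n k * Real.cos (m * zeroAngle n k) := by
    rw [← Finset.sum_neg_distrib]
    refine Finset.sum_congr rfl fun k hk => ?_
    have hk := Finset.mem_range.1 hk
    have e1 : ((-1 : ℝ)) ^ (2 * n - 1 - k) = -(-1) ^ k := by
      have e2 : (-1 : ℝ) ^ (2 * n - 1 - k) * (-1) ^ (k + 1) = 1 := by
        rw [← pow_add, show 2 * n - 1 - k + (k + 1) = 2 * n by omega, pow_mul]
        simp
      have e3 : (-1 : ℝ) ^ (k + 1) * (-1) ^ (k + 1) = 1 := by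
        rw [← mul_pow]
        simp
      calc (-1 : ℝ) ^ (2 * n - 1 - k)
          = (-1 : ℝ) ^ (2 * n - 1 - k) * ((-1) ^ (k + 1) * (-1) ^ (k + 1)) := by rw [e3, mul_one]
        _ = (-1 : ℝ) ^ (k + 1) := by rw [← mul_assoc, e2, one_mul]
        _ = -(-1) ^ k := by ring
    have e4 : rieszWeight n (2 * n - 1 - k) = rieszWeight n k := by
      unfold rieszWeight
      rw [zeroAngle_reflect hk, show (2 * Real.pi - zeroAngle n k) / 2 =
        Real.pi - zeroAngle n k / 2 by ring, Real.sin_pi_sub]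
    have e5 : Real.cos (m * zeroAngle n (2 * n - 1 - k)) = Real.cos (m * zeroAngle n k) := by
      rw [zeroAngle_reflect hk, mul_sub, ← Real.cos_neg, neg_sub, Real.cos_sub_nat_mul_two_pi]
    rw [e1, e4, e5]
    ring
  rw [h2] at h
  linarith

theorem sum_sin_zeroAngle {n m : ℕ} (hm : m < n) :
    ∑ k ∈ Finset.range (2 * n), (-1) ^ k * Real.sin (m * zeroAngle n k) = 0 := by
  have hn : (0 : ℝ) < n := by exact_mod_cast (by omega : 0 < n)
  have hpi := Real.pi_pos
  have hc : 0 < Real.cos (m * Real.pi / (2 * n)) := by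
    have : (m : ℝ) < n := by exact_mod_cast hm
    refine Real.cos_pos_of_mem_Ioo ⟨?_, ?_⟩
    · have : 0 ≤ m * Real.pi / (2 * n) := by positivity
      linarith
    · rw [div_lt_div_iff₀ (by positivity) (by positivity)]
      nlinarith
  have h1 : ∀ N : ℕ, (∑ k ∈ Finset.range N, (-1) ^ k * Real.sin (m * zeroAngle n k)) *
      (2 * Real.cos (m * Real.pi / (2 * n))) = -(-1) ^ N * Real.sin (m * N * Real.pi / n) := by
    intro N
    induction N with
    | zero => simp
    | succ N ih =>
      rw [Finset.sum_range_succ, add_mul, ih]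
      have e1 : m * ((N + 1 : ℕ) : ℝ) * Real.pi / n =
          m * zeroAngle n N + m * Real.pi / (2 * n) := by
        unfold zeroAngle
        push_cast
        field_simp
        ring
      have e2 : m * (N : ℝ) * Real.pi / n = m * zeroAngle n N - m * Real.pi / (2 * n) := by
        unfold zeroAngle
        field_simp
        ring
      rw [e1, e2, Real.sin_add, Real.sin_sub]
      ring
  have h2 := h1 (2 * n)
  have e3 : m * ((2 * n : ℕ) : ℝ) * Real.pi / n = ((2 * m : ℕ) : ℝ) * Real.pi := by
    push_cast
    field_simp
  rw [e3, Real.sin_nat_mul_pi, mul_zero] at h2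
  exact (mul_eq_zero.1 h2).resolve_right (by positivity)

theorem sum_riesz_sin_rec {n : ℕ} (m : ℕ) :
    ∑ k ∈ Finset.range (2 * n), (-1) ^ k * rieszWeight n k * Real.sin ((m + 2 : ℕ) * zeroAngle n k)
    = 2 * ∑ k ∈ Finset.range (2 * n),
        (-1) ^ k * rieszWeight n k * Real.sin ((m + 1 : ℕ) * zeroAngle n k)
      - ∑ k ∈ Finset.range (2 * n), (-1) ^ k * rieszWeight n k * Real.sin (m * zeroAngle n k)
      - 1 / n * ∑ k ∈ Finset.range (2 * n), (-1) ^ k * Real.sin ((m + 1 : ℕ) * zeroAngle n k) := by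
  rw [Finset.mul_sum, Finset.mul_sum, ← Finset.sum_sub_distrib, ← Finset.sum_sub_distrib]
  refine Finset.sum_congr rfl fun k hk => ?_
  have hk := Finset.mem_range.1 hk
  have hn : (n : ℝ) ≠ 0 := by exact_mod_cast (by omega : n ≠ 0)
  have hz := zeroAngle_mem_two hk
  have hs : Real.sin (zeroAngle n k / 2) ≠ 0 :=
    (Real.sin_pos_of_pos_of_lt_pi (by linarith [hz.1]) (by linarith [hz.2])).ne'
  set φ := zeroAngle n k with hφ
  have e1 : ((m + 2 : ℕ) : ℝ) * φ = (m + 1 : ℕ) * φ + φ := by push_cast; ring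
  have e2 : (m : ℝ) * φ = (m + 1 : ℕ) * φ - φ := by push_cast; ring
  have e3 : Real.cos φ = 1 - 2 * Real.sin (φ / 2) ^ 2 := by
    rw [← Real.cos_sq_add_sin_sq (φ / 2), show Real.cos φ = Real.cos (2 * (φ / 2)) by ring_nf,
      Real.cos_two_mul']
    ring
  have e4 : rieszWeight n k * Real.sin (φ / 2) ^ 2 = 1 / (4 * n) := by
    unfold rieszWeight
    rw [← hφ]
    field_simp
  rw [e1, e2, Real.sin_add, Real.sin_sub, e3]
  have e5 : (1 : ℝ) / n = 4 * (rieszWeight n k * Real.sin (φ / 2) ^ 2) := by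
    rw [e4]; field_simp
  rw [e5]
  ring

theorem sum_riesz_sin {n m : ℕ} (hn : n ≠ 0) (hm : m ≤ n) :
    ∑ k ∈ Finset.range (2 * n), (-1) ^ k * rieszWeight n k * Real.sin (m * zeroAngle n k) = m := by
  have hn0 : (n : ℝ) ≠ 0 := by exact_mod_cast hn
  set S : ℕ → ℝ := fun m => ∑ k ∈ Finset.range (2 * n),
    (-1) ^ k * rieszWeight n k * Real.sin (m * zeroAngle n k) with hS
  have hrec : ∀ m, S (m + 2) = 2 * S (m + 1) - S m -
      1 / n * ∑ k ∈ Finset.range (2 * n), (-1) ^ k * Real.sin ((m + 1 : ℕ) * zeroAngle n k) :=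
    fun m => sum_riesz_sin_rec m
  have h0 : S 0 = 0 := by simp [hS]
  have hlin : ∀ m, m + 1 ≤ n → S m = m * S 1 ∧ S (m + 1) = (m + 1) * S 1 := by
    intro m
    induction m with
    | zero => intro _; simp [h0]
    | succ m ih =>
      intro hm
      obtain ⟨h1, h2⟩ := ih (by omega)
      refine ⟨by rw [h2]; push_cast; ring, ?_⟩
      rw [hrec m, sum_sin_zeroAngle (by omega), h1, h2]
      push_cast
      ring
  obtain ⟨p, rfl⟩ : ∃ p, n = p + 1 := ⟨n - 1, by omega⟩
  -- the second difference at `m = n`, where the sum over the nodes is `2n` and not `0`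
  have hsym : S (p + 2) = S p := by
    refine Finset.sum_congr rfl fun k _ => ?_
    have e1 : ((p + 2 : ℕ) : ℝ) * zeroAngle (p + 1) k =
      (p + 1 : ℕ) * zeroAngle (p + 1) k + zeroAngle (p + 1) k := by push_cast; ring
    have e2 : (p : ℝ) * zeroAngle (p + 1) k =
      (p + 1 : ℕ) * zeroAngle (p + 1) k - zeroAngle (p + 1) k := by push_cast; ring
    rw [e1, e2, Real.sin_add, Real.sin_sub, cos_nat_mul_zeroAngle hn]
    ring
  have hsum : ∑ k ∈ Finset.range (2 * (p + 1)),
      (-1) ^ k * Real.sin ((p + 1 : ℕ) * zeroAngle (p + 1) k) = 2 * (p + 1 : ℕ) := by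
    rw [Finset.sum_congr rfl (g := fun _ => (1 : ℝ))]
    · simp
    · intro k _
      rw [sin_nat_mul_zeroAngle hn, ← mul_pow]
      simp
  have h3 := hrec p
  rw [hsym, hsum] at h3
  obtain ⟨h4, h5⟩ := hlin p le_rfl
  have h6 : 1 / ((p + 1 : ℕ) : ℝ) * (2 * (p + 1 : ℕ)) = 2 := by field_simp
  have h7 : S 1 = 1 := by
    rw [h6, h4, h5] at h3
    linarith
  rcases m with _ | m
  · simp
  · have := (hlin m (by omega)).2
    rw [h7, mul_one] at this
    change S (m + 1) = _
    rw [this]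
    push_cast
    ring

/-- The interpolation formula of M. Riesz for an even trigonometric polynomial. -/
theorem riesz_formula {n : ℕ} (hn : n ≠ 0) {p : ℝ[X]} (hp : p.degree < (n + 1 : ℕ)) (t : ℝ) :
    (derivative p).eval (Real.cos t) * Real.sin t = -∑ k ∈ Finset.range (2 * n),
      (-1) ^ k * rieszWeight n k * p.eval (Real.cos (t + zeroAngle n k)) := by
  have hmem : p ∈ degreeLT ℝ (n + 1) := by rwa [mem_degreeLT]
  rw [← Sequence.span_degreeLT (chebyshevTsequence ℝ) (by simp)] at hmem
  clear hp
  induction hmem using Submodule.span_induction with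
  | mem x hx =>
    obtain ⟨m, hm, rfl⟩ := hx
    have hm : m ≤ n := Nat.lt_succ_iff.1 hm
    change (derivative (T ℝ m)).eval _ * _ = -∑ k ∈ _, _ * (T ℝ m).eval _
    rw [eval_derivative_T_mul_sin]
    have h1 := sum_riesz_sin hn hm
    have h2 := sum_riesz_cos n m
    have h3 : ∀ k, (-1) ^ k * rieszWeight n k * (T ℝ m).eval (Real.cos (t + zeroAngle n k)) =
        Real.cos (m * t) * ((-1) ^ k * rieszWeight n k * Real.cos (m * zeroAngle n k)) -
        Real.sin (m * t) * ((-1) ^ k * rieszWeight n k * Real.sin (m * zeroAngle n k)) := by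
      intro k
      rw [T_real_cos]
      push_cast
      rw [mul_add, Real.cos_add]
      ring
    simp_rw [h3]
    rw [Finset.sum_sub_distrib, ← Finset.mul_sum, ← Finset.mul_sum, h1, h2]
    ring
  | zero => simp
  | add x y _ _ hx hy =>
    simp only [derivative_add, eval_add, add_mul, mul_add, Finset.sum_add_distrib, neg_add] at *
    rw [hx, hy]
  | smul a x _ hx =>
    simp only [derivative_smul, eval_smul, smul_eq_mul]
    rw [mul_assoc, hx, mul_neg, Finset.mul_sum]
    congr 1
    refine Finset.sum_congr rfl fun k _ => by ring

/-- Bernstein's inequality. -/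
theorem bernstein {n : ℕ} (hn : n ≠ 0) {p : ℝ[X]} (hp : p.degree < (n + 1 : ℕ)) {W : ℝ}
    (hW : ∀ x ∈ Icc (-1 : ℝ) 1, |p.eval x| ≤ W) (t : ℝ) :
    |(derivative p).eval (Real.cos t) * Real.sin t| ≤ n * W := by
  rw [riesz_formula hn hp, abs_neg]
  have h1 := sum_riesz_sin hn (le_refl n)
  rw [← h1, Finset.sum_mul]
  refine (Finset.abs_sum_le_sum_abs _ _).trans (Finset.sum_le_sum fun k _ => ?_)
  rw [abs_mul, abs_mul, abs_pow, abs_neg, abs_one, one_pow, one_mul,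
    abs_of_nonneg (rieszWeight_nonneg n k), sin_nat_mul_zeroAngle hn, mul_right_comm ((-1 : ℝ) ^ k),
    ← mul_pow, neg_one_mul, neg_neg, one_pow, one_mul]
  exact mul_le_mul_of_nonneg_left (hW _ (Real.cos_mem_Icc _)) (rieszWeight_nonneg n k)

theorem abs_sin_nat_mul_le (n : ℕ) (t : ℝ) : |Real.sin (n * t)| ≤ n * |Real.sin t| := by
  induction n with
  | zero => simp
  | succ n ih =>
    push_cast
    rw [add_mul, one_mul, Real.sin_add, add_mul, one_mul]
    refine (abs_add_le _ _).trans (add_le_add ?_ ?_)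
    · rw [abs_mul]
      exact (mul_le_of_le_one_right (abs_nonneg _) (Real.abs_cos_le_one _)).trans ih
    · rw [abs_mul]
      exact mul_le_of_le_one_left (abs_nonneg _) (Real.abs_cos_le_one _)

/-- `|T_n'| ≤ n²` on `[-1, 1]`; at the end points the bound is obtained by continuity. -/
theorem abs_eval_derivative_T_le (n : ℕ) {x : ℝ} (hx : x ∈ Icc (-1 : ℝ) 1) :
    |(derivative (T ℝ n)).eval x| ≤ (n : ℝ) ^ 2 := by
  have h1 : ∀ x ∈ Ioo (-1 : ℝ) 1, |(derivative (T ℝ n)).eval x| ≤ (n : ℝ) ^ 2 := by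
    intro x hx
    have hs : 0 < Real.sin (Real.arccos x) := by
      rw [Real.sin_arccos]
      apply Real.sqrt_pos.2
      nlinarith [hx.1, hx.2]
    have h := eval_derivative_T_mul_sin n (Real.arccos x)
    rw [Real.cos_arccos hx.1.le hx.2.le] at h
    have h2 := abs_sin_nat_mul_le n (Real.arccos x)
    have h3 := congrArg abs h
    rw [abs_mul, abs_mul, abs_of_pos hs, Nat.abs_cast] at h3
    rw [abs_of_pos hs] at h2
    refine le_of_mul_le_mul_right ?_ hs
    rw [h3, sq, mul_assoc]
    exact mul_le_mul_of_nonneg_left h2 (Nat.cast_nonneg n)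
  have h2 : Icc (-1 : ℝ) 1 = closure (Ioo (-1) 1) := (closure_Ioo (by norm_num)).symm
  rw [h2] at hx
  exact closure_minimal (s := Ioo (-1 : ℝ) 1) (t := {x | |(derivative (T ℝ n)).eval x| ≤ (n : ℝ) ^ 2})
    h1 (isClosed_le (by fun_prop) continuous_const) hx

/-- Schur's step from Bernstein's to Markov's inequality, to the right or to the left of all zeros
of `T_n`: there the terms of `T_n'(x) / T_n(x) = ∑ 1 / (x - x_k)` all have the same sign. -/
theorem schur_outside {n : ℕ} {q : ℝ[X]} (hq : q.degree < n) {W : ℝ}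
    (hW : ∀ t, |q.eval (Real.cos t) * Real.sin t| ≤ n * W) {x : ℝ} (hx : x ∈ Icc (-1 : ℝ) 1)
    (h : (∀ k < n, Real.cos (zeroAngle n k) < x) ∨ ∀ k < n, x < Real.cos (zeroAngle n k))
    (hW0 : 0 ≤ W) : |q.eval x| ≤ (n : ℝ) ^ 2 * W := by
  set v : ℕ → ℝ := fun k => Real.cos (zeroAngle n k) with hv
  have hne : ∀ i ∈ Finset.range n, x ≠ v i := by
    intro i hi
    have hi := Finset.mem_range.1 hi
    rcases h with h | h
    · exact (h i hi).ne'
    · exact (h i hi).ne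
  have h1 := Lagrange.eq_interpolate (injOn_cos_zeroAngle n) (f := q) (by simpa using hq)
  have h2 := Lagrange.eval_interpolate_not_at_node (s := Finset.range n) (v := v)
    (fun i => q.eval (Real.cos (zeroAngle n i))) hne
  rw [← h1] at h2
  have h3 : (derivative (Lagrange.nodal (Finset.range n) v)).eval x =
      (Lagrange.nodal (Finset.range n) v).eval x * ∑ k ∈ Finset.range n, (x - v k)⁻¹ := by
    rw [Lagrange.derivative_nodal, eval_finsetSum, Finset.mul_sum]
    refine Finset.sum_congr rfl fun k hk => ?_
    rw [Lagrange.nodal_eq_mul_nodal_erase hk, eval_mul]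
    have := sub_ne_zero.2 (hne k hk)
    simp only [eval_sub, eval_X, eval_C]
    field_simp
  have h4 : |∑ k ∈ Finset.range n, (x - v k)⁻¹| = ∑ k ∈ Finset.range n, |(x - v k)⁻¹| := by
    rcases h with h | h
    · rw [Finset.abs_sum_of_nonneg]
      · refine Finset.sum_congr rfl fun k hk => ?_
        rw [abs_of_nonneg]
        exact inv_nonneg.2 (sub_nonneg.2 (h k (Finset.mem_range.1 hk)).le)
      · exact fun k hk => inv_nonneg.2 (sub_nonneg.2 (h k (Finset.mem_range.1 hk)).le)
    · rw [← abs_neg, ← Finset.sum_neg_distrib, Finset.abs_sum_of_nonneg]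
      · refine Finset.sum_congr rfl fun k hk => ?_
        rw [abs_of_nonpos]
        exact inv_nonpos.2 (sub_nonpos.2 (h k (Finset.mem_range.1 hk)).le)
      · intro k hk
        exact neg_nonneg.2 (inv_nonpos.2 (sub_nonpos.2 (h k (Finset.mem_range.1 hk)).le))
  have h5 := abs_eval_derivative_T_le n hx
  rw [derivative_T_eq_nodal, h3, abs_mul, abs_mul, h4, abs_of_pos (by positivity)] at h5
  have h6 : |∑ i ∈ Finset.range n, Lagrange.nodalWeight (Finset.range n) v i * (x - v i)⁻¹ *
      q.eval (Real.cos (zeroAngle n i))| ≤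
      2 ^ (n - 1) * W * ∑ k ∈ Finset.range n, |(x - v k)⁻¹| := by
    refine (Finset.abs_sum_le_sum_abs _ _).trans ?_
    rw [Finset.mul_sum]
    refine Finset.sum_le_sum fun k hk => ?_
    have hk := Finset.mem_range.1 hk
    have hs := sin_zeroAngle_pos hk
    have hn : (0 : ℝ) < n := by exact_mod_cast (by omega : 0 < n)
    have h7 := hW (zeroAngle n k)
    rw [abs_mul, abs_of_pos hs] at h7
    rw [abs_mul, abs_mul, abs_nodalWeight_zeroAngle hk]
    calc 2 ^ (n - 1) * Real.sin (zeroAngle n k) / n * |(x - v k)⁻¹| *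
          |q.eval (Real.cos (zeroAngle n k))|
        = 2 ^ (n - 1) / n * |(x - v k)⁻¹| *
          (|q.eval (Real.cos (zeroAngle n k))| * Real.sin (zeroAngle n k)) := by ring
      _ ≤ 2 ^ (n - 1) / n * |(x - v k)⁻¹| * (n * W) :=
          mul_le_mul_of_nonneg_left h7 (by positivity)
      _ = 2 ^ (n - 1) * W * |(x - v k)⁻¹| := by field_simp
  rw [h2, abs_mul]
  calc |(Lagrange.nodal (Finset.range n) v).eval x| * |_|
      ≤ |(Lagrange.nodal (Finset.range n) v).eval x| *
        (2 ^ (n - 1) * W * ∑ k ∈ Finset.range n, |(x - v k)⁻¹|) :=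
        mul_le_mul_of_nonneg_left h6 (abs_nonneg _)
    _ = 2 ^ (n - 1) * (|(Lagrange.nodal (Finset.range n) v).eval x| *
        ∑ k ∈ Finset.range n, |(x - v k)⁻¹|) * W := by ring
    _ ≤ _ := mul_le_mul_of_nonneg_right h5 hW0

/-- The inequality of A. A. Markov. -/
theorem markov {n : ℕ} {p : ℝ[X]} (hp : p.natDegree ≤ n) {W : ℝ}
    (hW : ∀ x ∈ Icc (-1 : ℝ) 1, |p.eval x| ≤ W) {x : ℝ} (hx : x ∈ Icc (-1 : ℝ) 1) :
    |(derivative p).eval x| ≤ (n : ℝ) ^ 2 * W := by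
  have hW0 : 0 ≤ W := (abs_nonneg _).trans (hW x hx)
  rcases Nat.eq_zero_or_pos n with rfl | hn
  · rw [natDegree_eq_zero.1 (Nat.le_zero.1 hp) |>.choose_spec.symm]
    simp
  have hn' : (0 : ℝ) < n := by exact_mod_cast hn
  have hpi := Real.pi_pos
  have hB := bernstein hn.ne' (degree_le_natDegree.trans_lt
    (by exact_mod_cast Nat.lt_succ_of_le hp)) hW
  have hmono : ∀ k < n, zeroAngle n 0 ≤ zeroAngle n k ∧ zeroAngle n k ≤ Real.pi - zeroAngle n 0 := by
    intro k hk
    refine ⟨(zeroAngle_strictMono hn.ne').monotone (Nat.zero_le k), ?_⟩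
    have : (k : ℝ) + 1 ≤ n := by exact_mod_cast hk
    unfold zeroAngle
    rw [le_sub_iff_add_le, ← add_div, div_le_iff₀ (by positivity)]
    push_cast
    nlinarith
  have h0 := zeroAngle_mem (n := n) hn
  by_cases hout : (∀ k < n, Real.cos (zeroAngle n k) < x) ∨ ∀ k < n, x < Real.cos (zeroAngle n k)
  · refine schur_outside ?_ hB hx hout hW0
    refine degree_le_natDegree.trans_lt ?_
    have := natDegree_derivative_le p
    exact_mod_cast (by omega : (derivative p).natDegree < n)
  -- otherwise `x = cos t` with `sin t ≥ sin (π / (2n)) ≥ 1 / n`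
  push Not at hout
  obtain ⟨⟨k, hk, hxk⟩, l, hl, hxl⟩ := hout
  have h1 : x ≤ Real.cos (zeroAngle n 0) := hxk.trans
    (Real.cos_le_cos_of_nonneg_of_le_pi h0.1.le (zeroAngle_mem hk).2.le (hmono k hk).1)
  have h2 : -Real.cos (zeroAngle n 0) ≤ x := by
    rw [← Real.cos_pi_sub]
    exact (Real.cos_le_cos_of_nonneg_of_le_pi (zeroAngle_mem hl).1.le
      (by linarith [h0.1]) (hmono l hl).2).trans hxl
  have hz : zeroAngle n 0 = Real.pi / (2 * n) := by
    unfold zeroAngle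
    simp
  have hs0 : 1 / (n : ℝ) ≤ Real.sin (zeroAngle n 0) := by
    have h1n : (1 : ℝ) ≤ n := by exact_mod_cast hn
    have := Real.mul_le_sin h0.1.le (by
      rw [hz]
      exact div_le_div_of_nonneg_left hpi.le (by norm_num) (by linarith))
    refine le_trans (le_of_eq ?_) this
    rw [hz]
    field_simp
  have hs : 1 / (n : ℝ) ≤ Real.sin (Real.arccos x) := by
    refine hs0.trans ?_
    rw [Real.sin_arccos]
    refine Real.le_sqrt_of_sq_le ?_
    rw [Real.sin_sq]
    nlinarith
  have h3 := hB (Real.arccos x)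
  rw [Real.cos_arccos hx.1 hx.2, abs_mul, abs_of_pos (lt_of_lt_of_le (by positivity) hs)] at h3
  have h4 := (mul_le_mul_of_nonneg_left hs (abs_nonneg ((derivative p).eval x))).trans h3
  rw [mul_one_div, div_le_iff₀ hn'] at h4
  calc _ ≤ _ := h4
    _ = _ := by ring

end ContFrac

/-! ### Trigonometric sums over the Chebyshev zeros -/

namespace ContFrac
open Real

/-- Midpoint (Hermite–Hadamard) estimate for the convex function `t ↦ sin t / (cos θ - cos t)`, the
derivative of `log (cos θ - cos t)`. -/
theorem midpoint_le_log_sub {θ t s : ℝ} (hθ : 0 < θ) (hs : 0 ≤ s) (h1 : θ < t - s)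
    (h2 : t + s ≤ π) : 2 * s * (sin t / (cos θ - cos t)) ≤
      log (cos θ - cos (t + s)) - log (cos θ - cos (t - s)) := by
  have hcos : ∀ y, θ < y → y ≤ π → 0 < cos θ - cos y := fun y h3 h4 =>
    sub_pos.2 (cos_lt_cos_of_nonneg_of_le_pi hθ.le h4 h3)
  have ht : 0 < cos θ - cos t := hcos t (by linarith) (by linarith)
  set g : ℝ → ℝ := fun y => log (cos θ - cos (t + y)) - log (cos θ - cos (t - y)) -
    2 * y * (sin t / (cos θ - cos t)) with hg
  have hd : ∀ y ∈ Icc 0 s, HasDerivAt g (sin (t + y) / (cos θ - cos (t + y)) +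
      sin (t - y) / (cos θ - cos (t - y)) - 2 * (sin t / (cos θ - cos t))) y := by
    intro y hy
    have e1 : HasDerivAt (fun y => t + y) 1 y := (hasDerivAt_id y).const_add t
    have e2 : HasDerivAt (fun y => t - y) (-1) y := (hasDerivAt_id y).const_sub t
    have e3 := ((e1.cos.const_sub (cos θ)).log (hcos (t + y) (by linarith [hy.1]) (by linarith [hy.2])).ne')
    have e4 := ((e2.cos.const_sub (cos θ)).log (hcos (t - y) (by linarith [hy.2]) (by linarith [hy.1])).ne')
    have e5 : HasDerivAt (fun y : ℝ => 2 * y * (sin t / (cos θ - cos t)))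
        (2 * 1 * (sin t / (cos θ - cos t))) y := ((hasDerivAt_id y).const_mul 2).mul_const _
    refine ((e3.sub e4).sub e5).congr_deriv ?_
    ring
  have hmono : MonotoneOn g (Icc 0 s) := by
    refine monotoneOn_of_deriv_nonneg (convex_Icc 0 s)
      (fun y hy => (hd y hy).continuousAt.continuousWithinAt)
      (fun y hy => (hd y (interior_subset hy)).differentiableAt.differentiableWithinAt) ?_
    intro y hy
    rw [interior_Icc] at hy
    rw [(hd y (Ioo_subset_Icc_self hy)).deriv]
    have p1 := hcos (t + y) (by linarith [hy.1]) (by linarith [hy.2])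
    have p2 := hcos (t - y) (by linarith [hy.2]) (by linarith [hy.1])
    have q1 : cos t ≤ cos y :=
      cos_le_cos_of_nonneg_of_le_pi hy.1.le (by linarith [hy.1]) (by linarith [hy.2])
    have q2 : -cos y ≤ cos t := by
      rw [← cos_pi_sub]
      exact cos_le_cos_of_nonneg_of_le_pi (by linarith [hy.2]) (by linarith [hy.1])
        (by linarith [hy.2])
    have hst : 0 ≤ sin t := sin_nonneg_of_nonneg_of_le_pi (by linarith) (by linarith)
    have hC := sin_sq_add_cos_sq θ
    have q3 : cos θ * cos t ≤ cos y := by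
      have h5 : |cos θ| ≤ 1 := abs_cos_le_one θ
      have h6 : |cos t| ≤ cos y := abs_le.2 ⟨q2, q1⟩
      calc cos θ * cos t ≤ |cos θ * cos t| := le_abs_self _
        _ = |cos θ| * |cos t| := abs_mul _ _
        _ ≤ 1 * |cos t| := mul_le_mul_of_nonneg_right h5 (abs_nonneg _)
        _ ≤ cos y := by rwa [one_mul]
    rw [div_add_div _ _ p1.ne' p2.ne', sub_nonneg, mul_div_assoc', div_le_div_iff₀ ht (mul_pos p1 p2)]
    rw [cos_add, cos_sub, sin_add, sin_sub]
    have hy1 := sin_sq_add_cos_sq y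
    have ht1 := sin_sq_add_cos_sq t
    have key : (sin t * cos y + cos t * sin y) * (cos θ - (cos t * cos y + sin t * sin y)) +
        (cos θ - (cos t * cos y - sin t * sin y)) * (sin t * cos y - cos t * sin y) =
        2 * sin t * (cos θ * cos y - cos t) := by
      linear_combination (-(2 * sin t * cos t)) * hy1
    have key2 : (cos θ - (cos t * cos y - sin t * sin y)) * (cos θ - (cos t * cos y + sin t * sin y))
        = cos θ ^ 2 - 2 * cos θ * cos t * cos y + cos t ^ 2 - sin y ^ 2 := by
      linear_combination (cos t ^ 2) * hy1 - sin y ^ 2 * ht1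
    have key3 : cos θ ^ 2 - 2 * cos θ * cos t * cos y + cos t ^ 2 - sin y ^ 2 ≤
        (cos θ * cos y - cos t) * (cos θ - cos t) := by
      have : 0 ≤ (1 - cos y) * (1 + cos y - cos θ ^ 2 - cos θ * cos t) :=
        mul_nonneg (by linarith [cos_le_one y]) (by nlinarith)
      nlinarith
    have := mul_le_mul_of_nonneg_left key3 (mul_nonneg (zero_le_two (α := ℝ)) hst)
    refine le_trans (le_of_eq ?_) (this.trans (le_of_eq ?_))
    · linear_combination (2 * sin t) * key2
    · linear_combination (-(cos θ - cos t)) * key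
  have := hmono ⟨le_rfl, hs⟩ ⟨hs, le_rfl⟩ hs
  simp only [hg, add_zero, sub_zero, sub_self, mul_zero, zero_mul] at this
  linarith

theorem cos_le_one_sub_four_div_pi_sq {x : ℝ} (hx : |x| ≤ π / 2) :
    cos x ≤ 1 - 4 / π ^ 2 * x ^ 2 := by
  have hpi := pi_pos
  have h1 : √2 / π * |x| ≤ sin (|x| / 2) := by
    have hl : 2 * |x| / π ≤ 1 := by rw [div_le_one hpi]; linarith
    have hl0 : 0 ≤ 2 * |x| / π := by positivity
    have := strictConcaveOn_sin_Icc.concaveOn.2 (x := 0) (y := π / 4) ⟨le_rfl, hpi.le⟩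
      ⟨by positivity, by linarith⟩ (sub_nonneg.2 hl) hl0 (by ring)
    simp only [smul_eq_mul, sin_zero, mul_zero, zero_add, sin_pi_div_four] at this
    rw [show 2 * |x| / π * (π / 4) = |x| / 2 by field_simp; ring] at this
    refine le_trans (le_of_eq ?_) this
    field_simp
  have h2 : cos x = 1 - 2 * sin (|x| / 2) ^ 2 := by
    rw [← cos_abs x, ← cos_sq_add_sin_sq (|x| / 2),
      show cos |x| = cos (2 * (|x| / 2)) by ring_nf, cos_two_mul']
    ring
  have h3 := pow_le_pow_left₀ (by positivity) h1 2
  rw [mul_pow, div_pow, sq_sqrt zero_le_two, sq_abs] at h3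
  rw [h2]
  have : 4 / π ^ 2 * x ^ 2 = 2 * (2 / π ^ 2 * x ^ 2) := by ring
  linarith

/-- The terms of the two zeros `c ± a` adjacent to `c + δ`. -/
theorem adjacent_le {c a δ : ℝ} (ha : 0 < a) (h1 : a ≤ c) (h2 : c + a ≤ π) (hδ : |δ| < a) :
    sin (c + a) / (cos (c + δ) - cos (c + a)) + sin (c - a) / (cos (c - a) - cos (c + δ)) ≤
      2 * a / (a ^ 2 - δ ^ 2) := by
  obtain ⟨d1, d2⟩ := abs_lt.1 hδ
  set B₁ := (a - δ) / 2 with hB₁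
  set B₂ := (a + δ) / 2 with hB₂
  set A₁ := c + B₂ with hA₁
  set A₂ := c - B₁ with hA₂
  have s1 : 0 < sin B₁ := sin_pos_of_pos_of_lt_pi (by linarith) (by linarith)
  have s2 : 0 < sin B₂ := sin_pos_of_pos_of_lt_pi (by linarith) (by linarith)
  have s3 : 0 < sin A₁ := sin_pos_of_pos_of_lt_pi (by linarith) (by linarith)
  have s4 : 0 < sin A₂ := sin_pos_of_pos_of_lt_pi (by linarith) (by linarith)
  have cot_le : ∀ x, 0 < x → x < π / 2 → cos x / sin x ≤ 1 / x := by
    intro x hx hx2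
    have h3 := lt_tan hx hx2
    have hc : 0 < cos x := cos_pos_of_mem_Ioo ⟨by linarith, hx2⟩
    rw [tan_eq_sin_div_cos, lt_div_iff₀ hc] at h3
    rw [div_le_div_iff₀ (sin_pos_of_pos_of_lt_pi hx (by linarith)) hx]
    linarith
  have e1 : sin (c + a) / (cos (c + δ) - cos (c + a)) =
      (cos B₁ / sin B₁ + cos A₁ / sin A₁) / 2 := by
    rw [show c + a = A₁ + B₁ by rw [hA₁, hB₁, hB₂]; ring,
      show c + δ = A₁ - B₁ by rw [hA₁, hB₁, hB₂]; ring]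
    rw [cos_add, cos_sub, sin_add]
    field_simp
    ring
  have e2 : sin (c - a) / (cos (c - a) - cos (c + δ)) =
      (cos B₂ / sin B₂ - cos A₂ / sin A₂) / 2 := by
    rw [show c - a = A₂ - B₂ by rw [hA₂, hB₁, hB₂]; ring,
      show c + δ = A₂ + B₂ by rw [hA₂, hB₁, hB₂]; ring]
    rw [cos_add, cos_sub, sin_sub]
    field_simp
    ring
  have e3 : cos A₁ / sin A₁ ≤ cos A₂ / sin A₂ := by
    rw [div_le_div_iff₀ s3 s4]
    have : 0 ≤ sin (A₁ - A₂) := sin_nonneg_of_nonneg_of_le_pi (by linarith) (by linarith)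
    rw [sin_sub] at this
    linarith
  have e4 := cot_le B₁ (by linarith) (by linarith)
  have e5 := cot_le B₂ (by linarith) (by linarith)
  have e6 : 2 * a / (a ^ 2 - δ ^ 2) = (1 / B₁ + 1 / B₂) / 2 := by
    rw [hB₁, hB₂]
    have x1 : a - δ ≠ 0 := by linarith
    have x2 : a + δ ≠ 0 := by linarith
    rw [show a ^ 2 - δ ^ 2 = (a - δ) * (a + δ) by ring]
    field_simp
    ring
  rw [e1, e2, e6]
  linarith

theorem sum_right_le {n m : ℕ} {t : ℝ} (ht : 0 < t) (hn : n ≠ 0) (h1 : t < (m + 1) * (π / n))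
    {N : ℕ} (hmN : m + 1 ≤ N) (hN : N ≤ n) :
    π / n * ∑ k ∈ Finset.Ico (m + 1) N, sin (zeroAngle n k) / (cos t - cos (zeroAngle n k)) ≤
      log (cos t - cos (N * (π / n))) - log (cos t - cos ((m + 1) * (π / n))) := by
  have hpi := pi_pos
  have hn0 : (0 : ℝ) < n := by exact_mod_cast Nat.pos_of_ne_zero hn
  induction N, hmN using Nat.le_induction with
  | base => simp
  | succ N hmN ih =>
    rw [Finset.sum_Ico_succ_top hmN, mul_add]
    have hN' : (N : ℝ) + 1 ≤ n := by exact_mod_cast hN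
    have hmN' : (m : ℝ) + 1 ≤ N := by exact_mod_cast hmN
    have e1 : zeroAngle n N - π / n / 2 = N * (π / n) := by
      unfold zeroAngle
      field_simp
      ring
    have e2 : zeroAngle n N + π / n / 2 = (N + 1 : ℕ) * (π / n) := by
      unfold zeroAngle
      push_cast
      field_simp
      ring
    have hd : 0 < π / n := by positivity
    have h3 := midpoint_le_log_sub (θ := t) (t := zeroAngle n N) (s := π / n / 2) ht
      (by positivity) (by rw [e1]; nlinarith) (by
        rw [e2]; push_cast; rw [mul_div_assoc', div_le_iff₀ hn0]; nlinarith)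
    rw [e1, e2, show 2 * (π / n / 2) = π / n by ring] at h3
    linarith [ih (by omega)]

theorem zeroAngle_sub {n k : ℕ} (hk : k < n) : zeroAngle n (n - 1 - k) = π - zeroAngle n k := by
  have hn : (n : ℝ) ≠ 0 := by exact_mod_cast (by omega : n ≠ 0)
  have : ((n - 1 - k : ℕ) : ℝ) = n - 1 - k := by
    rw [Nat.cast_sub (by omega), Nat.cast_sub (by omega)]
    push_cast
    ring
  unfold zeroAngle
  rw [this]
  field_simp
  ring

/-- The mirror image of `sum_right_le` under `t ↦ π - t`. -/
theorem sum_left_le {n m : ℕ} {t : ℝ} (ht : t < π) (hm : m < n) (h1 : m * (π / n) < t) :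
    π / n * ∑ k ∈ Finset.range m, sin (zeroAngle n k) / (cos (zeroAngle n k) - cos t) ≤
      log (1 - cos t) - log (cos (m * (π / n)) - cos t) := by
  have hn : n ≠ 0 := by omega
  have hn0 : (n : ℝ) ≠ 0 := by exact_mod_cast hn
  have hc : ((n - 1 - m : ℕ) : ℝ) + 1 = n - m := by
    rw [Nat.cast_sub (by omega), Nat.cast_sub (by omega)]
    push_cast
    ring
  have e0 : (((n - 1 - m : ℕ) : ℝ) + 1) * (π / n) = π - m * (π / n) := by
    rw [hc]
    field_simp
  have h2 := sum_right_le (n := n) (m := n - 1 - m) (t := π - t) (by linarith) hn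
    (by rw [e0]; linarith) (N := n) (by omega) le_rfl
  rw [e0, mul_div_cancel₀ _ hn0, cos_pi, cos_pi_sub, cos_pi_sub] at h2
  have e1 : ∑ k ∈ Finset.Ico (n - 1 - m + 1) n, sin (zeroAngle n k) / (-cos t - cos (zeroAngle n k))
      = ∑ k ∈ Finset.range m, sin (zeroAngle n k) / (cos (zeroAngle n k) - cos t) := by
    refine Finset.sum_bij' (fun k _ => n - 1 - k) (fun k _ => n - 1 - k) ?_ ?_ ?_ ?_ ?_
    · intro k hk
      simp only [Finset.mem_Ico, Finset.mem_range] at *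
      omega
    · intro k hk
      simp only [Finset.mem_Ico, Finset.mem_range] at *
      omega
    · intro k hk
      simp only [Finset.mem_Ico] at hk
      omega
    · intro k hk
      simp only [Finset.mem_range] at hk
      omega
    · intro k hk
      simp only [Finset.mem_Ico] at hk
      rw [zeroAngle_sub hk.2, sin_pi_sub, cos_pi_sub]
      congr 1
      ring
  rw [e1] at h2
  convert h2 using 3 <;> ring

theorem le_concave_quadratic {A B D x x₁ x₂ V : ℝ} (hD : 0 ≤ D) (h1 : x₁ ≤ x) (h2 : x ≤ x₂)
    (hV1 : V ≤ A + B * x₁ - D * x₁ ^ 2) (hV2 : V ≤ A + B * x₂ - D * x₂ ^ 2) :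
    V ≤ A + B * x - D * x ^ 2 := by
  by_contra! h
  have h3 : 0 < (x - x₁) * (D * (x₁ + x) - B) := by nlinarith
  have h4 : 0 < (x₂ - x) * (B - D * (x₂ + x)) := by nlinarith
  have h5 := pos_of_mul_pos_right h3 (sub_nonneg.2 h1)
  have h6 := pos_of_mul_pos_right h4 (sub_nonneg.2 h2)
  nlinarith [mul_nonneg hD (sub_nonneg.2 (h1.trans h2))]

/-- Lower bound for the arguments of the logarithms in the Lebesgue function. The ratio to
`sin² θ` is a concave quadratic polynomial in `cot θ`, so it is smallest when `c = d` or
`c = π - d`. -/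
theorem sin_sq_mul_le {c d δ : ℝ} (hd : 0 < d) (h1 : d ≤ c) (h2 : c + d ≤ π) (hδ : |δ| < d) :
    sin (c + δ) ^ 2 * (1 - cos d ^ 2 / cos ((d + |δ|) / 2) ^ 2) ≤
      (cos (c + δ) - cos (c + d)) * (cos (c - d) - cos (c + δ)) := by
  obtain ⟨d1, d2⟩ := abs_lt.1 hδ
  have a1 := le_abs_self δ
  have a2 := neg_abs_le δ
  set e := (d + δ) / 2 with he
  set e' := (d - δ) / 2 with he'
  set t := c + δ with ht
  have s0 : 0 < sin t := sin_pos_of_pos_of_lt_pi (by linarith) (by linarith)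
  have se : 0 < sin e := sin_pos_of_pos_of_lt_pi (by linarith) (by linarith)
  have se' : 0 < sin e' := sin_pos_of_pos_of_lt_pi (by linarith) (by linarith)
  have ce : 0 < cos e := cos_pos_of_mem_Ioo ⟨by linarith, by linarith⟩
  have ce' : 0 < cos e' := cos_pos_of_mem_Ioo ⟨by linarith, by linarith⟩
  have cE : 0 < cos ((d + |δ|) / 2) := cos_pos_of_mem_Ioo ⟨by linarith, by linarith⟩
  have hcd : cos d = cos e * cos e' - sin e * sin e' := by
    rw [← cos_add, he, he']
    ring_nf
  have hp1 := sin_sq_add_cos_sq e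
  have hp2 := sin_sq_add_cos_sq e'
  -- the values at the two ends of the range of `cot θ`
  have v1 : 1 - cos d ^ 2 / cos ((d + |δ|) / 2) ^ 2 ≤ 1 - cos d ^ 2 / cos e ^ 2 := by
    have : cos ((d + |δ|) / 2) ≤ cos e :=
      cos_le_cos_of_nonneg_of_le_pi (by linarith) (by linarith) (by linarith)
    gcongr
  have v2 : 1 - cos d ^ 2 / cos ((d + |δ|) / 2) ^ 2 ≤ 1 - cos d ^ 2 / cos e' ^ 2 := by
    have : cos ((d + |δ|) / 2) ≤ cos e' :=
      cos_le_cos_of_nonneg_of_le_pi (by linarith) (by linarith) (by linarith)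
    gcongr
  set V := 1 - cos d ^ 2 / cos ((d + |δ|) / 2) ^ 2 with hV
  have w1 : V * cos e ^ 2 ≤ cos e ^ 2 - cos d ^ 2 := by
    refine (mul_le_mul_of_nonneg_right v1 (sq_nonneg (cos e))).trans (le_of_eq ?_)
    field_simp
  have w2 : V * cos e' ^ 2 ≤ cos e' ^ 2 - cos d ^ 2 := by
    refine (mul_le_mul_of_nonneg_right v2 (sq_nonneg (cos e'))).trans (le_of_eq ?_)
    field_simp
  -- these say that `-cot (2e') ≤ cot θ ≤ cot (2e)`
  have hu : 0 ≤ sin (t - 2 * e) :=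
    sin_nonneg_of_nonneg_of_le_pi (by linarith) (by linarith)
  have hw : 0 ≤ sin (t + 2 * e') :=
    sin_nonneg_of_nonneg_of_le_pi (by linarith) (by linarith)
  have E1 : cos t - cos (c + d) = 2 * sin (t + e') * sin e' := by
    have x1 := cos_sub (t + e') e'
    have x2 := cos_add (t + e') e'
    rw [add_sub_cancel_right] at x1
    rw [show t + e' + e' = c + d by rw [he', ht]; ring] at x2
    linarith
  have E2 : cos (c - d) - cos t = 2 * sin (t - e) * sin e := by
    have x1 := cos_sub (t - e) e
    have x2 := cos_add (t - e) e
    rw [sub_add_cancel] at x2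
    rw [show t - e - e = c - d by rw [he, ht]; ring] at x1
    linarith
  rw [sin_sub, cos_two_mul', sin_two_mul] at hu
  rw [sin_add, cos_two_mul', sin_two_mul] at hw
  have hq := le_concave_quadratic (A := 4 * sin e * sin e' * (cos e * cos e'))
    (B := 4 * sin e * sin e' * (sin e' * cos e - cos e' * sin e))
    (D := 4 * sin e ^ 2 * sin e' ^ 2) (x := cos t / sin t) (V := V)
    (x₁ := -(cos e' ^ 2 - sin e' ^ 2) / (2 * sin e' * cos e'))
    (x₂ := (cos e ^ 2 - sin e ^ 2) / (2 * sin e * cos e)) (by positivity)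
    (by rw [div_le_div_iff₀ (by positivity) s0]; linarith)
    (by rw [div_le_div_iff₀ s0 (by positivity)]; linarith)
    (by
      refine le_of_mul_le_mul_right (w2.trans (le_of_eq ?_)) (by positivity : 0 < cos e' ^ 2)
      trans sin e * (cos e' ^ 2 + sin e' ^ 2) *
        (2 * sin e' * cos e * cos e' + (cos e' ^ 2 - sin e' ^ 2) * sin e)
      · rw [hcd]
        linear_combination (-cos e' ^ 2) * hp1 - sin e *
          (2 * sin e' * cos e * cos e' + (cos e' ^ 2 - sin e' ^ 2) * sin e) * hp2
      · field_simp
        ring)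
    (by
      refine le_of_mul_le_mul_right (w1.trans (le_of_eq ?_)) (by positivity : 0 < cos e ^ 2)
      trans sin e' * (cos e ^ 2 + sin e ^ 2) *
        (2 * sin e * cos e' * cos e + (cos e ^ 2 - sin e ^ 2) * sin e')
      · rw [hcd]
        linear_combination (-cos e ^ 2) * hp2 - sin e' *
          (2 * sin e * cos e' * cos e + (cos e ^ 2 - sin e ^ 2) * sin e') * hp1
      · field_simp
        ring)
  have := mul_le_mul_of_nonneg_left hq (sq_nonneg (sin t))
  refine this.trans (le_of_eq ?_)
  rw [E1, E2, sin_add t e', sin_sub t e]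
  field_simp
  ring

end ContFrac

/-! ### The Lebesgue function at the Chebyshev zeros -/

namespace ContFrac
open Real

theorem cos_le_quartic {x : ℝ} (hx : 0 ≤ x) (hx2 : x ≤ 2) :
    cos x ≤ 1 - x ^ 2 / 2 + x ^ 4 / 24 := by
  have h1 := sin_ge_sub_cube (x := x / 2) (by linarith)
  have h0 : 0 ≤ x / 2 - (x / 2) ^ 3 / 6 := by nlinarith [mul_nonneg hx hx]
  have h2 := pow_le_pow_left₀ h0 h1 2
  have h3 : cos x = 1 - 2 * sin (x / 2) ^ 2 := by
    rw [← cos_sq_add_sin_sq (x / 2), show cos x = cos (2 * (x / 2)) by ring_nf, cos_two_mul']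
    ring
  have h4 : 0 ≤ x ^ 6 := by positivity
  rw [h3]
  nlinarith

/-- If `E ≤ ρ d` and `d = π / n ≤ π / 3`, then `1 - cos² d / cos² E` is at least `K / n²`, given a
polynomial inequality in `q = d²`. -/
theorem div_sq_le_one_sub {n : ℕ} (hn : 3 ≤ n) {E ρ K L : ℝ} (hE : 0 ≤ E) (hρ : ρ ≤ 1) (hρ0 : 0 ≤ ρ)
    (hE2 : E ≤ ρ * (π / n)) (hK : K ≤ L * π ^ 2)
    (hpoly : ∀ q : ℝ, 0 ≤ q → q ≤ 1.0967 →
      (1 - q / 2 + q ^ 2 / 24) ^ 2 ≤ (1 - ρ ^ 2 * q / 2) ^ 2 * (1 - L * q)) :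
    K / (n : ℝ) ^ 2 ≤ 1 - cos (π / n) ^ 2 / cos E ^ 2 := by
  have hn3 : (3 : ℝ) ≤ n := by exact_mod_cast hn
  have hpi := pi_pos
  have hpi4 := pi_lt_d4
  set d := π / n with hd
  have hd0 : 0 < d := by positivity
  have hd1 : d ≤ π / 3 := div_le_div_of_nonneg_left hpi.le (by norm_num) hn3
  have hd2 : d ≤ 1.0472 := by linarith
  have hq : d ^ 2 ≤ 1.0967 := by nlinarith
  have hEd : E ≤ d := hE2.trans (mul_le_of_le_one_left hd0.le hρ)
  have c0 : 0 ≤ cos d := (cos_pos_of_mem_Ioo ⟨by linarith, by linarith⟩).le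
  have cE : 0 < cos E := cos_pos_of_mem_Ioo ⟨by linarith, by linarith⟩
  have h1 := cos_le_quartic hd0.le (by linarith)
  have h2 : cos d ^ 2 ≤ (1 - d ^ 2 / 2 + (d ^ 2) ^ 2 / 24) ^ 2 := by
    refine pow_le_pow_left₀ c0 (h1.trans (le_of_eq ?_)) 2
    ring
  have h3 := one_sub_sq_div_two_le_cos (x := E)
  have h4 : E ^ 2 ≤ ρ ^ 2 * d ^ 2 := by
    rw [← mul_pow]
    exact pow_le_pow_left₀ hE hE2 2
  have hρ2 : ρ ^ 2 ≤ 1 := by nlinarith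
  have h5 : 0 ≤ 1 - ρ ^ 2 * d ^ 2 / 2 := by nlinarith [sq_nonneg d]
  have h6 : (1 - ρ ^ 2 * d ^ 2 / 2) ^ 2 ≤ cos E ^ 2 :=
    pow_le_pow_left₀ h5 (by linarith) 2
  have h7 := hpoly (d ^ 2) (by positivity) hq
  have h8 : 0 ≤ 1 - L * d ^ 2 := by
    by_contra! h
    have h9 : 0 < (1 - d ^ 2 / 2 + (d ^ 2) ^ 2 / 24) ^ 2 := by
      have : 0 < 1 - d ^ 2 / 2 + (d ^ 2) ^ 2 / 24 := by nlinarith [sq_nonneg (d ^ 2)]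
      positivity
    nlinarith [mul_nonneg (sq_nonneg (1 - ρ ^ 2 * d ^ 2 / 2)) (neg_nonneg.2 h.le)]
  have h9 : cos d ^ 2 / cos E ^ 2 ≤ 1 - L * d ^ 2 := by
    rw [div_le_iff₀ (by positivity)]
    have := mul_le_mul_of_nonneg_right h6 h8
    linarith
  have h10 : K / (n : ℝ) ^ 2 ≤ L * d ^ 2 := by
    rw [hd, div_pow, div_le_iff₀ (by positivity)]
    refine hK.trans (le_of_eq ?_)
    field_simp
  linarith

/-- The numerical part of the bound for the Lebesgue function. The two constants `K` serve `θ` near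
the midpoint of its two neighbours and `θ` away from it, where `|cos (n θ)| ≤ 1 / √2`. -/
theorem exists_log_bound {n : ℕ} (hn : 3 ≤ n) {δ : ℝ} (hδ : |δ| < π / n / 2) :
    ∃ K : ℝ, 0 < K ∧ K / (n : ℝ) ^ 2 ≤ 1 - cos (π / n) ^ 2 / cos ((π / n + |δ|) / 2) ^ 2 ∧
      4 - 3 / 4 * π ≤ (1 - cos (n * δ)) * (2 * log 3) + cos (n * δ) * log K := by
  have hn3 : (3 : ℝ) ≤ n := by exact_mod_cast hn
  have hn0 : (0 : ℝ) < n := by linarith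
  have hpi := pi_pos
  set d := π / n with hd
  have hd0 : 0 < d := by positivity
  have hnd : n * d = π := by rw [hd]; field_simp
  have hnδ : |n * δ| ≤ π / 2 := by
    rw [abs_mul, Nat.abs_cast]
    have := mul_le_mul_of_nonneg_left hδ.le hn0.le
    linarith
  have hC0 : 0 ≤ cos (n * δ) :=
    cos_nonneg_of_mem_Icc ⟨by linarith [neg_abs_le (n * δ)], (le_abs_self _).trans hnδ⟩
  have l2 := log_two_gt_d9
  have l2' := log_two_lt_d9
  have l3 := log_three_gt_d9
  have l3' := log_three_lt_d9
  have l5 := log_five_gt_d9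
  have hpi4 := pi_gt_d4
  have hCle := cos_le_one (n * δ)
  have habs := abs_nonneg δ
  have hpisq : 9.869 ≤ π ^ 2 := by nlinarith
  rcases le_total |δ| (d / 4) with hcase | hcase
  · refine ⟨675 / 128, by norm_num, ?_, ?_⟩
    · refine div_sq_le_one_sub (E := (d + |δ|) / 2) (ρ := 5 / 8) (L := 0.5344) hn (by positivity)
        (by norm_num) (by norm_num) (by linarith) (by linarith) ?_
      intro q hq0 hq1
      nlinarith [mul_nonneg hq0 (sub_nonneg.2 hq1), mul_nonneg (mul_nonneg hq0 hq0) (sub_nonneg.2 hq1),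
        mul_nonneg (mul_nonneg hq0 (mul_nonneg hq0 hq0)) (sub_nonneg.2 hq1)]
    · have e : log (675 / 128 : ℝ) = 3 * log 3 + 2 * log 5 - 7 * log 2 := by
        rw [log_div (by norm_num) (by norm_num), show (675 : ℝ) = 3 ^ 3 * 5 ^ 2 by norm_num,
          show (128 : ℝ) = 2 ^ 7 by norm_num, log_mul (by norm_num) (by norm_num), log_pow,
          log_pow, log_pow]
        norm_num
      rw [e]
      have := mul_nonneg hC0 (by linarith : 0 ≤ log 3 + 2 * log 5 - 7 * log 2 + 0.535)
      linarith
  · refine ⟨25 / 6, by norm_num, ?_, ?_⟩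
    · refine div_sq_le_one_sub (E := (d + |δ|) / 2) (ρ := 3 / 4) (L := 0.4223) hn (by positivity)
        (by norm_num) (by norm_num) (by linarith) (by linarith) ?_
      intro q hq0 hq1
      have : 0 ≤ q * (0.0151 - 0.0168 * q + 0.0081 * q ^ 2 - 0.0018 * q ^ 3) := by
        refine mul_nonneg hq0 ?_
        nlinarith [mul_nonneg hq0 (sub_nonneg.2 hq1), sq_nonneg (q - 1),
          mul_nonneg (mul_nonneg hq0 hq0) (sub_nonneg.2 hq1)]
      nlinarith [mul_nonneg hq0 (sub_nonneg.2 hq1), mul_nonneg (mul_nonneg hq0 hq0) (sub_nonneg.2 hq1),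
        mul_nonneg (mul_nonneg hq0 (mul_nonneg hq0 hq0)) (sub_nonneg.2 hq1)]
    · have e : log (25 / 6 : ℝ) = 2 * log 5 - log 2 - log 3 := by
        rw [log_div (by norm_num) (by norm_num), show (25 : ℝ) = 5 ^ 2 by norm_num,
          show (6 : ℝ) = 2 * 3 by norm_num, log_mul (by norm_num) (by norm_num), log_pow]
        push_cast
        ring
      -- here `|n δ| ≥ π / 4`
      have hC2 : cos (n * δ) ≤ 0.7072 := by
        have h1 : π / 4 ≤ |n * δ| := by
          rw [abs_mul, Nat.abs_cast]
          have := mul_le_mul_of_nonneg_left hcase hn0.le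
          linarith
        have h2 := cos_le_cos_of_nonneg_of_le_pi (by positivity) (by linarith) h1
        rw [cos_abs, cos_pi_div_four] at h2
        have h3 : √2 ≤ 1.4144 := by
          rw [sqrt_le_left (by norm_num)]
          norm_num
        linarith
      rw [e]
      nlinarith

set_option maxHeartbeats 1000000 in
/-- The Lebesgue function of the zeros of `T_n` at a point between the first and the last zero; the
two zeros that enclose `θ` are `(p + 1) π / n ± π / (2n)`. -/
theorem lebesgue_function_le {n p : ℕ} (hn : 3 ≤ n) (hp : p + 2 ≤ n) {δ : ℝ}
    (hδ : |δ| < π / n / 2) :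
    |cos (n * ((p + 1) * (π / n) + δ))| / n * ∑ k ∈ Finset.range n, sin (zeroAngle n k) /
      |cos ((p + 1) * (π / n) + δ) - cos (zeroAngle n k)| ≤ 2 / π * log n + 3 / 4 := by
  have hn3 : (3 : ℝ) ≤ n := by exact_mod_cast hn
  have hpn : (p : ℝ) + 2 ≤ n := by exact_mod_cast hp
  have hn0 : (0 : ℝ) < n := by linarith
  have hpi := pi_pos
  have hp0 : (0 : ℝ) ≤ p := p.cast_nonneg
  set d := π / n with hd
  have hd0 : 0 < d := by positivity
  have hnd : n * d = π := by rw [hd]; field_simp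
  have hd1 : d ≤ π / 3 := div_le_div_of_nonneg_left hpi.le (by norm_num) hn3
  set c := ((p : ℝ) + 1) * d with hc
  set t := c + δ with ht
  obtain ⟨δ1, δ2⟩ := abs_lt.1 hδ
  have hpd : 0 ≤ p * d := by positivity
  have hcπ : c + d ≤ π := by
    have := mul_le_mul_of_nonneg_right hpn hd0.le
    rw [hc, ← hnd]
    linarith
  have hcd : d ≤ c := by rw [hc]; linarith
  have hct : ∀ x, 0 ≤ x → x < t → 0 < cos x - cos t := fun x h0 h1 =>
    sub_pos.2 (cos_lt_cos_of_nonneg_of_le_pi h0 (by linarith) h1)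
  have hct2 : ∀ x, t < x → x ≤ π → 0 < cos t - cos x := fun x h0 h1 =>
    sub_pos.2 (cos_lt_cos_of_nonneg_of_le_pi (by linarith) h1 h0)
  have hz : ∀ k, zeroAngle n k = (k + 1 / 2) * d := by
    intro k
    unfold zeroAngle
    rw [hd]
    field_simp
  -- splitting of the sum
  set f : ℕ → ℝ := fun k => sin (zeroAngle n k) / |cos t - cos (zeroAngle n k)| with hf
  have hsplit : ∑ k ∈ Finset.range n, f k = ∑ k ∈ Finset.range p, f k + (f (p + 1) + f p) +
      ∑ k ∈ Finset.Ico (p + 2) n, f k := by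
    rw [Finset.sum_Ico_eq_sub _ hp, Finset.sum_range_succ f (p + 1), Finset.sum_range_succ f p]
    ring
  have hL : ∑ k ∈ Finset.range p, f k =
      ∑ k ∈ Finset.range p, sin (zeroAngle n k) / (cos (zeroAngle n k) - cos t) := by
    refine Finset.sum_congr rfl fun k hk => ?_
    have hkp : (k : ℝ) + 1 ≤ p := by exact_mod_cast Finset.mem_range.1 hk
    have hkd := mul_le_mul_of_nonneg_right hkp hd0.le
    have := hct (zeroAngle n k) (by rw [hz]; positivity) (by rw [hz, ht, hc]; linarith)
    rw [hf]
    simp only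
    rw [abs_sub_comm, abs_of_pos this]
  have hR : ∑ k ∈ Finset.Ico (p + 1 + 1) n, f k =
      ∑ k ∈ Finset.Ico (p + 1 + 1) n, sin (zeroAngle n k) / (cos t - cos (zeroAngle n k)) := by
    refine Finset.sum_congr rfl fun k hk => ?_
    obtain ⟨hk1, hk2⟩ := Finset.mem_Ico.1 hk
    have hkp : (p : ℝ) + 2 ≤ k := by exact_mod_cast hk1
    have hkd := mul_le_mul_of_nonneg_right hkp hd0.le
    have := hct2 (zeroAngle n k) (by rw [hz, ht, hc]; linarith) (zeroAngle_mem hk2).2.le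
    rw [hf]
    simp only
    rw [abs_of_pos this]
  have hadj : f (p + 1) + f p ≤ 2 * (d / 2) / ((d / 2) ^ 2 - δ ^ 2) := by
    have h1 := adjacent_le (c := c) (a := d / 2) (δ := δ) (by positivity) (by linarith)
      (by linarith) hδ
    have e1 : zeroAngle n (p + 1) = c + d / 2 := by rw [hz, hc]; push_cast; ring
    have e2 : zeroAngle n p = c - d / 2 := by rw [hz, hc]; ring
    have i1 := hct2 (c + d / 2) (by linarith) (by linarith)
    have i2 := hct (c - d / 2) (by linarith) (by linarith)
    rw [hf]
    simp only
    rw [e1, e2, abs_of_pos i1, abs_sub_comm (cos t), abs_of_pos i2]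
    exact h1
  have hleft := sum_left_le (n := n) (m := p) (t := t) (by linarith) (by omega)
    (by rw [ht, hc]; linarith)
  have hright := sum_right_le (n := n) (m := p + 1) (t := t) (by linarith) (by omega)
    (by push_cast; rw [ht, hc]; linarith) (N := n) hp le_rfl
  rw [← hd, ← hL] at hleft
  rw [← hd, ← hR, hnd, cos_pi] at hright
  have ec1 : c + d = ((p + 1 : ℕ) + 1) * d := by rw [hc]; push_cast; ring
  have ec2 : c - d = p * d := by rw [hc]; ring
  have hX : 0 < cos t - cos (c + d) := hct2 _ (by linarith) hcπ
  have hY : 0 < cos (c - d) - cos t := hct _ (by linarith) (by linarith)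
  have hst : 0 < sin t := sin_pos_of_pos_of_lt_pi (by linarith) (by linarith)
  have hV := sin_sq_mul_le (c := c) (d := d) (δ := δ) hd0 hcd hcπ (by linarith)
  set V := 1 - cos d ^ 2 / cos ((d + |δ|) / 2) ^ 2 with hVdef
  have main : ∀ K : ℝ, 0 < K → K / (n : ℝ) ^ 2 ≤ V →
      ∑ k ∈ Finset.range n, f k ≤ n / π * (2 * log n - log K) + d / ((d / 2) ^ 2 - δ ^ 2) := by
    intro K hK hKV
    have hV0 : 0 < V := lt_of_lt_of_le (by positivity) hKV
    have hl : log (1 - cos t) + log (cos t - -1) - (log (cos (c - d) - cos t) +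
        log (cos t - cos (c + d))) ≤ 2 * log n - log K := by
      have p1 : 0 < 1 - cos t := by
        have := hct 0 le_rfl (by linarith)
        rwa [cos_zero] at this
      have p2 : 0 < cos t - -1 := by
        have := hct2 π (by linarith) le_rfl
        rwa [cos_pi] at this
      rw [← log_mul p1.ne' p2.ne', ← log_mul hY.ne' hX.ne']
      have e1 : (1 - cos t) * (cos t - -1) = sin t ^ 2 := by
        rw [sin_sq]
        ring
      rw [e1]
      have h1 : log (sin t ^ 2 * V) ≤ log ((cos (c - d) - cos t) * (cos t - cos (c + d))) :=
        log_le_log (by positivity) (by rw [mul_comm (cos (c - d) - cos t)]; exact hV)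
      rw [log_mul (by positivity) hV0.ne'] at h1
      have h2 := log_le_log (by positivity) hKV
      rw [log_div hK.ne' (by positivity), log_pow] at h2
      push_cast at h2
      linarith
    rw [ec1, ec2] at hl
    have h3 : d * (∑ k ∈ Finset.range p, f k + ∑ k ∈ Finset.Ico (p + 1 + 1) n, f k) ≤
        2 * log n - log K := by linarith
    have h4 : ∑ k ∈ Finset.range p, f k + ∑ k ∈ Finset.Ico (p + 1 + 1) n, f k ≤
        n / π * (2 * log n - log K) := by
      have h5 := mul_le_mul_of_nonneg_left h3 (by positivity : 0 ≤ n / π)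
      rw [← mul_assoc, hd, div_mul_div_cancel₀ hpi.ne', div_self hn0.ne', one_mul] at h5
      exact h5
    rw [hsplit]
    have e3 : 2 * (d / 2) / ((d / 2) ^ 2 - δ ^ 2) = d / ((d / 2) ^ 2 - δ ^ 2) := by
      congr 1
      ring
    rw [e3] at hadj
    linarith
  -- the factor `|cos (n θ)|`
  have hcos : |cos (n * t)| = cos (n * δ) := by
    have e1 : n * t = n * δ + (p + 1 : ℕ) * π := by
      rw [ht, hc, ← hnd]
      push_cast
      ring
    have e2 : 0 ≤ cos (n * δ) := by
      have i1 := mul_le_mul_of_nonneg_left δ1.le hn0.le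
      have i2 := mul_le_mul_of_nonneg_left δ2.le hn0.le
      refine cos_nonneg_of_mem_Icc ⟨?_, ?_⟩ <;> linarith
    rw [e1, cos_add_nat_mul_pi, abs_mul, abs_pow, abs_neg, abs_one, one_pow, one_mul,
      abs_of_nonneg e2]
  have hC0 : 0 ≤ cos (n * δ) := hcos ▸ abs_nonneg _
  have hδsq : 0 < (d / 2) ^ 2 - δ ^ 2 := by
    have := mul_pos (sub_pos.2 δ2) (sub_pos.2 δ1)
    linarith
  have hnδ : |n * δ| ≤ π / 2 := by
    rw [abs_mul, Nat.abs_cast]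
    have := mul_le_mul_of_nonneg_left hδ.le hn0.le
    linarith
  have hC1 : cos (n * δ) / n * (d / ((d / 2) ^ 2 - δ ^ 2)) ≤ 4 / π := by
    have h1 := cos_le_one_sub_four_div_pi_sq hnδ
    have h2 : 1 - 4 / π ^ 2 * (n * δ) ^ 2 = ((d / 2) ^ 2 - δ ^ 2) * (4 * n ^ 2 / π ^ 2) := by
      rw [hd]
      field_simp
      ring
    rw [h2] at h1
    rw [div_mul_div_comm, div_le_div_iff₀ (by positivity) hpi]
    calc cos (n * δ) * d * π ≤ ((d / 2) ^ 2 - δ ^ 2) * (4 * n ^ 2 / π ^ 2) * d * π := by gcongr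
      _ = 4 * (n * ((d / 2) ^ 2 - δ ^ 2)) := by
        rw [hd]
        field_simp
  have hlogn : log 3 ≤ log n := log_le_log (by norm_num) hn3
  have fin : ∀ K : ℝ, 0 < K → K / (n : ℝ) ^ 2 ≤ V →
      4 - 3 / 4 * π ≤ (1 - cos (n * δ)) * (2 * log 3) + cos (n * δ) * log K →
      |cos (n * t)| / n * ∑ k ∈ Finset.range n, f k ≤ 2 / π * log n + 3 / 4 := by
    intro K hK hKV hnum
    have h1 := mul_le_mul_of_nonneg_left (main K hK hKV)
      (div_nonneg hC0 hn0.le : 0 ≤ cos (n * δ) / n)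
    rw [hcos]
    refine h1.trans ?_
    rw [mul_add]
    have h2 : cos (n * δ) / n * (n / π * (2 * log n - log K)) =
        cos (n * δ) * (2 * log n - log K) / π := by
      field_simp
    rw [h2]
    have h3 : cos (n * δ) * (2 * log n - log K) / π + 4 / π ≤ 2 / π * log n + 3 / 4 := by
      have h4 := mul_le_mul_of_nonneg_left hlogn (sub_nonneg.2 (cos_le_one (n * δ)))
      rw [← add_div, div_le_iff₀ hpi]
      have e : (2 / π * log n + 3 / 4) * π = 2 * log n + 3 / 4 * π := by
        field_simp
      rw [e]
      linarith
    linarith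
  obtain ⟨K, hK, hKV, hnum⟩ := exists_log_bound hn hδ
  exact fin K hK hKV hnum

end ContFrac

/-! ### The Lebesgue constant -/

namespace ContFrac
open Real Polynomial

theorem le_psi {r : ℕ} (hr : 2 ≤ r) : 1.44 ≤ psi r := by
  have h1 : log 3 ≤ log (r + 1) := by
    refine log_le_log (by norm_num) ?_
    have : (2 : ℝ) ≤ r := by exact_mod_cast hr
    linarith
  have h2 := log_three_gt_d9
  have h3 : (0.63 : ℝ) ≤ 2 / π := by
    rw [le_div_iff₀ pi_pos]
    linarith [pi_lt_d4]
  unfold psi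
  nlinarith

/-- The Lebesgue constant of the extended Chebyshev points is at most `ψ(r)`. -/
theorem abs_eval_cos_le_psi {r : ℕ} (hr : 2 ≤ r) {Q : ℝ[X]} (hQ : Q.degree < (r + 1 : ℕ)) {W : ℝ}
    (hW : ∀ k < r + 1, |Q.eval (cos (zeroAngle (r + 1) k))| ≤ W) {t : ℝ}
    (ht : t ∈ Icc (π / (2 * r + 2)) (π - π / (2 * r + 2))) : |Q.eval (cos t)| ≤ psi r * W := by
  have hψ := le_psi hr
  have hr2 : (2 : ℝ) ≤ r := by exact_mod_cast hr
  have hW0 : 0 ≤ W := (abs_nonneg _).trans (hW 0 (by omega))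
  have hpi := pi_pos
  by_cases hnode : ∃ k < r + 1, cos t = cos (zeroAngle (r + 1) k)
  · obtain ⟨k, hk, hkt⟩ := hnode
    rw [hkt]
    exact (hW k hk).trans (le_mul_of_one_le_left hW0 (by linarith))
  push Not at hnode
  refine (abs_eval_le_sum_zeroAngle hQ hnode).trans ?_
  set n := r + 1 with hn
  set d := π / n with hd
  have hn' : (n : ℝ) = r + 1 := by rw [hn]; push_cast; ring
  have hn0 : (0 : ℝ) < n := by rw [hn']; linarith
  have hd0 : 0 < d := by positivity
  have hnd : n * d = π := by rw [hd]; field_simp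
  have had : π / (2 * r + 2) = d / 2 := by
    rw [hd, hn']
    field_simp
  rw [had] at ht
  have hz : ∀ k, zeroAngle n k = (k + 1 / 2) * d := by
    intro k
    unfold zeroAngle
    rw [hd]
    field_simp
  -- `t` lies between the zeros number `p` and `p + 1`
  obtain ⟨p, hp⟩ : ∃ p : ℕ, p = ⌊t / d - 1 / 2⌋₊ := ⟨_, rfl⟩
  have hx0 : 0 ≤ t / d - 1 / 2 := by
    have : 1 / 2 ≤ t / d := by
      rw [le_div_iff₀ hd0]
      linarith [ht.1]
    linarith
  have hp1 : (p + 1 / 2) * d ≤ t := by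
    have h1 := Nat.floor_le hx0
    rw [← hp] at h1
    have h2 : (p : ℝ) + 1 / 2 ≤ t / d := by linarith
    rwa [le_div_iff₀ hd0] at h2
  have hp2 : t < (p + 1 + 1 / 2) * d := by
    have h1 := Nat.lt_floor_add_one (t / d - 1 / 2)
    rw [← hp] at h1
    have h2 : t / d < p + 1 + 1 / 2 := by linarith
    rwa [div_lt_iff₀ hd0] at h2
  have hpn : p < n := by
    by_contra! h
    have : (n : ℝ) ≤ p := by exact_mod_cast h
    have := mul_le_mul_of_nonneg_right this hd0.le
    linarith [ht.2]
  have hp1' : (p + 1 / 2) * d < t := by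
    refine lt_of_le_of_ne hp1 fun h => hnode p hpn ?_
    rw [hz, h]
  have hpn2 : p + 2 ≤ n := by
    by_contra! h
    have : p + 1 = n := by omega
    have : (p : ℝ) + 1 = n := by exact_mod_cast this
    have : (p + 1) * d = π := by rw [this, hnd]
    linarith [ht.2]
  have key := lebesgue_function_le (n := n) (p := p) (by omega) hpn2 (δ := t - (p + 1) * d)
    (by rw [← hd, abs_lt]; constructor <;> linarith)
  rw [← hd, add_sub_cancel] at key
  have hpsi : psi r = 2 / π * log n + 3 / 4 := by rw [psi, hn']
  rw [hpsi]
  refine le_trans ?_ (mul_le_mul_of_nonneg_right key hW0)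
  rw [mul_assoc, Finset.sum_mul]
  refine mul_le_mul_of_nonneg_left (Finset.sum_le_sum fun k hk => ?_) (by positivity)
  have hk' := Finset.mem_range.1 hk
  exact mul_le_mul_of_nonneg_left (hW k hk')
    (div_nonneg (sin_zeroAngle_pos hk').le (abs_nonneg _))
end ContFrac

/-! ### Rolle's theorem and products over interlacing points -/

namespace ContFrac
open Real Polynomial

/-- Generalized Rolle theorem: `φ m` is the `m`-th derivative of `φ 0`. -/
theorem exists_eq_zero_of_card {a b : ℝ} (m : ℕ) : ∀ {φ : ℕ → ℝ → ℝ} {Z : Finset ℝ},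
    (∀ k, ∀ x ∈ Icc a b, HasDerivAt (φ k) (φ (k + 1) x) x) → (↑Z ⊆ Icc a b) → Z.card = m + 1 →
    (∀ z ∈ Z, φ 0 z = 0) → ∃ ζ ∈ Icc a b, φ m ζ = 0 := by
  induction m with
  | zero =>
    intro φ Z _ hZ hc h0
    obtain ⟨z, hz⟩ := Finset.card_pos.1 (by omega : 0 < Z.card)
    exact ⟨z, hZ hz, h0 z hz⟩
  | succ m ih =>
    intro φ Z hφ hZ hc h0
    set z := Z.orderEmbOfFin hc with hz
    have hzm : ∀ i, z i ∈ Z := fun i => Z.orderEmbOfFin_mem hc i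
    have hex : ∀ i : Fin (m + 1), ∃ w ∈ Ioo (z i.castSucc) (z i.succ), φ 1 w = 0 := by
      intro i
      have hsub : Icc (z i.castSucc) (z i.succ) ⊆ Icc a b :=
        Icc_subset_Icc (hZ (hzm _)).1 (hZ (hzm _)).2
      refine exists_hasDerivAt_eq_zero (z.strictMono i.castSucc_lt_succ) (f := φ 0)
        (fun x hx => (hφ 0 x (hsub hx)).continuousAt.continuousWithinAt) ?_
        (fun x hx => hφ 0 x (hsub (Ioo_subset_Icc_self hx)))
      rw [h0 _ (hzm _), h0 _ (hzm _)]
    choose w hw hw0 using hex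
    have hmono : StrictMono w := by
      refine Fin.strictMono_iff_lt_succ.2 fun i => ?_
      have h1 := (hw i.castSucc).2
      have h2 := (hw i.succ).1
      rw [Fin.succ_castSucc] at h1
      exact h1.trans h2
    refine ih (φ := fun k => φ (k + 1)) (Z := Finset.univ.image w) (fun k => hφ (k + 1)) ?_ ?_ ?_
    · intro x hx
      simp only [Finset.coe_image, Finset.coe_univ, image_univ, mem_range] at hx
      obtain ⟨i, rfl⟩ := hx
      exact ⟨(hZ (hzm _)).1.trans (hw i).1.le, (hw i).2.le.trans (hZ (hzm _)).2⟩
    · rw [Finset.card_image_of_injective _ hmono.injective, Finset.card_univ, Fintype.card_fin]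
    · intro x hx
      obtain ⟨i, -, rfl⟩ := Finset.mem_image.1 hx
      exact hw0 i

/-- A function with `m` zeros is bounded by its `m`-th derivative. -/
theorem abs_mul_factorial_le {a b K : ℝ} {g : ℕ → ℝ → ℝ} {Z : Finset ℝ}
    (hg : ∀ k, ∀ x ∈ Icc a b, HasDerivAt (g k) (g (k + 1) x) x) (hZ : ↑Z ⊆ Icc a b)
    (h0 : ∀ z ∈ Z, g 0 z = 0) {x : ℝ} (hx : x ∈ Icc a b)
    (hK : ∀ ζ ∈ Icc a b, |g Z.card ζ| ≤ K) :
    |g 0 x| * (Z.card.factorial : ℝ) ≤ K * ∏ z ∈ Z, |x - z| := by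
  by_cases hxZ : x ∈ Z
  · rw [h0 x hxZ, Finset.prod_eq_zero hxZ (by simp)]
    simp
  set w : ℝ[X] := Lagrange.nodal Z id with hw
  have hwx : w.eval x ≠ 0 := by
    rw [hw, Lagrange.eval_nodal]
    refine Finset.prod_ne_zero_iff.2 fun z hz => sub_ne_zero.2 ?_
    rintro rfl
    exact hxZ hz
  have key : ∃ ζ ∈ Icc a b, g Z.card ζ * w.eval x - g 0 x * (derivative^[Z.card] w).eval ζ = 0 := by
    refine exists_eq_zero_of_card Z.card
      (φ := fun k t => g k t * w.eval x - g 0 x * (derivative^[k] w).eval t) (Z := insert x Z)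
      ?_ ?_ ?_ ?_
    · intro k t ht
      have h1 := (derivative^[k] w).hasDerivAt t
      rw [← Function.iterate_succ_apply' derivative] at h1
      exact ((hg k t ht).mul_const _).sub (h1.const_mul _)
    · intro t ht
      rcases Finset.mem_insert.1 (Finset.mem_coe.1 ht) with rfl | h
      · exact hx
      · exact hZ h
    · rw [Finset.card_insert_of_notMem hxZ]
    · intro z hz
      rcases Finset.mem_insert.1 hz with rfl | h
      · simp only [Function.iterate_zero, id]
        ring
      · have : w.eval z = 0 := Lagrange.eval_nodal_at_node (v := id) h
        simp only [Function.iterate_zero, id, h0 z h, this]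
        ring
  obtain ⟨ζ, hζ, hζ0⟩ := key
  have hd : (derivative^[Z.card] w).eval ζ = (Z.card.factorial : ℝ) := by
    have h1 : (derivative^[Z.card] w).natDegree ≤ 0 := by
      refine (natDegree_iterate_derivative _ _).trans ?_
      rw [hw, Lagrange.natDegree_nodal]
      simp
    rw [eq_C_of_natDegree_le_zero h1, eval_C, coeff_iterate_derivative]
    have h2 : w.coeff (0 + Z.card) = 1 := by
      have := Lagrange.nodal_monic (s := Z) (v := (id : ℝ → ℝ))
      rw [zero_add, ← hw] at *
      rwa [Monic, leadingCoeff, hw, Lagrange.natDegree_nodal] at this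
    rw [h2, zero_add, Nat.descFactorial_self]
    simp
  simp only [hd] at hζ0
  have h1 : g 0 x * (Z.card.factorial : ℝ) = g Z.card ζ * w.eval x := by linarith
  have h2 : |w.eval x| = ∏ z ∈ Z, |x - z| := by
    rw [hw, Lagrange.eval_nodal, Finset.abs_prod]
    rfl
  rw [← h2, ← Nat.abs_cast (Z.card.factorial), ← abs_mul, h1, abs_mul]
  exact mul_le_mul_of_nonneg_right (hK ζ hζ) (abs_nonneg _)

theorem prod_erase_range {f : ℕ → ℝ} {n j : ℕ} (hj : j < n) :
    ∏ i ∈ (Finset.range n).erase j, f i =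
      (∏ i ∈ Finset.range j, f i) * ∏ i ∈ Finset.Ico (j + 1) n, f i := by
  have : (Finset.range n).erase j = Finset.range j ∪ Finset.Ico (j + 1) n := by
    ext i
    simp only [Finset.mem_erase, Finset.mem_range, Finset.mem_union, Finset.mem_Ico]
    omega
  rw [this, Finset.prod_union]
  rw [Finset.disjoint_left]
  intro i hi hi'
  simp only [Finset.mem_range, Finset.mem_Ico] at hi hi'
  omega

/-- Comparison of a product over interlacing points `z k ∈ [c k, c (k+1)]` with the products over
the points `c`. -/
theorem prod_interlacing_le {c z : ℕ → ℝ} {r : ℕ} (hz : ∀ k < r, z k ∈ Icc (c k) (c (k + 1)))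
    (hc : ∀ i k, i ≤ k → k ≤ r → c i ≤ c k) {j : ℕ} (hj : j < r) {x : ℝ} (hx : x ∈ Icc (c j) (c (j + 1))) :
    ∏ k ∈ Finset.range r, |x - z k| ≤ ∏ i ∈ (Finset.range (r + 1)).erase (j + 1), |x - c i| +
      ∏ i ∈ (Finset.range (r + 1)).erase j, |x - c i| := by
  have h1 : ∏ k ∈ Finset.range j, |x - z k| ≤ ∏ k ∈ Finset.range j, |x - c k| := by
    refine Finset.prod_le_prod (fun _ _ => abs_nonneg _) fun k hk => ?_
    have hkj := Finset.mem_range.1 hk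
    have h2 := hz k (by omega)
    have h3 : z k ≤ x := h2.2.trans ((hc (k + 1) j (by omega) (by omega)).trans hx.1)
    rw [abs_of_nonneg (by linarith), abs_of_nonneg (by linarith [h2.1])]
    linarith [h2.1]
  have h2 : ∏ k ∈ Finset.Ico (j + 1) r, |x - z k| ≤
      ∏ k ∈ Finset.Ico (j + 1) r, |x - c (k + 1)| := by
    refine Finset.prod_le_prod (fun _ _ => abs_nonneg _) fun k hk => ?_
    obtain ⟨hk1, hk2⟩ := Finset.mem_Ico.1 hk
    have h2 := hz k (by omega)
    have h3 : x ≤ z k := hx.2.trans ((hc (j + 1) k (by omega) (by omega)).trans h2.1)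
    rw [abs_of_nonpos (by linarith), abs_of_nonpos (by linarith [h2.2])]
    linarith [h2.2]
  have h3 : |x - z j| ≤ |x - c j| + |x - c (j + 1)| := by
    have h4 := hz j hj
    rw [abs_of_nonneg (by linarith [hx.1] : 0 ≤ x - c j),
      abs_of_nonpos (by linarith [hx.2] : x - c (j + 1) ≤ 0), abs_le]
    constructor <;> linarith [h4.1, h4.2, hx.1, hx.2]
  have e1 : ∏ k ∈ Finset.range r, |x - z k| = (∏ k ∈ Finset.range j, |x - z k|) * |x - z j| *
      ∏ k ∈ Finset.Ico (j + 1) r, |x - z k| := by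
    rw [← Finset.prod_range_succ, Finset.prod_range_mul_prod_Ico _ (by omega)]
  have e2 : ∏ k ∈ Finset.Ico (j + 1) r, |x - c (k + 1)| =
      ∏ k ∈ Finset.Ico (j + 1 + 1) (r + 1), |x - c k| :=
    Finset.prod_Ico_add' (fun k => |x - c k|) (j + 1) r 1
  have e3 : ∏ k ∈ Finset.Ico (j + 1) (r + 1), |x - c k| = |x - c (j + 1)| *
      ∏ k ∈ Finset.Ico (j + 1 + 1) (r + 1), |x - c k| :=
    Finset.prod_eq_prod_Ico_succ_bot (by omega) _
  rw [prod_erase_range (by omega), prod_erase_range (by omega), Finset.prod_range_succ, e1, e3,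
    ← e2]
  have hA : 0 ≤ ∏ k ∈ Finset.range j, |x - c k| := Finset.prod_nonneg fun _ _ => abs_nonneg _
  have hB : 0 ≤ ∏ k ∈ Finset.Ico (j + 1) r, |x - z k| :=
    Finset.prod_nonneg fun _ _ => abs_nonneg _
  calc _ ≤ (∏ k ∈ Finset.range j, |x - c k|) * (|x - c j| + |x - c (j + 1)|) *
        ∏ k ∈ Finset.Ico (j + 1) r, |x - c (k + 1)| := by gcongr
    _ = _ := by ring

/-- The product of the distances to all zeros of `T_n` but one. -/
theorem prod_erase_zeroAngle_le {n j : ℕ} (hj : j < n) {t : ℝ}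
    (ht : t ∈ Icc (π / (2 * n)) (π - π / (2 * n))) :
    ∏ i ∈ (Finset.range n).erase j, |cos t - cos (zeroAngle n i)| ≤
      n / (2 ^ (n - 1) * sin (π / (2 * n))) := by
  have hpi := pi_pos
  have hn0 : (0 : ℝ) < n := by exact_mod_cast (by omega : 0 < n)
  have hn1 : (1 : ℝ) ≤ n := by exact_mod_cast (by omega : 1 ≤ n)
  set a := π / (2 * n) with ha
  have ha0 : 0 < a := by positivity
  have ha1 : a ≤ π / 2 := div_le_div_of_nonneg_left hpi.le (by norm_num) (by linarith)
  have hsa : 0 < sin a := sin_pos_of_pos_of_lt_pi ha0 (by linarith)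
  have hge : ∀ u ∈ Icc a (π - a), sin a ≤ sin u := by
    intro u hu
    rcases le_total u (π / 2) with h | h
    · exact sin_le_sin_of_le_of_le_pi_div_two (by linarith) h hu.1
    · rw [← sin_pi_sub u]
      exact sin_le_sin_of_le_of_le_pi_div_two (by linarith) (by linarith) (by linarith [hu.2])
  have hj1 : (j : ℝ) + 1 ≤ n := by exact_mod_cast hj
  have hj0 : (0 : ℝ) ≤ j := j.cast_nonneg
  have hzj : zeroAngle n j ∈ Icc a (π - a) := by
    have e : zeroAngle n j = (2 * j + 1) * a := by rw [zeroAngle, ha]; ring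
    have e2 : π = 2 * n * a := by rw [ha]; field_simp
    have := mul_le_mul_of_nonneg_right hj1 ha0.le
    have := mul_nonneg hj0 ha0.le
    constructor
    · rw [e]; linarith
    · rw [e]; linarith
  have hsub := cos_sub_cos t (zeroAngle n j)
  have hmean := hge ((t + zeroAngle n j) / 2)
    ⟨by linarith [ht.1, hzj.1], by linarith [ht.2, hzj.2]⟩
  have hprod : ∀ u : ℝ, |(Lagrange.nodal ((Finset.range n).erase j)
      (fun k => cos (zeroAngle n k))).eval u| =
      ∏ i ∈ (Finset.range n).erase j, |u - cos (zeroAngle n i)| := by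
    intro u
    rw [Lagrange.eval_nodal, Finset.abs_prod]
  rw [le_div_iff₀ (by positivity), ← hprod]
  by_cases hne : cos t = cos (zeroAngle n j)
  · have h1 := abs_eval_derivative_T_zero hj
    rw [derivative_T_eq_nodal, abs_mul,
      Lagrange.eval_nodal_derivative_eval_node_eq (v := fun k => cos (zeroAngle n k))
        (Finset.mem_range.2 hj), abs_of_pos (by positivity : (0 : ℝ) < 2 ^ (n - 1))] at h1
    have hs := sin_zeroAngle_pos hj
    rw [eq_div_iff hs.ne'] at h1
    rw [hne, ← h1]
    have h2 := hge _ hzj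
    rw [← mul_assoc, mul_comm (|_|)]
    gcongr
  · have h1 := cos_nat_mul_eq_nodal n t
    rw [Lagrange.nodal_eq_mul_nodal_erase (Finset.mem_range.2 hj), eval_mul, eval_sub, eval_X,
      eval_C] at h1
    have h2 : |cos (n * t)| ≤ n / sin a * |cos t - cos (zeroAngle n j)| := by
      have h3 := cos_sub_cos (n * t) (n * zeroAngle n j)
      rw [cos_nat_mul_zeroAngle (by omega), sub_zero] at h3
      have h4 := abs_sin_nat_mul_le n ((t - zeroAngle n j) / 2)
      have h5 : |cos t - cos (zeroAngle n j)| =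
          2 * sin ((t + zeroAngle n j) / 2) * |sin ((t - zeroAngle n j) / 2)| := by
        rw [hsub, abs_mul, abs_mul, abs_of_pos (hsa.trans_le hmean)]
        norm_num
      have h6 : |cos (n * t)| = 2 * |sin (n * ((t + zeroAngle n j) / 2))| *
          |sin (n * ((t - zeroAngle n j) / 2))| := by
        rw [h3, abs_mul, abs_mul, mul_div_assoc', mul_div_assoc', mul_add, mul_sub]
        norm_num
      rw [h5, h6, div_mul_eq_mul_div, le_div_iff₀ hsa]
      calc 2 * |sin (n * ((t + zeroAngle n j) / 2))| *
          |sin (n * ((t - zeroAngle n j) / 2))| * sin a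
          ≤ 2 * 1 * (n * |sin ((t - zeroAngle n j) / 2)|) * sin ((t + zeroAngle n j) / 2) := by
            gcongr
            exact abs_sin_le_one _
        _ = _ := by ring
    have h3 : 0 < |cos t - cos (zeroAngle n j)| := abs_pos.2 (sub_ne_zero.2 hne)
    rw [h1, abs_mul, abs_mul, abs_of_pos (by positivity : (0 : ℝ) < 2 ^ (n - 1)),
      div_mul_eq_mul_div, le_div_iff₀ hsa] at h2
    refine le_of_mul_le_mul_right ?_ h3
    refine le_trans (le_of_eq ?_) h2
    ring
end ContFrac

/-! ### Interpolation on a cell and its error for powers -/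

namespace ContFrac
open Real Polynomial

/-- The `k`-th extended Chebyshev point of the cell `[t₀, t₀ + l]`. -/
noncomputable def chebNode (t₀ l : ℝ) (r k : ℕ) : ℝ := t₀ + l * (1 + chat r k) / 2

theorem pi_div_mem_Ioc {r : ℕ} (hr : 2 ≤ r) : π / (2 * r + 2) ∈ Ioc 0 (π / 6) := by
  have h : (2 : ℝ) ≤ r := by exact_mod_cast hr
  have hpi := pi_pos
  exact ⟨by positivity, div_le_div_of_nonneg_left hpi.le (by norm_num) (by linarith)⟩

theorem cos_pi_div_pos {r : ℕ} (hr : 2 ≤ r) : 0 < cos (π / (2 * r + 2)) := by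
  obtain ⟨h1, h2⟩ := pi_div_mem_Ioc hr
  have hpi := pi_pos
  exact cos_pos_of_mem_Ioo ⟨by linarith, by linarith⟩

theorem sin_pi_div_pos {r : ℕ} (hr : 2 ≤ r) : 0 < sin (π / (2 * r + 2)) := by
  obtain ⟨h1, h2⟩ := pi_div_mem_Ioc hr
  have hpi := pi_pos
  exact sin_pos_of_pos_of_lt_pi h1 (by linarith)

theorem pi_div_cast (r : ℕ) : π / (2 * ((r + 1 : ℕ) : ℝ)) = π / (2 * r + 2) := by
  push_cast
  ring_nf

theorem chat_eq (r k : ℕ) : chat r k = -cos (zeroAngle (r + 1) k) / cos (π / (2 * r + 2)) := by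
  rw [chat, zeroAngle]
  congr 3
  push_cast
  field_simp

theorem chat_strictMono {r i k : ℕ} (hr : 2 ≤ r) (hik : i < k) (hk : k ≤ r) :
    chat r i < chat r k := by
  rw [chat_eq, chat_eq, div_lt_div_iff_of_pos_right (cos_pi_div_pos hr), neg_lt_neg_iff]
  exact cos_lt_cos_of_nonneg_of_le_pi (zeroAngle_mem (by omega)).1.le
    (zeroAngle_mem (by omega)).2.le (zeroAngle_strictMono (by omega) hik)

theorem chat_mono {r i k : ℕ} (hr : 2 ≤ r) (hik : i ≤ k) (hk : k ≤ r) :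
    chat r i ≤ chat r k := by
  rcases hik.eq_or_lt with rfl | h
  · exact le_rfl
  · exact (chat_strictMono hr h hk).le

theorem chat_mem {r k : ℕ} (hr : 2 ≤ r) (hk : k ≤ r) : chat r k ∈ Icc (-1) 1 := by
  have h1 := chat_mono hr (Nat.zero_le k) hk
  have h2 := chat_mono hr hk le_rfl
  rw [chat_zero (by omega)] at h1
  rw [chat_last (by omega)] at h2
  exact ⟨h1, h2⟩

theorem chebNode_strictMono {t₀ l : ℝ} (hl : 0 < l) {r i k : ℕ} (hr : 2 ≤ r) (hik : i < k)
    (hk : k ≤ r) : chebNode t₀ l r i < chebNode t₀ l r k := by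
  have := mul_lt_mul_of_pos_left (chat_strictMono hr hik hk) hl
  unfold chebNode
  linarith

theorem chebNode_mem {t₀ l : ℝ} (hl : 0 < l) {r k : ℕ} (hr : 2 ≤ r) (hk : k ≤ r) :
    chebNode t₀ l r k ∈ Icc t₀ (t₀ + l) := by
  obtain ⟨h1, h2⟩ := chat_mem hr hk
  have := mul_le_mul_of_nonneg_left h1 hl.le
  have := mul_le_mul_of_nonneg_left h2 hl.le
  unfold chebNode
  constructor <;> linarith

theorem chebNode_zero (t₀ l : ℝ) {r : ℕ} (hr : 2 ≤ r) : chebNode t₀ l r 0 = t₀ := by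
  rw [chebNode, chat_zero (by omega)]
  ring

theorem chebNode_last (t₀ l : ℝ) {r : ℕ} (hr : 2 ≤ r) : chebNode t₀ l r r = t₀ + l := by
  rw [chebNode, chat_last (by omega)]
  ring

/-- The parametrization of a cell by the angle of the corresponding Chebyshev points. -/
theorem exists_angle {t₀ l x : ℝ} (hl : 0 < l) {r : ℕ} (hr : 2 ≤ r) (hx : x ∈ Icc t₀ (t₀ + l)) :
    ∃ t ∈ Icc (π / (2 * r + 2)) (π - π / (2 * r + 2)),
      x = t₀ + l * (1 - cos t / cos (π / (2 * r + 2))) / 2 := by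
  have hca := cos_pi_div_pos hr
  obtain ⟨ha0, ha1⟩ := pi_div_mem_Ioc hr
  set a := π / (2 * r + 2)
  have hpi := pi_pos
  set z := (1 - 2 * (x - t₀) / l) * cos a with hz
  have hq0 : 0 ≤ 2 * (x - t₀) / l := div_nonneg (by linarith [hx.1]) hl.le
  have hq1 : 2 * (x - t₀) / l ≤ 2 := by
    rw [div_le_iff₀ hl]
    linarith [hx.2]
  have hz1 : z ≤ cos a := by nlinarith
  have hz2 : -cos a ≤ z := by nlinarith
  have hle := cos_le_one a
  have harc : cos (arccos z) = z := cos_arccos (by linarith) (by linarith)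
  refine ⟨arccos z, ⟨?_, ?_⟩, ?_⟩
  · rw [← arccos_cos ha0.le (by linarith : a ≤ π)]
    exact arccos_le_arccos hz1
  · rw [← arccos_cos ha0.le (by linarith : a ≤ π), ← arccos_neg]
    exact arccos_le_arccos hz2
  · rw [harc, hz, mul_div_cancel_right₀ _ hca.ne']
    field_simp
    ring

theorem abs_sub_chebNode {t₀ l t : ℝ} (hl : 0 < l) {r : ℕ} (hr : 2 ≤ r) (k : ℕ) :
    |t₀ + l * (1 - cos t / cos (π / (2 * r + 2))) / 2 - chebNode t₀ l r k| =
      l / (2 * cos (π / (2 * r + 2))) * |cos t - cos (zeroAngle (r + 1) k)| := by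
  have hca := cos_pi_div_pos hr
  have : 0 < l / (2 * cos (π / (2 * r + 2))) := by positivity
  rw [chebNode, chat_eq, abs_sub_comm (cos t)]
  conv_rhs => rw [← abs_of_pos this, ← abs_mul]
  congr 1
  field_simp
  ring

theorem prod_abs_sub_chebNode_le {t₀ l x : ℝ} (hl : 0 < l) {r : ℕ} (hr : 2 ≤ r)
    (hx : x ∈ Icc t₀ (t₀ + l)) : ∏ k ∈ Finset.range (r + 1), |x - chebNode t₀ l r k| ≤
      2 * (l / (4 * cos (π / (2 * r + 2)))) ^ (r + 1) := by
  obtain ⟨t, ht, rfl⟩ := exists_angle hl hr hx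
  have hca := cos_pi_div_pos hr
  simp_rw [abs_sub_chebNode hl hr]
  rw [Finset.prod_mul_distrib, Finset.prod_const, Finset.card_range]
  have h1 := abs_cos_le_one ((r + 1 : ℕ) * t)
  rw [cos_nat_mul_eq_nodal, abs_mul, Lagrange.eval_nodal, Finset.abs_prod,
    abs_of_pos (by positivity)] at h1
  have e : l / (4 * cos (π / (2 * r + 2))) = l / (2 * cos (π / (2 * r + 2))) * (1 / 2) := by
    field_simp
    norm_num
  rw [e, mul_pow, mul_left_comm]
  refine mul_le_mul_of_nonneg_left ?_ (by positivity)
  rw [div_pow, one_pow, mul_one_div, le_div_iff₀ (by positivity), pow_succ]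
  simp only [Nat.add_sub_cancel] at h1
  linarith

theorem prod_erase_abs_sub_chebNode_le {t₀ l x : ℝ} (hl : 0 < l) {r j : ℕ} (hr : 2 ≤ r)
    (hj : j ≤ r) (hx : x ∈ Icc t₀ (t₀ + l)) :
    ∏ k ∈ (Finset.range (r + 1)).erase j, |x - chebNode t₀ l r k| ≤
      (l / (4 * cos (π / (2 * r + 2)))) ^ r * ((r + 1) / sin (π / (2 * r + 2))) := by
  obtain ⟨t, ht, rfl⟩ := exists_angle hl hr hx
  have hca := cos_pi_div_pos hr
  have hsa := sin_pi_div_pos hr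
  simp_rw [abs_sub_chebNode hl hr]
  rw [Finset.prod_mul_distrib, Finset.prod_const,
    Finset.card_erase_of_mem (Finset.mem_range.2 (by omega)), Finset.card_range]
  have h1 := prod_erase_zeroAngle_le (n := r + 1) (j := j) (by omega) (t := t)
    (by rw [pi_div_cast]; exact ht)
  rw [pi_div_cast] at h1
  simp only [Nat.add_sub_cancel] at h1 ⊢
  refine (mul_le_mul_of_nonneg_left h1 (by positivity)).trans (le_of_eq ?_)
  push_cast
  have e : l / (4 * cos (π / (2 * r + 2))) = l / (2 * cos (π / (2 * r + 2))) * (1 / 2) := by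
    field_simp
    norm_num
  rw [e, mul_pow, div_pow 1 2, one_pow]
  field_simp

theorem eval_comp_affine (p : ℝ[X]) (b m z : ℝ) :
    (p.comp (C b + C m * X)).eval z = p.eval (b + m * z) := by
  simp [eval_comp]

/-- On a cell, a polynomial of degree `≤ r` is at most `ψ(r)` times its maximum over the extended
Chebyshev points. -/
theorem abs_eval_le_psi_mul {t₀ l x W : ℝ} (hl : 0 < l) {r : ℕ} (hr : 2 ≤ r) {p : ℝ[X]}
    (hp : p.natDegree ≤ r) (hW : ∀ k ≤ r, |p.eval (chebNode t₀ l r k)| ≤ W)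
    (hx : x ∈ Icc t₀ (t₀ + l)) : |p.eval x| ≤ psi r * W := by
  obtain ⟨t, ht, rfl⟩ := exists_angle hl hr hx
  have hca := cos_pi_div_pos hr
  set a := π / (2 * r + 2) with ha
  have e : ∀ z, t₀ + l * (1 - z / cos a) / 2 = (t₀ + l / 2) + -(l / (2 * cos a)) * z := by
    intro z
    field_simp
    ring
  have hdeg : (p.comp (C (t₀ + l / 2) + C (-(l / (2 * cos a))) * X)).natDegree ≤ r := by
    refine natDegree_comp_le.trans ((Nat.mul_le_mul hp ?_).trans (mul_one r).le)
    exact natDegree_add_le_of_degree_le (by simp) (natDegree_C_mul_le _ _ |>.trans natDegree_X_le)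
  rw [e, ← eval_comp_affine]
  refine abs_eval_cos_le_psi hr ((degree_le_of_natDegree_le hdeg).trans_lt ?_) ?_ ht
  · exact_mod_cast Nat.lt_succ_self r
  · intro k hk
    rw [eval_comp_affine, ← e]
    have := hW k (by omega)
    rwa [chebNode, chat_eq, neg_div, ← sub_eq_add_neg] at this

/-- Markov's inequality on a cell. -/
theorem abs_eval_derivative_le {t₀ l x W : ℝ} (hl : 0 < l) {r : ℕ} {p : ℝ[X]}
    (hp : p.natDegree ≤ r) (hW : ∀ y ∈ Icc t₀ (t₀ + l), |p.eval y| ≤ W)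
    (hx : x ∈ Icc t₀ (t₀ + l)) : |(derivative p).eval x| ≤ 2 / l * (r ^ 2 * W) := by
  have hmem : ∀ y, 2 * (y - t₀) / l - 1 ∈ Icc (-1 : ℝ) 1 ↔ y ∈ Icc t₀ (t₀ + l) := by
    intro y
    rw [mem_Icc, mem_Icc, sub_le_iff_le_add, div_le_iff₀ hl, le_sub_iff_add_le, le_div_iff₀ hl]
    constructor <;> rintro ⟨h1, h2⟩ <;> constructor <;> linarith
  have hdeg : (p.comp (C (t₀ + l / 2) + C (l / 2) * X)).natDegree ≤ r := by
    refine natDegree_comp_le.trans ((Nat.mul_le_mul hp ?_).trans (mul_one r).le)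
    exact natDegree_add_le_of_degree_le (by simp) (natDegree_C_mul_le _ _ |>.trans natDegree_X_le)
  have key := markov hdeg (W := W) (x := 2 * (x - t₀) / l - 1) ?_ ((hmem x).2 hx)
  · have e : t₀ + l / 2 + l / 2 * (2 * (x - t₀) / l - 1) = x := by
      field_simp
      ring
    rw [derivative_comp] at key
    simp only [derivative_add, derivative_C, derivative_mul, derivative_X, zero_add, zero_mul,
      mul_one, eval_mul, eval_C] at key
    rw [eval_comp_affine, e, abs_mul, abs_of_pos (by positivity : 0 < l / 2)] at key
    rw [div_mul_eq_mul_div, le_div_iff₀ hl]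
    linarith
  · intro y hy
    rw [eval_comp_affine]
    refine hW _ ((hmem _).1 ?_)
    have e : 2 * (t₀ + l / 2 + l / 2 * y - t₀) / l - 1 = y := by
      field_simp
      ring
    rwa [e]

/-- The `k`-th derivative of `x ↦ (x + d) ^ (-2 s)`. -/
noncomputable def powDeriv (s d : ℝ) (k : ℕ) (x : ℝ) : ℝ :=
  (-1) ^ k * (∏ j ∈ Finset.range k, (2 * s + j)) * (x + d) ^ (-(2 * s) - k)

theorem powDeriv_zero (s d x : ℝ) : powDeriv s d 0 x = (x + d) ^ (-(2 * s)) := by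
  simp [powDeriv]

theorem hasDerivAt_powDeriv (s : ℝ) {d x : ℝ} (hx : 0 < x + d) (k : ℕ) :
    HasDerivAt (powDeriv s d k) (powDeriv s d (k + 1) x) x := by
  have h1 : HasDerivAt (fun y : ℝ => y + d) 1 x := (hasDerivAt_id x).add_const d
  have h2 := (h1.rpow_const (p := -(2 * s) - k) (Or.inl hx.ne')).const_mul
    ((-1) ^ k * (∏ j ∈ Finset.range k, (2 * s + j)))
  refine h2.congr_deriv ?_
  rw [powDeriv, Finset.prod_range_succ, pow_succ]
  push_cast
  rw [show -(2 * s) - (k + 1 : ℝ) = -(2 * s) - k - 1 by ring]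
  ring

theorem add_rpow_le_exp_mul {s d χ h x y : ℝ} (hs : 0 ≤ s) (hχ : 0 < χ) (hx : 0 < x + d)
    (hy : χ ≤ y + d) (hxy : |x - y| ≤ h) :
    (y + d) ^ (-(2 * s)) ≤ exp (2 * s * h / χ) * (x + d) ^ (-(2 * s)) := by
  have hy0 : 0 < y + d := hχ.trans_le hy
  have hh : 0 ≤ h := (abs_nonneg _).trans hxy
  have h1 : x + d ≤ exp (h / χ) * (y + d) := by
    have h2 := add_one_le_exp (h / χ)
    have h3 : h ≤ h / χ * (y + d) := by
      rw [div_mul_eq_mul_div, le_div_iff₀ hχ]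
      exact mul_le_mul_of_nonneg_left hy hh
    have h4 := mul_le_mul_of_nonneg_right h2 hy0.le
    linarith [le_abs_self (x - y)]
  have h2 := rpow_le_rpow hx.le h1 (by linarith : 0 ≤ 2 * s)
  rw [mul_rpow (exp_pos _).le hy0.le, ← exp_mul] at h2
  rw [rpow_neg hy0.le, rpow_neg hx.le]
  have e : h / χ * (2 * s) = 2 * s * h / χ := by ring
  rw [e] at h2
  have := rpow_pos_of_pos hx (2 * s)
  have := rpow_pos_of_pos hy0 (2 * s)
  rw [← div_eq_mul_inv, le_div_iff₀ (by positivity), inv_mul_eq_div, div_le_iff₀ (by positivity)]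
  exact h2

theorem abs_powDeriv_le {s d χ h x y : ℝ} (hs : 0 ≤ s) (hχ : 0 < χ) (hx : 0 < x + d)
    (hy : χ ≤ y + d) (hxy : |x - y| ≤ h) (n : ℕ) :
    |powDeriv s d n y| ≤ (∏ j ∈ Finset.range n, (2 * s + j)) * (1 / χ) ^ n *
      (exp (2 * s * h / χ) * (x + d) ^ (-(2 * s))) := by
  have hy0 : 0 < y + d := hχ.trans_le hy
  have hprod : 0 ≤ ∏ j ∈ Finset.range n, (2 * s + j) :=
    Finset.prod_nonneg fun j _ => by positivity
  rw [powDeriv, abs_mul, abs_mul, abs_pow, abs_neg, abs_one, one_pow, one_mul,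
    abs_of_nonneg hprod, abs_of_pos (rpow_pos_of_pos hy0 _), mul_assoc]
  refine mul_le_mul_of_nonneg_left ?_ hprod
  rw [rpow_sub hy0, rpow_natCast, div_eq_inv_mul]
  refine mul_le_mul ?_ (add_rpow_le_exp_mul hs hχ hx hy hxy) (by positivity) (by positivity)
  rw [div_pow, one_pow, one_div]
  exact inv_anti₀ (by positivity) (pow_le_pow_left₀ hχ.le hy n)

theorem G_eq (χ s h : ℝ) (r : ℕ) : G χ s h r * ((r + 1).factorial : ℝ) =
    2 * (∏ j ∈ Finset.range (r + 1), (2 * s + j)) * (1 / χ) ^ (r + 1) * exp (2 * s * h / χ) *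
      (1 / (4 * cos (π / (2 * r + 2)))) ^ (r + 1) := by
  have h1 : (∏ j ∈ Finset.range (r + 1), (2 * s + j) / (2 * j + 2)) * ((r + 1).factorial : ℝ) =
      (∏ j ∈ Finset.range (r + 1), (2 * s + j)) * (1 / 2) ^ (r + 1) := by
    rw [← Finset.prod_range_add_one_eq_factorial, Nat.cast_prod, ← Finset.prod_mul_distrib]
    have : (1 / 2 : ℝ) ^ (r + 1) = ∏ _j ∈ Finset.range (r + 1), (1 / 2 : ℝ) := by simp
    rw [this, ← Finset.prod_mul_distrib]
    refine Finset.prod_congr rfl fun j _ => ?_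
    push_cast
    field_simp
  have h2 : 1 / (4 * cos (π / (2 * r + 2))) = 1 / 2 * (1 / (2 * cos (π / (2 * r + 2)))) := by
    rw [one_div_mul_one_div]
    ring_nf
  rw [h2, mul_pow, G]
  calc _ = 2 * exp (2 * s * h / χ) *
      ((∏ j ∈ Finset.range (r + 1), (2 * s + j) / (2 * j + 2)) * ((r + 1).factorial : ℝ)) *
        (1 / χ) ^ (r + 1) * (1 / (2 * cos (π / (2 * r + 2)))) ^ (r + 1) := by ring
    _ = _ := by rw [h1]; ring

section InterpolationError

variable {s d χ t₀ l h x : ℝ} {r : ℕ} {p : ℝ[X]}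

theorem hasDerivAt_powDeriv_sub (hχ : 0 < χ) (hd : χ ≤ t₀ + d) (k : ℕ) {y : ℝ}
    (hy : y ∈ Icc t₀ (t₀ + l)) :
    HasDerivAt (fun z => powDeriv s d k z - (derivative^[k] p).eval z)
      (powDeriv s d (k + 1) y - (derivative^[k + 1] p).eval y) y := by
  have h1 := (derivative^[k] p).hasDerivAt y
  rw [← Function.iterate_succ_apply' derivative] at h1
  exact (hasDerivAt_powDeriv s (by linarith [hy.1]) k).sub h1

theorem abs_powDeriv_sub_le (hs : 0 < s) (hχ : 0 < χ) (hlh : l ≤ h)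
    (hd : χ ≤ t₀ + d) (hp : p.natDegree ≤ r) (hx : x ∈ Icc t₀ (t₀ + l)) {y : ℝ}
    (hy : y ∈ Icc t₀ (t₀ + l)) :
    |powDeriv s d (r + 1) y - (derivative^[r + 1] p).eval y| ≤
      (∏ j ∈ Finset.range (r + 1), (2 * s + j)) * (1 / χ) ^ (r + 1) *
      (exp (2 * s * h / χ) * (x + d) ^ (-(2 * s))) := by
  rw [iterate_derivative_eq_zero (by omega : p.natDegree < r + 1), eval_zero, sub_zero]
  refine abs_powDeriv_le hs.le hχ (by linarith [hx.1]) (by linarith [hy.1]) ?_ _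
  rw [abs_le]
  constructor <;> linarith [hx.1, hx.2, hy.1, hy.2]

/-- Pointwise error of the interpolation of `x ↦ (x + d) ^ (-2 s)`. -/
theorem abs_sub_eval_le (hs : 0 < s) (hχ : 0 < χ) (hl : 0 < l) (hlh : l ≤ h) (hr : 2 ≤ r)
    (hd : χ ≤ t₀ + d) (hp : p.natDegree ≤ r)
    (hpk : ∀ k ≤ r, p.eval (chebNode t₀ l r k) = (chebNode t₀ l r k + d) ^ (-(2 * s)))
    (hx : x ∈ Icc t₀ (t₀ + l)) :
    |(x + d) ^ (-(2 * s)) - p.eval x| ≤ G χ s h r * h ^ (r + 1) * (x + d) ^ (-(2 * s)) := by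
  have hca := cos_pi_div_pos hr
  have hxd : 0 < x + d := by linarith [hx.1]
  have hinj : Set.InjOn (chebNode t₀ l r) (Finset.range (r + 1) : Set ℕ) := by
    intro i hi k hk hik
    have hi' := Finset.mem_range.1 (Finset.mem_coe.1 hi)
    have hk' := Finset.mem_range.1 (Finset.mem_coe.1 hk)
    rcases lt_trichotomy i k with h | h | h
    · exact absurd hik (chebNode_strictMono hl hr h (by omega)).ne
    · exact h
    · exact absurd hik (chebNode_strictMono hl hr h (by omega)).ne'
  have hcard : ((Finset.range (r + 1)).image (chebNode t₀ l r)).card = r + 1 := by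
    rw [Finset.card_image_of_injOn hinj, Finset.card_range]
  have key := abs_mul_factorial_le
    (g := fun k z => powDeriv s d k z - (derivative^[k] p).eval z)
    (Z := (Finset.range (r + 1)).image (chebNode t₀ l r))
    (fun k y hy => hasDerivAt_powDeriv_sub hχ hd k hy) (by
      intro z hz
      obtain ⟨k, hk, rfl⟩ := Finset.mem_image.1 (Finset.mem_coe.1 hz)
      exact chebNode_mem hl hr (by have := Finset.mem_range.1 hk; omega)) (by
      intro z hz
      obtain ⟨k, hk, rfl⟩ := Finset.mem_image.1 hz
      simp only [powDeriv_zero, Function.iterate_zero, id]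
      rw [hpk k (by have := Finset.mem_range.1 hk; omega), sub_self]) hx (by
      intro ζ hζ
      rw [hcard]
      exact abs_powDeriv_sub_le hs hχ hlh hd hp hx hζ)
  rw [hcard, Finset.prod_image hinj] at key
  simp only [powDeriv_zero, Function.iterate_zero, id] at key
  have hprod : 0 ≤ ∏ j ∈ Finset.range (r + 1), (2 * s + j) :=
    Finset.prod_nonneg fun j _ => by positivity
  have hf : (0 : ℝ) < ((r + 1).factorial : ℝ) := by positivity
  refine le_of_mul_le_mul_right (key.trans ?_) hf
  have h1 := (prod_abs_sub_chebNode_le hl hr hx).trans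
    (mul_le_mul_of_nonneg_left (pow_le_pow_left₀ (by positivity)
      (div_le_div_of_nonneg_right hlh (by positivity)) (r + 1)) zero_le_two)
  refine (mul_le_mul_of_nonneg_left h1 (by positivity)).trans (le_of_eq ?_)
  rw [show G χ s h r * h ^ (r + 1) * (x + d) ^ (-(2 * s)) * ((r + 1).factorial : ℝ) =
    G χ s h r * ((r + 1).factorial : ℝ) * (h ^ (r + 1) * (x + d) ^ (-(2 * s))) by ring, G_eq,
    div_pow, div_pow 1 (4 * cos (π / (2 * r + 2))), one_pow]
  generalize 4 * cos (π / (2 * r + 2)) = u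
  ring

theorem exists_mem_Icc_succ {c : ℕ → ℝ} {x : ℝ} {r : ℕ} (hr : r ≠ 0) (h0 : c 0 ≤ x)
    (hx : x ≤ c r) : ∃ j < r, x ∈ Icc (c j) (c (j + 1)) := by
  induction r with
  | zero => exact absurd rfl hr
  | succ r ih =>
    by_cases h : c r ≤ x
    · exact ⟨r, by omega, h, hx⟩
    · push Not at h
      have : r ≠ 0 := by
        rintro rfl
        linarith
      obtain ⟨j, hj, hjx⟩ := ih this h.le
      exact ⟨j, by omega, hjx⟩

/-- Error of the derivative of the interpolating polynomial of `x ↦ (x + d) ^ (-2 s)`. The error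
vanishes at the nodes, so that its derivative has zeros which interlace them. -/
theorem abs_sub_eval_derivative_le (hs : 0 < s) (hχ : 0 < χ) (hl : 0 < l) (hlh : l ≤ h)
    (hr : 2 ≤ r) (hd : χ ≤ t₀ + d) (hp : p.natDegree ≤ r)
    (hpk : ∀ k ≤ r, p.eval (chebNode t₀ l r k) = (chebNode t₀ l r k + d) ^ (-(2 * s)))
    (hx : x ∈ Icc t₀ (t₀ + l)) :
    |powDeriv s d 1 x - (derivative p).eval x| ≤ G χ s h r * h ^ r *
      (4 * (r + 1) ^ 2 * (cos (π / (2 * r + 2)) / sin (π / (2 * r + 2)))) *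
        (x + d) ^ (-(2 * s)) := by
  have hca := cos_pi_div_pos hr
  have hsa := sin_pi_div_pos hr
  have hxd : 0 < x + d := by linarith [hx.1]
  have hcm : ∀ k ≤ r, chebNode t₀ l r k ∈ Icc t₀ (t₀ + l) := fun k hk => chebNode_mem hl hr hk
  have hex : ∀ k, ∃ z, k < r → z ∈ Ioo (chebNode t₀ l r k) (chebNode t₀ l r (k + 1)) ∧
      powDeriv s d 1 z - (derivative p).eval z = 0 := by
    intro k
    by_cases hk : k < r
    · have hsub : Icc (chebNode t₀ l r k) (chebNode t₀ l r (k + 1)) ⊆ Icc t₀ (t₀ + l) :=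
        Icc_subset_Icc (hcm k hk.le).1 (hcm (k + 1) hk).2
      obtain ⟨z, hz, hz0⟩ := exists_hasDerivAt_eq_zero
        (chebNode_strictMono hl hr (Nat.lt_succ_self k) hk)
        (f := fun z => powDeriv s d 0 z - (derivative^[0] p).eval z)
        (f' := fun z => powDeriv s d 1 z - (derivative^[1] p).eval z)
        (fun y hy => (hasDerivAt_powDeriv_sub hχ hd 0
          (hsub hy)).continuousAt.continuousWithinAt)
        (by
          simp only [powDeriv_zero, Function.iterate_zero, id]
          rw [hpk k hk.le, hpk (k + 1) hk, sub_self, sub_self])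
        (fun y hy => hasDerivAt_powDeriv_sub hχ hd 0 (hsub (Ioo_subset_Icc_self hy)))
      exact ⟨z, fun _ => ⟨hz, hz0⟩⟩
    · exact ⟨0, fun h => absurd h hk⟩
  choose z hz using hex
  have hzlt : ∀ i k, i < k → k < r → z i < z k := by
    intro i k hik hk
    refine (hz i (by omega)).1.2.trans_le (le_trans ?_ (hz k hk).1.1.le)
    rcases (by omega : i + 1 = k ∨ i + 1 < k) with h | h
    · rw [h]
    · exact (chebNode_strictMono hl hr h hk.le).le
  have hinj : Set.InjOn z (Finset.range r : Set ℕ) := by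
    intro i hi k hk hik
    have hi' := Finset.mem_range.1 (Finset.mem_coe.1 hi)
    have hk' := Finset.mem_range.1 (Finset.mem_coe.1 hk)
    rcases lt_trichotomy i k with h | h | h
    · exact absurd hik (hzlt i k h hk').ne
    · exact h
    · exact absurd hik (hzlt k i h hi').ne'
  have hcard : ((Finset.range r).image z).card = r := by
    rw [Finset.card_image_of_injOn hinj, Finset.card_range]
  have key := abs_mul_factorial_le
    (g := fun k y => powDeriv s d (k + 1) y - (derivative^[k + 1] p).eval y)
    (Z := (Finset.range r).image z)
    (fun k y hy => hasDerivAt_powDeriv_sub hχ hd (k + 1) hy) (by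
      intro y hy
      obtain ⟨k, hk, rfl⟩ := Finset.mem_image.1 (Finset.mem_coe.1 hy)
      have hk' := Finset.mem_range.1 hk
      have := (hz k hk').1
      exact ⟨(hcm k hk'.le).1.trans this.1.le, this.2.le.trans (hcm (k + 1) hk').2⟩) (by
      intro y hy
      obtain ⟨k, hk, rfl⟩ := Finset.mem_image.1 hy
      exact (hz k (Finset.mem_range.1 hk)).2) hx (by
      intro ζ hζ
      rw [hcard]
      exact abs_powDeriv_sub_le hs hχ hlh hd hp hx hζ)
  rw [hcard, Finset.prod_image hinj] at key
  simp only [zero_add, Function.iterate_one] at key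
  obtain ⟨j, hj, hjx⟩ := exists_mem_Icc_succ (c := chebNode t₀ l r) (x := x) (r := r) (by omega)
    (by rw [chebNode_zero _ _ hr]; exact hx.1) (by rw [chebNode_last _ _ hr]; exact hx.2)
  have h1 := prod_interlacing_le (c := chebNode t₀ l r) (z := z)
    (fun k hk => Ioo_subset_Icc_self (hz k hk).1) (fun i k hik hk => by
      rcases hik.eq_or_lt with rfl | h
      · exact le_rfl
      · exact (chebNode_strictMono hl hr h hk).le) hj hjx
  have h2 := prod_erase_abs_sub_chebNode_le (j := j) hl hr (by omega) hx
  have h3 := prod_erase_abs_sub_chebNode_le (j := j + 1) hl hr (by omega) hx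
  have h4 : (l / (4 * cos (π / (2 * r + 2)))) ^ r ≤ (h / (4 * cos (π / (2 * r + 2)))) ^ r :=
    pow_le_pow_left₀ (by positivity) (div_le_div_of_nonneg_right hlh (by positivity)) r
  have h5 := mul_le_mul_of_nonneg_right h4
    (by positivity : 0 ≤ ((r : ℝ) + 1) / sin (π / (2 * r + 2)))
  have h6 : ∏ k ∈ Finset.range r, |x - z k| ≤ 2 * ((h / (4 * cos (π / (2 * r + 2)))) ^ r *
      ((r + 1) / sin (π / (2 * r + 2)))) := by linarith
  have hprod : 0 ≤ ∏ j ∈ Finset.range (r + 1), (2 * s + j) :=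
    Finset.prod_nonneg fun j _ => by positivity
  have hf : (0 : ℝ) < ((r + 1).factorial : ℝ) := by positivity
  have h7 := mul_le_mul_of_nonneg_left (key.trans (mul_le_mul_of_nonneg_left h6 (by positivity)))
    (by positivity : (0 : ℝ) ≤ r + 1)
  refine le_of_mul_le_mul_right (le_trans (le_of_eq ?_) (h7.trans (le_of_eq ?_))) hf
  · rw [Nat.factorial_succ]
    push_cast
    ring
  · have e : ∀ u v : ℝ, 0 < u → 0 < v → ∀ A B C E : ℝ,
        (r + 1) * (A * B * (C * E) * (2 * ((h / (4 * u)) ^ r * ((r + 1) / v)))) =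
        2 * A * B * C * (1 / (4 * u)) ^ (r + 1) * (h ^ r * (4 * (r + 1) ^ 2 * (u / v)) * E) := by
      intro u v hu hv A B C E
      have h8 : 1 / (4 * u) * (u / v) = 1 / (4 * v) := by field_simp
      rw [pow_succ, div_pow h, div_pow 1 (4 * u) r, one_pow]
      calc _ = (1 / (4 * v)) * (8 * (r + 1) ^ 2 * (A * B * C * E) * (h ^ r / (4 * u) ^ r)) := by
            ring
        _ = _ := by
          rw [← h8]
          ring
    rw [e _ _ hca hsa, ← G_eq]
    ring

end InterpolationError
end ContFrac

/-! ### Compositions of the maps and log-Lipschitz cones -/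

namespace ContFrac
open Real

namespace Alphabet

variable (A : Alphabet)

theorem a_le_aInf (k : ℕ) : A.a k ≤ A.aInf :=
  (monotone_nat_of_le_succ fun k => (A.ends_aux k).2.2.1).ge_of_tendsto A.tendsto_a k

theorem Btilde_pos (k : ℕ) : 0 < A.Btilde k ∧ 0 < A.Btilde (k + 1) := by
  have hγ := A.one_le_gmin
  induction k with
  | zero => exact ⟨one_pos, by change 0 < A.gmin; linarith⟩
  | succ k ih =>
    refine ⟨ih.2, ?_⟩
    change 0 < A.Btilde k + A.gmin * A.Btilde (k + 1)
    have := mul_pos (by linarith : 0 < A.gmin) ih.2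
    linarith [ih.1]

theorem hasDerivAt_theta {β x : ℝ} (h : x + β ≠ 0) :
    HasDerivAt (theta β) (-1 / (x + β) ^ 2) x := by
  have h1 : HasDerivAt (fun y : ℝ => y + β) 1 x := (hasDerivAt_id x).add_const β
  have h2 : HasDerivAt (theta β) ((0 * (x + β) - 1 * 1) / (x + β) ^ 2) x :=
    (hasDerivAt_const x (1 : ℝ)).fun_div h1 h
  simpa using h2

/-- The derivative of a composition of `k + 1` maps `θ_β` is `± (B' x + B)⁻²`, where `B'` and `B`
are the last two denominators of the continued fraction with the given digits. -/
theorem exists_hasDerivAt_foldr (k : ℕ) : ∀ L : List ℝ, L.length = k + 1 →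
    (∀ β ∈ L, β ∈ A.digits) → ∃ B' B e : ℝ, |e| = 1 ∧ 0 < B' ∧ 0 < B ∧ A.Btilde k ≤ B' ∧
      A.Btilde (k + 1) ≤ B ∧ (A.a k + A.gmin) * B' ≤ B ∧ A.a (k + 1) * B ≤ B' ∧
      B' ≤ A.b (k + 1) * B ∧
      ∀ x, 0 ≤ x → HasDerivAt (fun y => L.foldr theta y) (e / (B' * x + B) ^ 2) x := by
  have hγ := A.one_le_gmin
  have hΓ := A.gmin_lt_gmax
  induction k with
  | zero =>
    intro L hL hmem
    obtain ⟨β, rfl⟩ := List.length_eq_one_iff.1 hL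
    have hβ := hmem β (by simp)
    have h1 := A.gmin_le hβ
    have h2 := A.le_gmax hβ
    have h0 : 0 < β := by linarith
    refine ⟨1, β, -1, by simp, one_pos, h0, le_rfl, h1, ?_, ?_, ?_, ?_⟩
    · change (0 + A.gmin) * 1 ≤ β
      linarith
    · change 1 / (1 / A.gmin + A.gmax) * β ≤ 1
      have : 0 < 1 / A.gmin := by positivity
      rw [one_div_mul_eq_div, div_le_one (by linarith)]
      linarith
    · change 1 ≤ 1 / (0 + A.gmin) * β
      rw [zero_add, one_div_mul_eq_div, one_le_div (by linarith)]
      exact h1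
    · intro x hx
      simp only [List.foldr_cons, List.foldr_nil, one_mul]
      exact hasDerivAt_theta (by linarith)
  | succ k ih =>
    intro L hL hmem
    rcases L.eq_nil_or_concat with rfl | ⟨L, β, rfl⟩
    · simp at hL
    have hβ := hmem β (by simp)
    obtain ⟨B', B, e, he, hB', hB, h1, h2, h3, h4, h5, h6⟩ := ih L (by simpa using hL)
      (fun x hx => hmem x (by simp [hx]))
    have g1 := A.gmin_le hβ
    have g2 := A.le_gmax hβ
    have hβ0 : 0 < β := by linarith
    obtain ⟨a0, ab, -, -⟩ := A.ends_aux (k + 1)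
    have m1 := mul_le_mul_of_nonneg_right g1 hB.le
    have m2 := mul_le_mul_of_nonneg_right g2 hB.le
    have m3 := mul_pos hβ0 hB
    refine ⟨B, B' + β * B, -e, by rwa [abs_neg], hB, by linarith, h2, ?_, ?_, ?_, ?_, ?_⟩
    · change A.Btilde k + A.gmin * A.Btilde (k + 1) ≤ _
      have : A.gmin * A.Btilde (k + 1) ≤ β * B :=
        mul_le_mul g1 h2 (A.Btilde_pos k).2.le hβ0.le
      linarith
    · linarith
    · change 1 / (A.b (k + 1) + A.gmax) * (B' + β * B) ≤ B
      rw [one_div_mul_eq_div, div_le_iff₀ (by linarith)]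
      linarith
    · change B ≤ 1 / (A.a (k + 1) + A.gmin) * (B' + β * B)
      rw [one_div_mul_eq_div, le_div_iff₀ (by linarith)]
      linarith
    · intro x hx
      have hxβ : 0 < x + β := by linarith
      have hθ : 0 ≤ theta β x := by
        unfold theta
        positivity
      have hd := (h6 (theta β x) hθ).comp x (hasDerivAt_theta hxβ.ne')
      have hfun : (fun y => (L.concat β).foldr theta y) =
          (fun y => L.foldr theta y) ∘ theta β := by
        funext y
        simp
      rw [hfun]
      refine hd.congr_deriv ?_
      have hpos : B' * theta β x + B ≠ 0 := by positivity
      have hpos' : B * x + (B' + β * B) ≠ 0 := by positivity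
      unfold theta at *
      have e2 : B' * (1 / (x + β)) + B = (B * x + (B' + β * B)) / (x + β) := by
        field_simp
        ring
      rw [e2]
      field_simp

variable {A}

theorem exists_hasDerivAt_thetaWord {ν : ℕ} (hν : 1 ≤ ν) (ω : A.Word ν) :
    ∃ B' B e : ℝ, |e| = 1 ∧ 0 < B' ∧ 0 < B ∧ A.Btilde (ν - 1) ≤ B' ∧ A.Btilde ν ≤ B ∧
      (A.a (ν - 1) + A.gmin) * B' ≤ B ∧
      ∀ x, 0 ≤ x → HasDerivAt (thetaWord ω) (e / (B' * x + B) ^ 2) x := by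
  obtain ⟨k, rfl⟩ : ∃ k, ν = k + 1 := ⟨ν - 1, by omega⟩
  obtain ⟨B', B, e, h0, h1, h2, h3, h4, h5, -, -, h6⟩ := A.exists_hasDerivAt_foldr k
    (List.ofFn fun j => (ω j : ℝ)) (by simp) (by simp [List.mem_ofFn])
  exact ⟨B', B, e, h0, h1, h2, h3, h4, h5, h6⟩

theorem exists_gWord_eq {ν : ℕ} (hν : 1 ≤ ν) (ω : A.Word ν) :
    ∃ B' B : ℝ, 0 < B' ∧ 0 < B ∧ A.Btilde (ν - 1) ≤ B' ∧ A.Btilde ν ≤ B ∧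
      (A.a (ν - 1) + A.gmin) * B' ≤ B ∧ ∀ x, 0 ≤ x → gWord ω x = ((B' * x + B) ^ 2)⁻¹ := by
  obtain ⟨B', B, e, h0, h1, h2, h3, h4, h5, h6⟩ := exists_hasDerivAt_thetaWord hν ω
  refine ⟨B', B, h1, h2, h3, h4, h5, fun x hx => ?_⟩
  rw [gWord, (h6 x hx).deriv, abs_div, h0, abs_of_pos (by positivity), one_div]

theorem gWord_nonneg {ν : ℕ} (ω : A.Word ν) (x : ℝ) : 0 ≤ gWord ω x := abs_nonneg _

theorem gWord_le {ν : ℕ} (hν : 1 ≤ ν) (ω : A.Word ν) {x : ℝ} (hx : x ∈ A.S) :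
    gWord ω x ≤ A.c ν := by
  obtain ⟨B', B, h1, h2, h3, h4, -, h6⟩ := exists_gWord_eq hν ω
  have h0 := A.aInf_nonneg
  rw [h6 x (h0.trans hx.1), c]
  have hb := (A.Btilde_pos (ν - 1)).1
  have hb' : 0 < A.Btilde ν := by
    have := (A.Btilde_pos (ν - 1)).2
    rwa [Nat.sub_add_cancel hν] at this
  refine inv_anti₀ (by positivity) (pow_le_pow_left₀ (by positivity) ?_ 2)
  have := mul_le_mul h3 hx.1 h0 h1.le
  linarith

theorem thetaWord_mem {ν : ℕ} (ω : A.Word ν) {x : ℝ} (hx : x ∈ A.S) : thetaWord ω x ∈ A.S := by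
  have : ∀ L : List ℝ, (∀ β ∈ L, β ∈ A.digits) → L.foldr theta x ∈ A.S := by
    intro L hL
    induction L with
    | nil => exact hx
    | cons β L ih =>
      exact A.theta_mem (hL β (by simp)) (ih fun b hb => hL b (by simp [hb]))
  exact this _ (by simp [List.mem_ofFn])

theorem abs_thetaWord_sub_le {ν : ℕ} (hν : 1 ≤ ν) (ω : A.Word ν) {x y : ℝ} (hx : x ∈ A.S)
    (hy : y ∈ A.S) : |thetaWord ω x - thetaWord ω y| ≤ A.c ν * |x - y| := by
  obtain ⟨B', B, e, -, -, -, -, -, -, h6⟩ := exists_hasDerivAt_thetaWord hν ω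
  have := (convex_Icc A.aInf A.bInf).norm_image_sub_le_of_norm_hasDerivWithin_le
    (f := thetaWord ω) (C := A.c ν) (fun z hz => (h6 z (A.aInf_nonneg.trans hz.1)).hasDerivWithinAt)
    (fun z hz => by
      rw [← (h6 z (A.aInf_nonneg.trans hz.1)).deriv]
      exact gWord_le hν ω hz) hy hx
  simpa using this

end Alphabet

/-- The cone `K(M; X)`, as a predicate on functions that are defined on the whole line. -/
def MemCone (M : ℝ) (X : Set ℝ) (f : ℝ → ℝ) : Prop :=
  ∀ x ∈ X, ∀ y ∈ X, f x ≤ exp (M * |x - y|) * f y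

namespace MemCone

variable {M M' c : ℝ} {X Y : Set ℝ} {f g : ℝ → ℝ}

theorem mono (hf : MemCone M X f) (h0 : ∀ x ∈ X, 0 ≤ f x) (hM : M ≤ M') : MemCone M' X f :=
  fun x hx y hy => (hf x hx y hy).trans (mul_le_mul_of_nonneg_right
    (exp_le_exp.2 (mul_le_mul_of_nonneg_right hM (abs_nonneg _))) (h0 y hy))

theorem mul (hf : MemCone M X f) (hg : MemCone M' X g) (hf0 : ∀ x ∈ X, 0 ≤ f x)
    (hg0 : ∀ x ∈ X, 0 ≤ g x) : MemCone (M + M') X (fun x => f x * g x) := by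
  intro x hx y hy
  have := mul_le_mul (hf x hx y hy) (hg x hx y hy) (hg0 x hx)
    (mul_nonneg (exp_pos _).le (hf0 y hy))
  refine this.trans (le_of_eq ?_)
  rw [add_mul, exp_add]
  ring

theorem comp {φ : ℝ → ℝ} (hf : MemCone M Y f) (hf0 : ∀ y ∈ Y, 0 ≤ f y) (hM : 0 ≤ M)
    (hφ : ∀ x ∈ X, φ x ∈ Y) (hc : ∀ x ∈ X, ∀ y ∈ X, |φ x - φ y| ≤ c * |x - y|) :
    MemCone (c * M) X (fun x => f (φ x)) := by
  intro x hx y hy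
  refine (hf _ (hφ x hx) _ (hφ y hy)).trans (mul_le_mul_of_nonneg_right (exp_le_exp.2 ?_)
    (hf0 _ (hφ y hy)))
  have := mul_le_mul_of_nonneg_left (hc x hx y hy) hM
  linarith

theorem sum {ι : Type*} {s : Finset ι} {f : ι → ℝ → ℝ} (hf : ∀ i ∈ s, MemCone M X (f i)) :
    MemCone M X (fun x => ∑ i ∈ s, f i x) := by
  intro x hx y hy
  simp only
  rw [Finset.mul_sum]
  exact Finset.sum_le_sum fun i hi => hf i hi x hx y hy

theorem const_mul (hf : MemCone M X f) (hc : 0 ≤ c) : MemCone M X (fun x => c * f x) := by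
  intro x hx y hy
  have := mul_le_mul_of_nonneg_left (hf x hx y hy) hc
  simp only
  linarith

theorem subset (hf : MemCone M X f) (h : Y ⊆ X) : MemCone M Y f :=
  fun x hx y hy => hf x (h hx) y (h hy)

theorem congr (hf : MemCone M X f) (h : ∀ x ∈ X, f x = g x) : MemCone M X g := by
  intro x hx y hy
  rw [← h x hx, ← h y hy]
  exact hf x hx y hy

theorem rpow {s : ℝ} (hf : MemCone M X f) (h0 : ∀ x ∈ X, 0 ≤ f x) (hs : 0 ≤ s) :
    MemCone (s * M) X (fun x => f x ^ s) := by
  intro x hx y hy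
  have := rpow_le_rpow (h0 x hx) (hf x hx y hy) hs
  rw [mul_rpow (exp_pos _).le (h0 y hy), ← exp_mul] at this
  refine this.trans (le_of_eq ?_)
  ring_nf

end MemCone

/-- If `B ≥ κ B'`, then `x ↦ (B' x + B)⁻²` is log-Lipschitz on `[α, ∞)` with the constant
`2 / (α + κ)`. -/
theorem memCone_inv_sq {B' B α κ : ℝ} (hB' : 0 < B') (hκ : κ * B' ≤ B) (hα : 0 < α + κ) :
    MemCone (2 / (α + κ)) (Ici α) (fun x => ((B' * x + B) ^ 2)⁻¹) := by
  have hpos : ∀ x ∈ Ici α, (α + κ) * B' ≤ B' * x + B := by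
    intro x hx
    have := mul_le_mul_of_nonneg_left (mem_Ici.1 hx) hB'.le
    linarith
  intro x hx y hy
  have h1 := hpos x hx
  have h2 := hpos y hy
  have h0 : 0 < (α + κ) * B' := by positivity
  have px : 0 < B' * x + B := h0.trans_le h1
  have py : 0 < B' * y + B := h0.trans_le h2
  have h3 : B' * y + B ≤ exp (|x - y| / (α + κ)) * (B' * x + B) := by
    have h4 := mul_le_mul_of_nonneg_right (add_one_le_exp (|x - y| / (α + κ))) px.le
    have h5 : B' * |x - y| ≤ |x - y| / (α + κ) * (B' * x + B) := by
      rw [div_mul_eq_mul_div, le_div_iff₀ hα]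
      have := mul_le_mul_of_nonneg_left h1 (abs_nonneg (x - y))
      linarith
    have h6 : y - x ≤ |x - y| := by
      rw [abs_sub_comm]
      exact le_abs_self _
    have := mul_le_mul_of_nonneg_left h6 hB'.le
    linarith
  have h7 := pow_le_pow_left₀ py.le h3 2
  rw [mul_pow, ← exp_nat_mul] at h7
  simp only
  rw [← div_eq_mul_inv, le_div_iff₀ (by positivity), inv_mul_eq_div, div_le_iff₀ (by positivity)]
  refine h7.trans (le_of_eq ?_)
  congr 2
  push_cast
  ring

namespace Alphabet
variable {A : Alphabet}

theorem memCone_gWord_rpow {ν : ℕ} (hν : 1 ≤ ν) (ω : A.Word ν) {s : ℝ} (hs : 0 ≤ s) :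
    MemCone (2 * s / (A.aInf + A.a (ν - 1) + A.gmin)) A.S (fun x => gWord ω x ^ s) := by
  obtain ⟨B', B, h1, h2, -, -, h5, h6⟩ := exists_gWord_eq hν ω
  have h0 := A.aInf_nonneg
  have hγ := A.one_le_gmin
  have ha := (A.ends_aux (ν - 1)).1
  have h7 := memCone_inv_sq (α := A.aInf) h1 h5 (by linarith)
  have h8 : MemCone (2 / (A.aInf + (A.a (ν - 1) + A.gmin))) A.S (gWord ω) :=
    (h7.subset Icc_subset_Ici_self).congr fun x hx => (h6 x (h0.trans hx.1)).symm
  have h9 := h8.rpow (fun x _ => gWord_nonneg ω x) hs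
  have e : s * (2 / (A.aInf + (A.a (ν - 1) + A.gmin))) =
      2 * s / (A.aInf + A.a (ν - 1) + A.gmin) := by
    rw [add_assoc]
    ring
  rwa [e] at h9

end Alphabet
end ContFrac

/-! ### Invariance of the cones under the collocation operator -/

namespace ContFrac
open Real Polynomial

/-- Every cell has a node at distance at most `η l` from all its nodes: the middle one, or one of the
two middle ones. -/
theorem exists_central_node {r : ℕ} (hr : 2 ≤ r) {l : ℝ} (hl : 0 < l) (t₀ : ℝ) :
    ∃ m ≤ r, ∀ k ≤ r, |chebNode t₀ l r k - chebNode t₀ l r m| ≤ eta r * l := by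
  have hca := cos_pi_div_pos hr
  have hsa := sin_pi_div_pos hr
  have key : ∃ m ≤ r, ∀ k ≤ r, |chat r k - chat r m| ≤ 2 * eta r := by
    rcases Nat.even_or_odd' r with ⟨j, hj | hj⟩
    · refine ⟨j, by omega, fun k hk => ?_⟩
      have he : Even r := ⟨j, by omega⟩
      have hz : zeroAngle (r + 1) j = π / 2 := by
        rw [zeroAngle, hj]
        push_cast
        field_simp
      obtain ⟨h1, h2⟩ := chat_mem hr hk
      rw [chat_eq r j, hz, cos_pi_div_two, eta, if_pos he, neg_zero, zero_div, sub_zero, abs_le]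
      constructor <;> linarith
    · refine ⟨j, by omega, fun k hk => ?_⟩
      have he : ¬ Even r := Nat.not_even_iff_odd.2 ⟨j, hj⟩
      have hz : zeroAngle (r + 1) j = π / 2 - π / (2 * r + 2) := by
        rw [zeroAngle, hj]
        push_cast
        field_simp
        ring
      obtain ⟨h1, h2⟩ := chat_mem hr hk
      have ht : 0 < tan (π / (2 * r + 2)) := by
        rw [tan_eq_sin_div_cos]
        positivity
      rw [chat_eq r j, hz, cos_pi_div_two_sub, eta, if_neg he, neg_div, ← tan_eq_sin_div_cos,
        abs_le]
      constructor <;> linarith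
  obtain ⟨m, hm, h⟩ := key
  refine ⟨m, hm, fun k hk => ?_⟩
  have e : chebNode t₀ l r k - chebNode t₀ l r m = l / 2 * (chat r k - chat r m) := by
    unfold chebNode
    ring
  rw [e, abs_mul, abs_of_pos (by positivity : 0 < l / 2)]
  have := mul_le_mul_of_nonneg_left (h k hk) (by positivity : 0 ≤ l / 2)
  linarith

theorem half_le_eta {r : ℕ} (hr : 2 ≤ r) : 1 / 2 ≤ eta r := by
  unfold eta
  split_ifs
  · exact le_rfl
  · have : 0 < tan (π / (2 * r + 2)) := by
      rw [tan_eq_sin_div_cos]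
      exact div_pos (sin_pi_div_pos hr) (cos_pi_div_pos hr)
    linarith

namespace MemCone

variable {B a b c : ℝ} {w : ℝ → ℝ}

/-- A function with `|w'| ≤ B w` lies in `K(B)`, since `w(x) e^{Bx}` increases and `w(x) e^{-Bx}`
decreases. -/
theorem of_hasDerivAt {w' : ℝ → ℝ} (hw : ∀ x ∈ Icc a b, HasDerivAt w (w' x) x)
    (hB : ∀ x ∈ Icc a b, |w' x| ≤ B * w x) : MemCone B (Icc a b) w := by
  have hd : ∀ e : ℝ, ∀ x ∈ Icc a b, HasDerivAt (fun y => exp (e * y) * w y)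
      (exp (e * x) * (e * w x + w' x)) x := by
    intro e x hx
    have h1 : HasDerivAt (fun y : ℝ => e * y) (e * 1) x := (hasDerivAt_id x).const_mul e
    refine (h1.exp.mul (hw x hx)).congr_deriv ?_
    ring
  have hcont : ∀ e : ℝ, ContinuousOn (fun y => exp (e * y) * w y) (Icc a b) := fun e x hx =>
    (hd e x hx).continuousAt.continuousWithinAt
  have hmono : MonotoneOn (fun y => exp (B * y) * w y) (Icc a b) := by
    refine monotoneOn_of_hasDerivWithinAt_nonneg (convex_Icc a b) (hcont B)
      (fun x hx => (hd B x (interior_subset hx)).hasDerivWithinAt) fun x hx => ?_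
    have := (abs_le.1 (hB x (interior_subset hx))).1
    exact mul_nonneg (exp_pos _).le (by linarith)
  have hanti : AntitoneOn (fun y => exp (-B * y) * w y) (Icc a b) := by
    refine antitoneOn_of_hasDerivWithinAt_nonpos (convex_Icc a b) (hcont (-B))
      (fun x hx => (hd (-B) x (interior_subset hx)).hasDerivWithinAt) fun x hx => ?_
    have := (abs_le.1 (hB x (interior_subset hx))).2
    exact mul_nonpos_of_nonneg_of_nonpos (exp_pos _).le (by linarith)
  intro x hx y hy
  rcases le_total x y with h | h
  · have h1 := mul_le_mul_of_nonneg_left (hmono hx hy h) (exp_pos (-(B * x))).le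
    simp only at h1
    rw [← mul_assoc, ← mul_assoc, ← exp_add, ← exp_add] at h1
    rw [abs_of_nonpos (by linarith)]
    rw [neg_add_cancel, exp_zero, one_mul] at h1
    refine h1.trans (le_of_eq ?_)
    ring_nf
  · have h1 := mul_le_mul_of_nonneg_left (hanti hy hx h) (exp_pos (B * x)).le
    simp only at h1
    rw [← mul_assoc, ← mul_assoc, ← exp_add, ← exp_add] at h1
    rw [abs_of_nonneg (by linarith)]
    rw [show B * x + -B * x = 0 by ring, exp_zero, one_mul] at h1
    refine h1.trans (le_of_eq ?_)
    ring_nf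

theorem union_Icc (h1 : MemCone B (Icc a b) w) (h2 : MemCone B (Icc b c) w) (hab : a ≤ b)
    (hbc : b ≤ c) : MemCone B (Icc a c) w := by
  have hb1 : b ∈ Icc a b := ⟨hab, le_rfl⟩
  have hb2 : b ∈ Icc b c := ⟨le_rfl, hbc⟩
  intro x hx y hy
  rcases le_total x b with hxb | hxb <;> rcases le_total y b with hyb | hyb
  · exact h1 x ⟨hx.1, hxb⟩ y ⟨hy.1, hyb⟩
  · have i1 := h1 x ⟨hx.1, hxb⟩ b hb1
    have i2 := mul_le_mul_of_nonneg_left (h2 b hb2 y ⟨hyb, hy.2⟩) (exp_pos (B * |x - b|)).le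
    rw [← mul_assoc, ← exp_add] at i2
    refine (i1.trans i2).trans (le_of_eq ?_)
    rw [abs_of_nonpos (by linarith : x - b ≤ 0), abs_of_nonpos (by linarith : b - y ≤ 0),
      abs_of_nonpos (by linarith : x - y ≤ 0)]
    ring_nf
  · have i1 := h2 x ⟨hxb, hx.2⟩ b hb2
    have i2 := mul_le_mul_of_nonneg_left (h1 b hb1 y ⟨hy.1, hyb⟩) (exp_pos (B * |x - b|)).le
    rw [← mul_assoc, ← exp_add] at i2
    refine (i1.trans i2).trans (le_of_eq ?_)
    rw [abs_of_nonneg (by linarith : 0 ≤ x - b), abs_of_nonneg (by linarith : 0 ≤ b - y),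
      abs_of_nonneg (by linarith : 0 ≤ x - y)]
    ring_nf
  · exact h2 x ⟨hxb, hx.2⟩ y ⟨hyb, hy.2⟩

end MemCone

namespace Mesh

variable {A : Alphabet} (P : Mesh A)

theorem left_add_N_mul_step (i : Fin P.I) : P.left i + P.N i * P.step i = P.right i := by
  have : (P.N i : ℝ) ≠ 0 := Nat.cast_ne_zero.2 (P.N_pos i).ne'
  unfold step
  field_simp
  ring

theorem exists_mem_cell {i : Fin P.I} {x : ℝ} (hx : x ∈ Icc (P.left i) (P.right i)) :
    ∃ p : P.Cell, p.1 = i ∧ x ∈ P.cell p := by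
  obtain ⟨j, hj, hjx⟩ := exists_mem_Icc_succ (c := fun j : ℕ => P.left i + j * P.step i)
    (r := P.N i) (x := x) (P.N_pos i).ne' (by simpa using hx.1)
    (by rw [P.left_add_N_mul_step]; exact hx.2)
  refine ⟨⟨i, ⟨j, hj⟩⟩, rfl, hjx.1, hjx.2.trans (le_of_eq ?_)⟩
  simp only [t]
  push_cast
  ring

/-- A function that lies in `K(B)` on each cell of `[a_i, b_i]` does so on `[a_i, b_i]`. -/
theorem memCone_of_cells {B : ℝ} {w : ℝ → ℝ} {i : Fin P.I}
    (hw : ∀ p : P.Cell, p.1 = i → MemCone B (P.cell p) w) :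
    MemCone B (Icc (P.left i) (P.right i)) w := by
  have hl := P.step_pos i
  have key : ∀ m : ℕ, m ≤ P.N i → MemCone B (Icc (P.left i) (P.left i + m * P.step i)) w := by
    intro m
    induction m with
    | zero =>
      intro _ x hx y hy
      simp only [Nat.cast_zero, zero_mul, add_zero, Icc_self, mem_singleton_iff] at hx hy
      rw [hx, hy]
      simp
    | succ m ih =>
      intro hm
      refine (ih (by omega)).union_Icc ?_ ?_ ?_ (b := P.left i + m * P.step i)
      · have := hw ⟨i, ⟨m, hm⟩⟩ rfl
        refine this.subset fun x hx => ⟨hx.1, hx.2.trans (le_of_eq ?_)⟩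
        simp only [t]
        push_cast
        ring
      · have : 0 ≤ (m : ℝ) * P.step i := by positivity
        linarith
      · push_cast
        linarith
  have := key (P.N i) le_rfl
  rwa [P.left_add_N_mul_step] at this

theorem natDegree_cellPoly_le (r : ℕ) (p : P.Cell) (F : P.T r → ℝ) :
    (P.cellPoly r p F).natDegree ≤ r := by
  have h := Lagrange.degree_interpolate_lt (s := Finset.univ) (v := P.node r p)
    (fun k => F ⟨P.node r p k, P.node_mem r p k⟩) (P.node_injective r p).injOn
  rw [Finset.card_univ, Fintype.card_fin] at h
  exact natDegree_le_iff_degree_le.2 (Order.le_of_lt_succ (by exact_mod_cast h))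

theorem chebNode_mem_T {r k : ℕ} (p : P.Cell) (hk : k ≤ r) :
    chebNode (P.t p) (P.step p.1) r k ∈ P.T r :=
  P.node_mem r p ⟨k, by omega⟩

theorem eval_cellPoly_chebNode {r k : ℕ} (p : P.Cell) (hk : k ≤ r) (F : P.T r → ℝ) :
    (P.cellPoly r p F).eval (chebNode (P.t p) (P.step p.1) r k) =
      F ⟨_, P.chebNode_mem_T p hk⟩ :=
  P.eval_node r p F ⟨k, by omega⟩

theorem step_le_h (i : Fin P.I) : P.step i ≤ P.h := le_ciSup (finite_range _).bddAbove i

theorem cell_subset_S (p : P.Cell) : P.cell p ⊆ A.S := (P.cell_subset p).trans (P.subset p.1)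

theorem exists_cell_of_mem_T {r : ℕ} {ξ : ℝ} (hξ : ξ ∈ P.T r) :
    ∃ p : P.Cell, ∃ k ≤ r, ξ = chebNode (P.t p) (P.step p.1) r k := by
  obtain ⟨⟨p, k⟩, -, rfl⟩ := Finset.mem_image.1 hξ
  exact ⟨p, k, by omega, rfl⟩

theorem mem_S_of_mem_T {r : ℕ} (hr : 2 ≤ r) {ξ : ℝ} (hξ : ξ ∈ P.T r) : ξ ∈ A.S := by
  obtain ⟨p, k, hk, rfl⟩ := P.exists_cell_of_mem_T hξ
  exact P.cell_subset_S p (chebNode_mem (P.step_pos _) hr hk)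

theorem cone_nonneg {r : ℕ} (hr : 2 ≤ r) {M : ℝ} (hM : 0 < M) {F : P.T r → ℝ}
    (hF : F ∈ cone M (P.T r)) (ξ : P.T r) : 0 ≤ F ξ := by
  obtain ⟨p, k, hk, hξ⟩ := P.exists_cell_of_mem_T ξ.2
  obtain ⟨ζ, hζ⟩ : ∃ ζ : P.T r, (ζ : ℝ) ≠ ξ := by
    by_cases h0 : k = 0
    · refine ⟨⟨_, P.chebNode_mem_T p le_rfl⟩, ?_⟩
      rw [hξ, h0]
      exact (chebNode_strictMono (P.step_pos _) hr (by omega) le_rfl).ne'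
    · refine ⟨⟨_, P.chebNode_mem_T p (Nat.zero_le r)⟩, ?_⟩
      rw [hξ]
      exact (chebNode_strictMono (P.step_pos _) hr (by omega) hk).ne
  have ht : 0 < M * |(ξ : ℝ) - ζ| := mul_pos hM (abs_pos.2 (sub_ne_zero.2 hζ.symm))
  have h1 := hF ξ ζ
  have h2 := hF ζ ξ
  rw [abs_sub_comm] at h2
  set q := exp (M * |(ξ : ℝ) - ζ|) with hq
  have hq1 : 1 < q := one_lt_exp_iff.2 ht
  by_contra! h
  have h3 := mul_le_mul_of_nonneg_left h2 (by linarith : 0 ≤ q)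
  have h4 : 0 < q * q - 1 := by nlinarith
  have h5 := mul_pos h4 (neg_pos.2 h)
  linarith

/-- The polynomial that interpolates an element of `K(M; T)` on a cell is nonnegative there and its
derivative is controlled, by Markov's inequality. -/
theorem abs_derivative_cellPoly_le {r : ℕ} (hr : 2 ≤ r) {M : ℝ} (hM : 0 < M) {F : P.T r → ℝ}
    (hF : F ∈ cone M (P.T r)) (h1 : ConeCond1 r (M * eta r * P.h)) (p : P.Cell) {x : ℝ}
    (hx : x ∈ P.cell p) :
    0 ≤ (P.cellPoly r p F).eval x ∧ |(derivative (P.cellPoly r p F)).eval x| ≤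
      M * (2 * eta r * r ^ 2 * psi r) * (exp (M * eta r * P.h) /
        (1 - psi r * (M * eta r * P.h) * exp (M * eta r * P.h))) *
          (P.cellPoly r p F).eval x := by
  set l := P.step p.1 with hl
  have hl0 : 0 < l := P.step_pos _
  set Q := P.cellPoly r p F with hQ
  obtain ⟨m, hm, hmk⟩ := exists_central_node hr hl0 (P.t p)
  set Fs := F ⟨_, P.chebNode_mem_T p hm⟩ with hFs
  have hFs0 : 0 ≤ Fs := P.cone_nonneg hr hM hF _
  have hη := half_le_eta hr
  have hψ := le_psi hr
  set u := M * eta r * P.h with hu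
  set v := M * eta r * l with hv
  have hMη : 0 < M * eta r := by positivity
  have hv0 : 0 < v := by positivity
  have hvu : v ≤ u := mul_le_mul_of_nonneg_left (P.step_le_h _) hMη.le
  have hexp : exp v - 1 ≤ v * exp v := by
    have h2 := mul_le_mul_of_nonneg_left (add_one_le_exp (-v)) (exp_pos v).le
    rw [← exp_add, add_neg_cancel, exp_zero] at h2
    linarith
  have hev : exp v ≤ exp u := exp_le_exp.2 hvu
  have hveu : v * exp v ≤ u * exp u := mul_le_mul hvu hev (exp_pos _).le (by linarith)
  have hev1 : 1 < exp v := one_lt_exp_iff.2 hv0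
  -- the values at the nodes are close to the value at the central node
  have hnode : ∀ k ≤ r, |(Q - C Fs).eval (chebNode (P.t p) l r k)| ≤ (exp v - 1) * Fs := by
    intro k hk
    rw [eval_sub, eval_C, hQ, P.eval_cellPoly_chebNode p hk]
    have d1 := mul_le_mul_of_nonneg_left (hmk k hk) hM.le
    have d2 : exp (M * |chebNode (P.t p) l r k - chebNode (P.t p) l r m|) ≤ exp v :=
      exp_le_exp.2 (by linarith)
    have i1 := (hF ⟨_, P.chebNode_mem_T p hk⟩ ⟨_, P.chebNode_mem_T p hm⟩).trans
      (mul_le_mul_of_nonneg_right d2 hFs0)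
    have hFk := P.cone_nonneg hr hM hF ⟨_, P.chebNode_mem_T p hk⟩
    have i2 := hF ⟨_, P.chebNode_mem_T p hm⟩ ⟨_, P.chebNode_mem_T p hk⟩
    rw [abs_sub_comm] at i2
    have i3 := i2.trans (mul_le_mul_of_nonneg_right d2 hFk)
    set Fk := F ⟨_, P.chebNode_mem_T p hk⟩
    rw [abs_le]
    constructor
    · by_cases hle : Fs ≤ Fk
      · nlinarith
      · push Not at hle
        have := mul_le_mul_of_nonneg_left hle.le (by linarith : 0 ≤ exp v - 1)
        linarith
    · linarith
  have hdeg : (Q - C Fs).natDegree ≤ r :=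
    (natDegree_sub_C).le.trans (P.natDegree_cellPoly_le r p F)
  have hcell : ∀ y ∈ Icc (P.t p) (P.t p + l), |(Q - C Fs).eval y| ≤ psi r * ((exp v - 1) * Fs) :=
    fun y hy => abs_eval_le_psi_mul hl0 hr hdeg hnode hy
  have hder := abs_eval_derivative_le hl0 hdeg hcell hx
  rw [derivative_sub, derivative_C, sub_zero] at hder
  have hval := (abs_le.1 (hcell x hx)).1
  rw [eval_sub, eval_C] at hval
  have h1' : psi r * u * exp u < 1 := h1
  have hden : 0 < 1 - psi r * u * exp u := by linarith
  have hψv : psi r * ((exp v - 1) * Fs) ≤ psi r * u * exp u * Fs := by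
    have : (exp v - 1) ≤ u * exp u := hexp.trans hveu
    have := mul_le_mul_of_nonneg_left (mul_le_mul_of_nonneg_right this hFs0)
      (by linarith : 0 ≤ psi r)
    linarith
  have hlow : (1 - psi r * u * exp u) * Fs ≤ Q.eval x := by linarith
  refine ⟨(mul_nonneg hden.le hFs0).trans hlow, ?_⟩
  have hFsQ : Fs ≤ Q.eval x / (1 - psi r * u * exp u) := by
    rw [le_div_iff₀ hden]
    linarith
  calc |(derivative Q).eval x| ≤ 2 / l * (r ^ 2 * (psi r * ((exp v - 1) * Fs))) := hder
    _ ≤ 2 / l * (r ^ 2 * (psi r * ((v * exp u) * Fs))) := by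
      have : exp v - 1 ≤ v * exp u := hexp.trans (mul_le_mul_of_nonneg_left hev hv0.le)
      gcongr
    _ = M * (2 * eta r * r ^ 2 * psi r) * exp u * Fs := by
      rw [hv]
      field_simp
    _ ≤ M * (2 * eta r * r ^ 2 * psi r) * exp u * (Q.eval x / (1 - psi r * u * exp u)) := by
      gcongr
    _ = _ := by ring

/-- The piecewise interpolant of an element of `K(M; T)` is log-Lipschitz on each `[a_i, b_i]`. -/
theorem memCone_interp {r : ℕ} (hr : 2 ≤ r) {M : ℝ} (hM : 0 < M) {F : P.T r → ℝ}
    (hF : F ∈ cone M (P.T r)) (h1 : ConeCond1 r (M * eta r * P.h)) (i : Fin P.I) :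
    (∀ x ∈ Icc (P.left i) (P.right i), 0 ≤ P.interp r x F) ∧
    MemCone (M * (2 * eta r * r ^ 2 * psi r) * (exp (M * eta r * P.h) /
        (1 - psi r * (M * eta r * P.h) * exp (M * eta r * P.h))))
      (Icc (P.left i) (P.right i)) (fun x => P.interp r x F) := by
  constructor
  · intro x hx
    obtain ⟨p, -, hp⟩ := P.exists_mem_cell hx
    rw [P.interp_eq (by omega) hp]
    exact (P.abs_derivative_cellPoly_le hr hM hF h1 p hp).1
  · refine P.memCone_of_cells fun p _ => MemCone.congr (f := fun x => (P.cellPoly r p F).eval x)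
      ?_ fun x hx => (P.interp_eq (by omega) hx F).symm
    exact MemCone.of_hasDerivAt (fun x _ => (P.cellPoly r p F).hasDerivAt x)
      fun x hx => (P.abs_derivative_cellPoly_le hr hM hF h1 p hx).2

theorem colloc_apply (s : ℝ) (ν r : ℕ) (F : P.T r → ℝ) (ξ : P.T r) : P.colloc s ν r F ξ =
    ∑ ω : A.Word ν, Alphabet.gWord ω ξ ^ s * P.interp r (Alphabet.thetaWord ω ξ) F := by
  simp [colloc]

/-- Summing `g_ω ^ s · (w ∘ θ_ω)` over all words turns log-Lipschitz constants `B` on the intervals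
`[a_i, b_i]` into `M₁ + c(ν) B`. -/
theorem memCone_sum_words {ν : ℕ} (hν : 1 ≤ ν) (hP : P.Covers ν) {s M₁ B : ℝ}
    (hg : ∀ ω : A.Word ν, MemCone M₁ A.S (fun x => Alphabet.gWord ω x ^ s)) {w : ℝ → ℝ}
    (hw0 : ∀ i, ∀ x ∈ Icc (P.left i) (P.right i), 0 ≤ w x) (hB : 0 ≤ B)
    (hw : ∀ i, MemCone B (Icc (P.left i) (P.right i)) w) :
    MemCone (M₁ + A.c ν * B) A.S
      (fun x => ∑ ω : A.Word ν, Alphabet.gWord ω x ^ s * w (Alphabet.thetaWord ω x)) := by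
  refine MemCone.sum fun ω _ => ?_
  obtain ⟨i, hi⟩ := hP ω
  have hmap : ∀ x ∈ A.S, Alphabet.thetaWord ω x ∈ Icc (P.left i) (P.right i) := fun x hx =>
    hi (mem_image_of_mem _ hx)
  exact (hg ω).mul ((hw i).comp (hw0 i) hB hmap
    fun x hx y hy => Alphabet.abs_thetaWord_sub_le hν ω hx hy)
    (fun x _ => rpow_nonneg (Alphabet.gWord_nonneg ω x) s) (fun x hx => hw0 i _ (hmap x hx))

end Mesh

theorem MemCone.mem_cone {A : Alphabet} {P : Mesh A} {r : ℕ} (hr : 2 ≤ r) {M : ℝ} {f : ℝ → ℝ}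
    (hf : MemCone M A.S f) {F : P.T r → ℝ} (hF : ∀ ξ : P.T r, F ξ = f ξ) :
    F ∈ cone M (P.T r) := by
  intro ξ ζ
  rw [hF, hF]
  exact hf ξ (P.mem_S_of_mem_T hr ξ.2) ζ (P.mem_S_of_mem_T hr ζ.2)

/-- The collocation operator maps `K(M; T)` into `K(κ₂ M; T)`. -/
theorem Mesh.colloc_mem_cone {A : Alphabet} (P : Mesh A) {r ν : ℕ} (hr : 2 ≤ r) (hν : 1 ≤ ν)
    (hP : P.Covers ν) {s M₀ M κ₁ κ₂ : ℝ} (hs : 0 ≤ s) (hM : 0 < M) (hM₀ : A.IsM0 ν M₀)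
    (hκ₁ : κ₁ = A.c ν * (2 * eta r * (r : ℝ) ^ 2 * psi r))
    (h1 : ConeCond1 r (M * eta r * P.h)) (h2 : ConeCond2 r κ₁ κ₂ s M₀ M (M * eta r * P.h))
    {F : P.T r → ℝ} (hF : F ∈ cone M (P.T r)) :
    P.colloc s ν r F ∈ cone (κ₂ * M) (P.T r) := by
  have hη := half_le_eta hr
  have hψ := le_psi hr
  have h1' : psi r * (M * eta r * P.h) * exp (M * eta r * P.h) < 1 := h1
  have hB : 0 ≤ M * (2 * eta r * r ^ 2 * psi r) * (exp (M * eta r * P.h) /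
        (1 - psi r * (M * eta r * P.h) * exp (M * eta r * P.h))) :=
    mul_nonneg (by positivity) (div_nonneg (exp_pos _).le (by linarith))
  have hg : ∀ ω : A.Word ν, MemCone (s * M₀) A.S (fun x => Alphabet.gWord ω x ^ s) := fun ω =>
    MemCone.rpow (fun x hx y hy => hM₀ ω x hx y hy)
      (fun x _ => Alphabet.gWord_nonneg ω x) hs
  have key := P.memCone_sum_words hν hP hg
    (fun i => (P.memCone_interp hr hM hF h1 i).1) hB
    (fun i => (P.memCone_interp hr hM hF h1 i).2)
  refine MemCone.mem_cone hr (MemCone.mono key ?_ ?_) (P.colloc_apply s ν r F)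
  · intro x hx
    refine Finset.sum_nonneg fun ω _ => mul_nonneg (rpow_nonneg (Alphabet.gWord_nonneg ω x) s) ?_
    obtain ⟨i, hi⟩ := hP ω
    exact (P.memCone_interp hr hM hF h1 i).1 _ (hi (mem_image_of_mem _ hx))
  · have h3 := mul_le_mul_of_nonneg_left (le_of_lt h2) hM.le
    rw [mul_sub, hκ₁] at h3
    have e1 : M * (s * M₀ / M) = s * M₀ := by field_simp
    rw [e1] at h3
    refine le_trans (le_of_eq ?_) (sub_nonneg.1 (le_of_le_of_eq (sub_nonneg.2 h3) ?_) :
      M * (A.c ν * (2 * eta r * (r : ℝ) ^ 2 * psi r) * exp (M * eta r * P.h) /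
        (1 - psi r * (M * eta r * P.h) * exp (M * eta r * P.h))) + s * M₀ ≤ κ₂ * M)
    · ring
    · ring
end ContFrac

/-! ### The interpolation error in the cone -/

namespace ContFrac
open Real Polynomial

theorem sin_pi_div_le_half {r : ℕ} (hr : 2 ≤ r) : sin (π / (2 * r + 2)) ≤ 1 / 2 := by
  obtain ⟨h1, h2⟩ := pi_div_mem_Ioc hr
  have hpi := pi_pos
  rw [← sin_pi_div_six]
  exact sin_le_sin_of_le_of_le_pi_div_two (by linarith) (by linarith) h2

theorem G_pos {χ s h : ℝ} (hχ : 0 < χ) (hs : 0 < s) {r : ℕ} (hr : 2 ≤ r) : 0 < G χ s h r := by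
  have hca := cos_pi_div_pos hr
  have : 0 < ∏ j ∈ Finset.range (r + 1), (2 * s + j) / (2 * j + 2) :=
    Finset.prod_pos fun j _ => by positivity
  unfold G
  positivity

theorem H_pos {μ χ s h : ℝ} (hμ : 0 < μ) (hχ : 0 < χ) (hs : 0 < s) {r : ℕ} (hr : 2 ≤ r) :
    0 < H μ χ s h r := by
  have hsa := sin_pi_div_pos hr
  have := G_pos (h := h) hχ hs hr
  unfold H D
  positivity

namespace Mesh

variable {A : Alphabet} (P : Mesh A)

theorem h_pos (i : Fin P.I) : 0 < P.h := (P.step_pos i).trans_le (P.step_le_h i)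

theorem one_le_mu (i : Fin P.I) : 1 ≤ P.mu := by
  have : Nonempty (Fin P.I) := ⟨i⟩
  obtain ⟨j, hj⟩ := exists_eq_ciInf_of_finite (f := P.step)
  have h1 : 0 < ⨅ i, P.step i := hj ▸ P.step_pos j
  rw [mu, one_le_div h1]
  exact (ciInf_le (finite_range _).bddBelow i).trans (P.step_le_h i)

end Mesh

/-- With `ε = H h^r`, the error `G h^(r+1)` of the interpolation is at most `0.15 ε`. -/
theorem G_mul_pow_le {μ χ s h : ℝ} (hμ : 1 ≤ μ) (hχ : 1 ≤ χ) (hs : 0 < s) (hs' : s ≤ 3 / 2)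
    (hh : 0 < h) (hh' : h ≤ 0.2) {r : ℕ} (hr : 2 ≤ r) :
    G χ s h r * h ^ (r + 1) ≤ 0.15 * (H μ χ s h r * h ^ r) := by
  have hG := G_pos (h := h) (by linarith : 0 < χ) hs hr
  have hsa := sin_pi_div_pos hr
  have hsa' := sin_pi_div_le_half hr
  have h1 : h ≤ 0.15 * (μ * (1 / sin (π / (2 * r + 2))) ^ 2 * (χ / (2 * s))) := by
    have h2 : 2 ≤ 1 / sin (π / (2 * r + 2)) := by
      rw [le_div_iff₀ hsa]
      linarith
    have h3 : 1 / 3 ≤ χ / (2 * s) := by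
      rw [le_div_iff₀ (by positivity)]
      linarith
    have h4 : 2 ^ 2 ≤ (1 / sin (π / (2 * r + 2))) ^ 2 := pow_le_pow_left₀ (by norm_num) h2 2
    have h5 : 1 * 2 ^ 2 * (1 / 3) ≤ μ * (1 / sin (π / (2 * r + 2))) ^ 2 * (χ / (2 * s)) := by
      gcongr
    linarith
  have := mul_le_mul_of_nonneg_left h1 (by positivity : 0 ≤ G χ s h r * h ^ r)
  unfold H D
  rw [pow_succ]
  linarith

/-- With `ε = H h^r`, the error of the derivative is at most `2 π (r + 1) (2 s / χ) ε`. -/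
theorem G_mul_pow_mul_le {μ χ s h : ℝ} (hμ : 1 ≤ μ) (hχ : 1 ≤ χ) (hs : 0 < s)
    (hh : 0 < h) {r : ℕ} (hr : 2 ≤ r) :
    G χ s h r * h ^ r *
      (4 * (r + 1) ^ 2 * (cos (π / (2 * r + 2)) / sin (π / (2 * r + 2)))) ≤
      H μ χ s h r * h ^ r * (2 * s / χ * (2 * π * (r + 1))) := by
  have hG := G_pos (h := h) (by linarith : 0 < χ) hs hr
  have hsa := sin_pi_div_pos hr
  have hca := cos_pi_div_pos hr
  have hχ0 : 0 < χ := by linarith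
  have hpi := pi_pos
  have h1 : 4 * (r + 1) ^ 2 * (cos (π / (2 * r + 2)) / sin (π / (2 * r + 2))) ≤
      μ * (1 / sin (π / (2 * r + 2))) ^ 2 * (2 * π * (r + 1)) := by
    have h2 := sin_le (pi_div_mem_Ioc hr).1.le
    have h3 := cos_le_one (π / (2 * r + 2))
    have h4 : 4 * (r + 1) ^ 2 * cos (π / (2 * r + 2)) * sin (π / (2 * r + 2)) ≤
        μ * (2 * π * (r + 1)) := by
      calc 4 * (r + 1) ^ 2 * cos (π / (2 * r + 2)) * sin (π / (2 * r + 2))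
          ≤ 4 * (r + 1) ^ 2 * 1 * (π / (2 * r + 2)) := by gcongr
        _ = 1 * (2 * π * (r + 1)) := by
          field_simp
          ring
        _ ≤ _ := by gcongr
    have h5 := mul_le_mul_of_nonneg_right h4
      (by positivity : 0 ≤ (1 / sin (π / (2 * r + 2))) ^ 2)
    refine le_trans (le_of_eq ?_) (h5.trans (le_of_eq ?_))
    · field_simp
    · ring
  have h6 := mul_le_mul_of_nonneg_left h1 (by positivity : 0 ≤ G χ s h r * h ^ r)
  refine h6.trans (le_of_eq ?_)
  have e : χ / (2 * s) * (2 * s / χ) = 1 := by field_simp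
  calc _ = G χ s h r * h ^ r * (μ * (1 / sin (π / (2 * r + 2))) ^ 2 * (2 * π * (r + 1))) *
        (χ / (2 * s) * (2 * s / χ)) := by rw [e, mul_one]
    _ = _ := by
      unfold H D
      ring

namespace Mesh

variable {A : Alphabet} (P : Mesh A)

theorem chi_le_add {d x : ℝ} (hd : A.aInf + A.gmin ≤ d) (hx : x ∈ A.S) : A.chi ≤ x + d := by
  have := hx.1
  unfold Alphabet.chi
  linarith

/-- The functions `ε f ± (f - 𝓕)`, where `f(x) = (x + d)^(-2s)`, `ε = H h^r` and `𝓕` interpolates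
`f`, are nonnegative and log-Lipschitz on every interval `[a_i, b_i]`. -/
theorem memCone_error (hχ : 1 ≤ A.chi) {s : ℝ} (hs : 0 < s) (hs' : s ≤ 3 / 2) {r : ℕ}
    (hr : 2 ≤ r) (hh : P.h ≤ 0.2) {d : ℝ} (hd : A.aInf + A.gmin ≤ d) {e : ℝ} (he : |e| = 1)
    (i : Fin P.I) :
    (∀ x ∈ Icc (P.left i) (P.right i), 0 ≤ H P.mu A.chi s P.h r * P.h ^ r *
      (x + d) ^ (-(2 * s)) + e * ((x + d) ^ (-(2 * s)) -
        P.interp r x fun ξ => ((ξ : ℝ) + d) ^ (-(2 * s)))) ∧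
    MemCone (2 * s / A.chi * (1 + 2 * π * (r + 1)) / 0.85) (Icc (P.left i) (P.right i))
      (fun x => H P.mu A.chi s P.h r * P.h ^ r * (x + d) ^ (-(2 * s)) +
        e * ((x + d) ^ (-(2 * s)) - P.interp r x fun ξ => ((ξ : ℝ) + d) ^ (-(2 * s)))) := by
  have hμ := P.one_le_mu i
  have hh0 := P.h_pos i
  have hχ0 : 0 < A.chi := by linarith
  have hpi := pi_pos
  set ε := H P.mu A.chi s P.h r * P.h ^ r with hε
  have hε0 : 0 < ε := mul_pos (H_pos (by linarith) hχ0 hs hr) (by positivity)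
  set F : P.T r → ℝ := fun ξ => ((ξ : ℝ) + d) ^ (-(2 * s)) with hF
  have hE := G_mul_pow_le hμ hχ hs hs' hh0 hh hr
  have hE' := G_mul_pow_mul_le hμ hχ hs hh0 hr
  rw [← hε] at hE hE'
  have hcell : ∀ p : P.Cell, ∀ x ∈ P.cell p,
      |e * ((x + d) ^ (-(2 * s)) - (P.cellPoly r p F).eval x)| ≤
        0.15 * ε * (x + d) ^ (-(2 * s)) ∧
      |e * (powDeriv s d 1 x - (derivative (P.cellPoly r p F)).eval x)| ≤
        ε * (2 * s / A.chi * (2 * π * (r + 1))) * (x + d) ^ (-(2 * s)) := by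
    intro p x hx
    have hl := P.step_pos p.1
    have ht : A.chi ≤ P.t p + d := chi_le_add hd (P.cell_subset_S p ⟨le_rfl, by linarith⟩)
    have hxd : 0 < x + d := by linarith [hx.1]
    have hf : 0 < (x + d) ^ (-(2 * s)) := rpow_pos_of_pos hxd _
    have hnode : ∀ k ≤ r, (P.cellPoly r p F).eval (chebNode (P.t p) (P.step p.1) r k) =
        (chebNode (P.t p) (P.step p.1) r k + d) ^ (-(2 * s)) := fun k hk =>
      P.eval_cellPoly_chebNode p hk F
    have h1 := abs_sub_eval_le hs hχ0 hl (P.step_le_h _) hr ht (P.natDegree_cellPoly_le r p F)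
      hnode hx
    have h2 := abs_sub_eval_derivative_le hs hχ0 hl (P.step_le_h _) hr ht
      (P.natDegree_cellPoly_le r p F) hnode hx
    rw [abs_mul, abs_mul, he, one_mul, one_mul]
    exact ⟨h1.trans (mul_le_mul_of_nonneg_right hE hf.le),
      h2.trans (mul_le_mul_of_nonneg_right hE' hf.le)⟩
  have hlow : ∀ p : P.Cell, ∀ x ∈ P.cell p, 0.85 * ε * (x + d) ^ (-(2 * s)) ≤
      ε * (x + d) ^ (-(2 * s)) + e * ((x + d) ^ (-(2 * s)) - (P.cellPoly r p F).eval x) := by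
    intro p x hx
    have := (abs_le.1 (hcell p x hx).1).1
    linarith
  have hpos : ∀ p : P.Cell, ∀ x ∈ P.cell p, 0 < x + d := fun p x hx =>
    hχ0.trans_le (chi_le_add hd (P.cell_subset_S p hx))
  constructor
  · intro x hx
    obtain ⟨p, -, hp⟩ := P.exists_mem_cell hx
    rw [P.interp_eq (by omega) hp]
    have := rpow_pos_of_pos (hpos p x hp) (-(2 * s))
    exact le_trans (by positivity) (hlow p x hp)
  · refine P.memCone_of_cells fun p _ => MemCone.congr (f := fun x => ε * (x + d) ^ (-(2 * s)) +
      e * ((x + d) ^ (-(2 * s)) - (P.cellPoly r p F).eval x)) ?_ fun x hx => by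
        rw [P.interp_eq (by omega) hx F]
    refine MemCone.of_hasDerivAt (w' := fun x => ε * powDeriv s d 1 x +
      e * (powDeriv s d 1 x - (derivative (P.cellPoly r p F)).eval x)) (fun x hx => ?_)
      fun x hx => ?_
    · have h1 := hasDerivAt_powDeriv s (hpos p x hx) 0
      have h2 : HasDerivAt (fun y => (y + d) ^ (-(2 * s))) (powDeriv s d 1 x) x :=
        h1.congr_of_eventuallyEq (Eventually.of_forall fun y => (powDeriv_zero s d y).symm)
      exact (h2.const_mul ε).add ((h2.sub ((P.cellPoly r p F).hasDerivAt x)).const_mul e)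
    · have hxd := hpos p x hx
      have hf : 0 < (x + d) ^ (-(2 * s)) := rpow_pos_of_pos hxd _
      have h1 : |powDeriv s d 1 x| ≤ 2 * s / A.chi * (x + d) ^ (-(2 * s)) := by
        have := abs_powDeriv_le (h := 0) hs.le hχ0 hxd (chi_le_add hd (P.cell_subset_S p hx))
          (by simp) 1
        simpa [div_eq_mul_inv] using this
      have h2 := (hcell p x hx).2
      have h3 := abs_add_le (ε * powDeriv s d 1 x)
        (e * (powDeriv s d 1 x - (derivative (P.cellPoly r p F)).eval x))
      rw [abs_mul ε, abs_of_pos hε0] at h3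
      have h4 := mul_le_mul_of_nonneg_left h1 hε0.le
      have h5 : 0 ≤ 2 * s / A.chi * (1 + 2 * π * (r + 1)) / 0.85 := by positivity
      have h6 := mul_le_mul_of_nonneg_left (hlow p x hx) h5
      refine le_trans ?_ h6
      have e2 : 2 * s / A.chi * (1 + 2 * π * (r + 1)) / 0.85 *
          (0.85 * ε * (x + d) ^ (-(2 * s))) = ε * (2 * s / A.chi * (x + d) ^ (-(2 * s))) +
            ε * (2 * s / A.chi * (2 * π * (r + 1))) * (x + d) ^ (-(2 * s)) := by
        ring
      rw [e2]
      linarith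

end Mesh

/-- The numerical comparison of the log-Lipschitz constants. -/
theorem constant_le {A : Alphabet} {s κ₁ κ₂ M : ℝ} (hs : 0 < s) {r ν : ℕ}
    (hr : 2 ≤ r) (hκ₁ : κ₁ = A.c ν * (2 * eta r * (r : ℝ) ^ 2 * psi r)) (hκ₁₂ : κ₁ < κ₂)
    (hκ₂ : κ₂ < 1) (hM : M = 4 * s / (A.aInf + A.a (ν - 1) + A.gmin) * (1 / (κ₂ - κ₁))) :
    2 * s / (A.aInf + A.a (ν - 1) + A.gmin) +
      A.c ν * (2 * s / A.chi * (1 + 2 * π * (r + 1)) / 0.85) ≤ M ∧ 0 ≤ κ₁ ∧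
    2 * s / A.chi ≤ 2 * s / (A.aInf + A.a (ν - 1) + A.gmin) := by
  have hη := half_le_eta hr
  have hψ := le_psi hr
  have hr2 : (2 : ℝ) ≤ r := by exact_mod_cast hr
  have h0 := A.aInf_nonneg
  have hγ := A.one_le_gmin
  have ha := (A.ends_aux (ν - 1)).1
  have ha' := A.a_le_aInf (ν - 1)
  have hc : 0 ≤ A.c ν := by
    unfold Alphabet.c
    positivity
  have hD : 0 < A.aInf + A.a (ν - 1) + A.gmin := by linarith
  have hσχ : 2 * s / A.chi ≤ 2 * s / (A.aInf + A.a (ν - 1) + A.gmin) := by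
    refine div_le_div_of_nonneg_left (by positivity) hD ?_
    unfold Alphabet.chi
    linarith
  set σ := 2 * s / (A.aInf + A.a (ν - 1) + A.gmin) with hσ
  have hσ0 : 0 < σ := by positivity
  have hκ0 : 0 ≤ κ₁ := by
    rw [hκ₁]
    positivity
  refine ⟨?_, hκ0, hσχ⟩
  have h1 : A.c ν * ((r : ℝ) ^ 2 * 1.44) ≤ κ₁ := by
    rw [hκ₁]
    refine mul_le_mul_of_nonneg_left ?_ hc
    calc (r : ℝ) ^ 2 * 1.44 = 1 * r ^ 2 * 1.44 := by ring
      _ ≤ 2 * eta r * r ^ 2 * psi r := by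
        gcongr
        linarith
  have h2 : 1 + 2 * π * (r + 1) ≤ 4.97 * (r : ℝ) ^ 2 := by
    have : 2 * π * (r + 1) ≤ 2 * 3.1416 * (r + 1) := by
      have := pi_lt_d4
      gcongr
    nlinarith
  have h3 : A.c ν * (2 * s / A.chi * (1 + 2 * π * (r + 1)) / 0.85) ≤ σ * (4.1 * κ₁) := by
    calc A.c ν * (2 * s / A.chi * (1 + 2 * π * (r + 1)) / 0.85)
        ≤ A.c ν * (σ * (4.97 * (r : ℝ) ^ 2) / 0.85) := by gcongr
      _ = σ * (4.97 / 0.85 / 1.44 * (A.c ν * ((r : ℝ) ^ 2 * 1.44))) := by ring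
      _ ≤ σ * (4.97 / 0.85 / 1.44 * κ₁) := by gcongr
      _ ≤ σ * (4.1 * κ₁) := by
        gcongr
        norm_num
  have h4 : 1 + 4.1 * κ₁ ≤ 2 / (κ₂ - κ₁) := by
    rw [le_div_iff₀ (by linarith)]
    have := mul_le_mul_of_nonneg_left (by linarith : κ₂ - κ₁ ≤ 1 - κ₁)
      (by linarith : 0 ≤ 1 + 4.1 * κ₁)
    nlinarith [sq_nonneg (κ₁ - 0.378)]
  have h5 := mul_le_mul_of_nonneg_left h4 hσ0.le
  have e : M = σ * (2 / (κ₂ - κ₁)) := by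
    rw [hM, hσ]
    ring
  rw [e]
  linarith

end ContFrac

/-! ### Gelfand's formula and the transfer operator on powers -/

namespace ContFrac
open Real

section Gelfand

variable {𝔸 : Type*} [NormedRing 𝔸] [NormedAlgebra ℂ 𝔸] [CompleteSpace 𝔸]

theorem spectralRadius_ne_top (a : 𝔸) : spectralRadius ℂ a ≠ ⊤ := by
  refine ne_top_of_le_ne_top ?_ (spectrum.spectralRadius_le_pow_nnnorm_pow_one_div ℂ a 0)
  simp only [CharP.cast_eq_zero, zero_add, div_one, ENNReal.rpow_one]
  finiteness

/-- Gelfand's formula along the multiples of `n`. -/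
theorem tendsto_norm_pow_mul_rpow (a : 𝔸) {n : ℕ} (hn : n ≠ 0) :
    Tendsto (fun k : ℕ => ‖a ^ (n * k)‖ ^ (1 / (k : ℝ))) atTop
      (𝓝 ((spectralRadius ℂ a).toReal ^ n)) := by
  have h1 := (ENNReal.tendsto_toReal (spectralRadius_ne_top a)).comp
    (spectrum.pow_norm_pow_one_div_tendsto_nhds_spectralRadius a)
  have h2 : Tendsto (fun k : ℕ => n * k) atTop atTop :=
    tendsto_id.const_mul_atTop' (Nat.pos_of_ne_zero hn)
  have h3 := (h1.comp h2).pow n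
  refine h3.congr fun k => ?_
  simp only [Function.comp]
  rw [ENNReal.toReal_ofReal (by positivity), ← rpow_natCast, ← rpow_mul (norm_nonneg _)]
  congr 1
  push_cast
  rcases eq_or_ne k 0 with rfl | hk
  · simp
  · field_simp

theorem tendsto_const_mul_pow_rpow {C ρ : ℝ} (hC : 0 < C) (hρ : 0 ≤ ρ) :
    Tendsto (fun k : ℕ => (C * ρ ^ k) ^ (1 / (k : ℝ))) atTop (𝓝 ρ) := by
  have h1 : Tendsto (fun k : ℕ => C ^ (1 / (k : ℝ)) * ρ) atTop (𝓝 (C ^ (0 : ℝ) * ρ)) :=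
    (tendsto_const_nhds.rpow tendsto_one_div_atTop_nhds_zero_nat (Or.inl hC.ne')).mul_const ρ
  rw [rpow_zero, one_mul] at h1
  refine h1.congr' ?_
  filter_upwards [eventually_ne_atTop 0] with k hk
  rw [mul_rpow hC.le (by positivity), ← rpow_natCast, ← rpow_mul hρ, mul_one_div_cancel
    (by exact_mod_cast hk), rpow_one]

/-- Upper bound for the spectral radius from the growth of the powers along the multiples of `n`. -/
theorem spectralRadius_pow_le_of_norm_le {a : 𝔸} {n : ℕ} (hn : n ≠ 0) {C ρ : ℝ} (hC : 0 < C)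
    (hρ : 0 ≤ ρ) (h : ∀ k, ‖a ^ (n * k)‖ ≤ C * ρ ^ k) :
    (spectralRadius ℂ a).toReal ^ n ≤ ρ :=
  le_of_tendsto_of_tendsto' (tendsto_norm_pow_mul_rpow a hn) (tendsto_const_mul_pow_rpow hC hρ)
    fun k => rpow_le_rpow (norm_nonneg _) (h k) (by positivity)

/-- Lower bound for the spectral radius from the growth of the powers along the multiples of `n`. -/
theorem le_spectralRadius_pow_of_le_norm {a : 𝔸} {n : ℕ} (hn : n ≠ 0) {C ρ : ℝ} (hC : 0 < C)
    (hρ : 0 ≤ ρ) (h : ∀ k, C * ρ ^ k ≤ ‖a ^ (n * k)‖) :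
    ρ ≤ (spectralRadius ℂ a).toReal ^ n :=
  le_of_tendsto_of_tendsto' (tendsto_const_mul_pow_rpow hC hρ) (tendsto_norm_pow_mul_rpow a hn)
    fun k => rpow_le_rpow (by positivity) (h k) (by positivity)

end Gelfand

namespace Alphabet

variable (A : Alphabet)

/-- The transfer operator on real functions on the line; on `S` its values depend only on the
values of `f` on `S`. -/
noncomputable def rtransfer (s : ℝ) (f : ℝ → ℝ) (x : ℝ) : ℝ :=
  ∑ β : A.digits, (x + β) ^ (-(2 * s)) * f (theta β x)

/-- Functions that agree on `S` with a positive linear combination of the functions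
`x ↦ (x + d)^(-2s)`, where `𝔞_∞ + γ ≤ d`, `d ≤ 𝔟_∞ + Γ`. -/
inductive PowComb (s : ℝ) : (ℝ → ℝ) → Prop
  | pow (d : ℝ) (h1 : A.aInf + A.gmin ≤ d) (h2 : d ≤ A.bInf + A.gmax) :
      PowComb s fun x => (x + d) ^ (-(2 * s))
  | add (f g : ℝ → ℝ) : PowComb s f → PowComb s g → PowComb s fun x => f x + g x
  | smul (c : ℝ) (f : ℝ → ℝ) (hc : 0 < c) : PowComb s f → PowComb s fun x => c * f x
  | congr (f g : ℝ → ℝ) (h : ∀ x ∈ A.S, f x = g x) : PowComb s f → PowComb s g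

variable {A} {s : ℝ}

theorem abs_deriv_theta_rpow {β x : ℝ} (hβ : β ∈ A.digits) (hx : x ∈ A.S) :
    |deriv (theta β) x| ^ s = (x + β) ^ (-(2 * s)) := by
  have h := A.add_pos_of_mem hβ hx
  rw [deriv_theta h.ne', abs_div, abs_neg, abs_one, abs_of_pos (by positivity), one_div,
    inv_rpow (by positivity), ← rpow_natCast, ← rpow_mul h.le, rpow_neg h.le]
  norm_num

theorem rtransfer_pow {d x : ℝ} (hd : A.aInf + A.gmin ≤ d) (hx : x ∈ A.S) :
    A.rtransfer s (fun x => (x + d) ^ (-(2 * s))) x =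
      ∑ β : A.digits, d ^ (-(2 * s)) * (x + (β + 1 / d)) ^ (-(2 * s)) := by
  have h0 := A.aInf_nonneg
  have hγ := A.one_le_gmin
  have hd0 : 0 < d := by linarith
  refine Finset.sum_congr rfl fun β _ => ?_
  have h := A.add_pos_of_mem β.2 hx
  have h1 : 0 < theta β x := by
    unfold theta
    positivity
  have h2 : 0 ≤ x + (β + 1 / d) := by
    have : 0 < 1 / d := by positivity
    linarith
  rw [← mul_rpow h.le (by linarith), ← mul_rpow hd0.le h2]
  congr 1
  unfold theta
  field_simp
  ring

theorem PowComb.sum {ι : Type*} {t : Finset ι} (ht : t.Nonempty) {f : ι → ℝ → ℝ}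
    (hf : ∀ i ∈ t, A.PowComb s (f i)) : A.PowComb s fun x => ∑ i ∈ t, f i x := by
  classical
  induction ht using Finset.Nonempty.cons_induction with
  | singleton a => simpa using hf a (by simp)
  | cons a t ha ht ih =>
    simp only [Finset.sum_cons]
    exact .add _ _ (hf a (by simp)) (ih fun i hi => hf i (by simp [hi]))

theorem digits_univ_nonempty : (Finset.univ : Finset A.digits).Nonempty := by
  obtain ⟨β, hβ⟩ := A.nontrivial.nonempty
  exact ⟨⟨β, hβ⟩, Finset.mem_univ _⟩

theorem PowComb.rtransfer {f : ℝ → ℝ} (hf : A.PowComb s f) : A.PowComb s (A.rtransfer s f) := by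
  have hγ := A.one_le_gmin
  have hΓ := A.gmin_lt_gmax
  have h0 := A.aInf_nonneg
  induction hf with
  | pow d h1 h2 =>
    have hd0 : 0 < d := by linarith
    refine .congr _ _ (fun x hx => (rtransfer_pow h1 hx).symm) ?_
    refine PowComb.sum digits_univ_nonempty fun β _ => ?_
    refine .smul _ _ (by positivity) (.pow _ ?_ ?_)
    · have := A.gmin_le β.2
      have h3 : A.aInf ≤ 1 / d := by
        rw [← A.theta_gmax_bInf]
        exact one_div_le_one_div_of_le hd0 h2
      linarith
    · have := A.le_gmax β.2
      have h3 : 1 / d ≤ A.bInf := by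
        rw [← A.theta_gmin_aInf]
        exact one_div_le_one_div_of_le (by linarith) h1
      linarith
  | add f g _ _ ihf ihg =>
    refine .congr _ _ (fun x _ => ?_) (.add _ _ ihf ihg)
    simp only [Alphabet.rtransfer, mul_add, Finset.sum_add_distrib]
  | smul c f hc _ ih =>
    refine .congr _ _ (fun x _ => ?_) (.smul c _ hc ih)
    simp only [Alphabet.rtransfer, Finset.mul_sum]
    exact Finset.sum_congr rfl fun β _ => by ring
  | congr f g h _ ih =>
    refine .congr _ _ (fun x hx => ?_) ih
    exact Finset.sum_congr rfl fun β _ => by rw [h _ (A.theta_mem β.2 hx)]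

theorem PowComb.iterate {f : ℝ → ℝ} (hf : A.PowComb s f) (n : ℕ) :
    A.PowComb s ((A.rtransfer s)^[n] f) := by
  induction n with
  | zero => exact hf
  | succ n ih =>
    rw [Function.iterate_succ_apply']
    exact ih.rtransfer

theorem chi_pos : 0 < A.chi := by
  have hγ := A.one_le_gmin
  have h0 := A.aInf_nonneg
  unfold chi
  linarith

theorem PowComb.pos {f : ℝ → ℝ} (hf : A.PowComb s f) : ∀ x ∈ A.S, 0 < f x := by
  induction hf with
  | pow d h1 h2 =>
    intro x hx
    exact rpow_pos_of_pos (A.chi_pos.trans_le (Mesh.chi_le_add h1 hx)) _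
  | add f g _ _ ihf ihg => exact fun x hx => add_pos (ihf x hx) (ihg x hx)
  | smul c f hc _ ih => exact fun x hx => mul_pos hc (ih x hx)
  | congr f g h _ ih => exact fun x hx => h x hx ▸ ih x hx

theorem memCone_pow (hs : 0 ≤ s) {d : ℝ} (hd : A.aInf + A.gmin ≤ d) :
    MemCone (2 * s / A.chi) A.S fun x => (x + d) ^ (-(2 * s)) := by
  intro x hx y hy
  have := add_rpow_le_exp_mul (h := |x - y|) hs A.chi_pos
    (A.chi_pos.trans_le (Mesh.chi_le_add hd hy)) (Mesh.chi_le_add hd hx)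
    (abs_sub_comm y x).le
  rwa [mul_div_right_comm] at this

theorem PowComb.memCone (hs : 0 ≤ s) {f : ℝ → ℝ} (hf : A.PowComb s f) :
    MemCone (2 * s / A.chi) A.S f := by
  induction hf with
  | pow d h1 h2 => exact memCone_pow hs h1
  | add f g _ _ ihf ihg =>
    intro x hx y hy
    have h1 := ihf x hx y hy
    have h2 := ihg x hx y hy
    simp only
    rw [mul_add]
    exact add_le_add h1 h2
  | smul c f hc _ ih => exact ih.const_mul hc.le
  | congr f g h _ ih => exact ih.congr h

/-- The iterates of the transfer operator are sums over words. -/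
theorem iterate_rtransfer_eq (ν : ℕ) (f : ℝ → ℝ) : ∀ x ∈ A.S, (A.rtransfer s)^[ν] f x =
    ∑ ω : A.Word ν, gWord ω x ^ s * f (thetaWord ω x) := by
  induction ν generalizing f with
  | zero =>
    intro x hx
    have h1 : ∀ ω : A.Word 0, gWord ω x = 1 := by
      intro ω
      have : thetaWord ω = id := by
        funext y
        simp [thetaWord]
      rw [gWord, this]
      simp
    simp [h1, thetaWord]
  | succ ν ih =>
    intro x hx
    rw [Function.iterate_succ_apply, ih _ x hx]
    simp only [rtransfer]
    rw [← (Fin.consEquiv fun _ => (A.digits : Type)).sum_comp, Fintype.sum_prod_type_right]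
    refine Finset.sum_congr rfl fun ω _ => ?_
    rw [Finset.mul_sum]
    refine Finset.sum_congr rfl fun β _ => ?_
    have hθ : thetaWord (Fin.consEquiv (fun _ => (A.digits : Type)) (β, ω)) =
        theta β ∘ thetaWord ω := by
      funext y
      simp [thetaWord, Fin.consEquiv, List.ofFn_succ]
    have hmem := thetaWord_mem ω hx
    have hdiff : DifferentiableAt ℝ (thetaWord ω) x := by
      rcases Nat.eq_zero_or_pos ν with rfl | hν
      · have : thetaWord ω = id := by
          funext y
          simp [thetaWord]
        rw [this]
        exact differentiableAt_id
      · obtain ⟨B', B, e, -, -, -, -, -, -, h6⟩ := exists_hasDerivAt_thetaWord hν ω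
        exact (h6 x (A.aInf_nonneg.trans hx.1)).differentiableAt
    have hg : gWord (Fin.consEquiv (fun _ => (A.digits : Type)) (β, ω)) x =
        |deriv (theta β) (thetaWord ω x)| * gWord ω x := by
      rw [gWord, hθ, deriv_comp _ (hasDerivAt_theta (A.add_pos_of_mem β.2 hmem).ne').differentiableAt
        hdiff, abs_mul, gWord]
    rw [hg, hθ, mul_rpow (abs_nonneg _) (gWord_nonneg ω x), abs_deriv_theta_rpow β.2 hmem]
    simp only [Function.comp]
    ring

end Alphabet
end ContFrac

/-! ### Growth of the iterates of the transfer operator -/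

namespace ContFrac
open Real

namespace Alphabet

variable {A : Alphabet} {s : ℝ}

theorem rtransfer_mono {f g : ℝ → ℝ} (h : ∀ x ∈ A.S, f x ≤ g x) :
    ∀ x ∈ A.S, A.rtransfer s f x ≤ A.rtransfer s g x := fun _ hx =>
  Finset.sum_le_sum fun β _ => mul_le_mul_of_nonneg_left (h _ (A.theta_mem β.2 hx))
    (rpow_nonneg (A.add_pos_of_mem β.2 hx).le _)

theorem iterate_rtransfer_mono {f g : ℝ → ℝ} (h : ∀ x ∈ A.S, f x ≤ g x) (n : ℕ) :
    ∀ x ∈ A.S, (A.rtransfer s)^[n] f x ≤ (A.rtransfer s)^[n] g x := by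
  induction n with
  | zero => exact h
  | succ n ih =>
    rw [Function.iterate_succ_apply', Function.iterate_succ_apply']
    exact rtransfer_mono ih

theorem iterate_rtransfer_const_mul (c : ℝ) (f : ℝ → ℝ) (n : ℕ) :
    (A.rtransfer s)^[n] (fun x => c * f x) = fun x => c * (A.rtransfer s)^[n] f x := by
  induction n with
  | zero => rfl
  | succ n ih =>
    rw [Function.iterate_succ_apply', Function.iterate_succ_apply', ih]
    funext x
    simp only [rtransfer, Finset.mul_sum]
    exact Finset.sum_congr rfl fun β _ => by ring

theorem iterate_mul_le {f : ℝ → ℝ} {n : ℕ} {ρ : ℝ} (hρ : 0 ≤ ρ)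
    (h : ∀ x ∈ A.S, (A.rtransfer s)^[n] f x ≤ ρ * f x) (k : ℕ) :
    ∀ x ∈ A.S, (A.rtransfer s)^[n * k] f x ≤ ρ ^ k * f x := by
  induction k with
  | zero =>
    intro x _
    simp
  | succ k ih =>
    intro x hx
    rw [Nat.mul_succ, Nat.add_comm (n * k), Function.iterate_add_apply]
    refine (iterate_rtransfer_mono ih n x hx).trans ?_
    rw [iterate_rtransfer_const_mul]
    have := mul_le_mul_of_nonneg_left (h x hx) (pow_nonneg hρ k)
    rw [pow_succ]
    linarith

theorem le_iterate_mul {f : ℝ → ℝ} {n : ℕ} {ρ : ℝ} (hρ : 0 ≤ ρ)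
    (h : ∀ x ∈ A.S, ρ * f x ≤ (A.rtransfer s)^[n] f x) (k : ℕ) :
    ∀ x ∈ A.S, ρ ^ k * f x ≤ (A.rtransfer s)^[n * k] f x := by
  induction k with
  | zero =>
    intro x _
    simp
  | succ k ih =>
    intro x hx
    rw [Nat.mul_succ, Nat.add_comm (n * k), Function.iterate_add_apply]
    refine le_trans ?_ (iterate_rtransfer_mono ih n x hx)
    rw [iterate_rtransfer_const_mul]
    have := mul_le_mul_of_nonneg_left (h x hx) (pow_nonneg hρ k)
    rw [pow_succ]
    linarith

theorem transfer_apply (g : C(A.S, ℂ)) (x : A.S) : A.transfer ℂ s g x =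
    ∑ β : A.digits, (((x : ℝ) + β) ^ (-(2 * s)) : ℝ) * g ⟨theta β x, A.theta_mem β.2 x.2⟩ := by
  change (∑ β : A.digits, A.weight ℂ s β * g.comp (A.thetaMap β)) x = _
  rw [ContinuousMap.sum_apply]
  refine Finset.sum_congr rfl fun β _ => ?_
  rw [← abs_deriv_theta_rpow β.2 x.2]
  rfl

theorem norm_transfer_pow_apply_le {g : C(A.S, ℂ)} {φ : ℝ → ℝ} (h : ∀ x : A.S, ‖g x‖ ≤ φ x)
    (n : ℕ) : ∀ x : A.S, ‖(A.transfer ℂ s ^ n) g x‖ ≤ (A.rtransfer s)^[n] φ x := by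
  induction n with
  | zero => exact h
  | succ n ih =>
    intro x
    rw [pow_succ', Function.iterate_succ_apply', mul_apply_eq_comp, transfer_apply]
    refine (norm_sum_le _ _).trans (Finset.sum_le_sum fun β _ => ?_)
    have hp := rpow_nonneg (A.add_pos_of_mem β.2 x.2).le (-(2 * s))
    rw [norm_mul, Complex.norm_real, norm_of_nonneg hp]
    exact mul_le_mul_of_nonneg_left (ih _) hp

theorem transfer_pow_apply_of_eq {g : C(A.S, ℂ)} {φ : ℝ → ℝ} (h : ∀ x : A.S, g x = (φ x : ℝ))
    (n : ℕ) : ∀ x : A.S, (A.transfer ℂ s ^ n) g x = ((A.rtransfer s)^[n] φ x : ℝ) := by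
  induction n with
  | zero => exact h
  | succ n ih =>
    intro x
    rw [pow_succ', Function.iterate_succ_apply', mul_apply_eq_comp, transfer_apply,
      rtransfer, Complex.ofReal_sum]
    refine Finset.sum_congr rfl fun β _ => ?_
    rw [ih, Complex.ofReal_mul]

/-- A Harnack type inequality: the constant does not depend on `f`. -/
theorem PowComb.le_exp_mul (hs : 0 ≤ s) {f : ℝ → ℝ} (hf : A.PowComb s f) {x y : ℝ} (hx : x ∈ A.S)
    (hy : y ∈ A.S) : f x ≤ exp (2 * s / A.chi * (A.bInf - A.aInf)) * f y := by
  refine (hf.memCone hs x hx y hy).trans (mul_le_mul_of_nonneg_right (exp_le_exp.2 ?_)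
    (hf.pos y hy).le)
  have := A.chi_pos
  refine mul_le_mul_of_nonneg_left ?_ (by positivity)
  rw [abs_le]
  constructor <;> linarith [hx.1, hx.2, hy.1, hy.2]

theorem aInf_mem : A.aInf ∈ A.S := ⟨le_rfl, A.aInf_le_bInf⟩

theorem powComb_base (s : ℝ) :
    A.PowComb s (fun x => (x + (A.aInf + A.gmin)) ^ (-(2 * s))) :=
  .pow _ le_rfl (by linarith [A.aInf_le_bInf, A.gmin_lt_gmax])

theorem lam_pow_le_of_norm_le {n : ℕ} (hn : n ≠ 0) {C ρ : ℝ} (hC : 0 < C) (hρ : 0 ≤ ρ)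
    (h : ∀ k, ‖A.transfer ℂ s ^ (n * k)‖ ≤ C * ρ ^ k) : A.lam s ^ n ≤ ρ := by
  unfold lam
  exact spectralRadius_pow_le_of_norm_le (a := A.transfer ℂ s) hn hC hρ h

theorem le_lam_pow_of_le_norm {n : ℕ} (hn : n ≠ 0) {C ρ : ℝ} (hC : 0 < C) (hρ : 0 ≤ ρ)
    (h : ∀ k, C * ρ ^ k ≤ ‖A.transfer ℂ s ^ (n * k)‖) : ρ ≤ A.lam s ^ n := by
  unfold lam
  exact le_spectralRadius_pow_of_le_norm (a := A.transfer ℂ s) hn hC hρ h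

/-- By Gelfand's formula and the Harnack type inequality `PowComb.le_exp_mul`, the iterates of
`L_s` on a positive combination of powers grow exactly like the powers of `λ_s`. -/
theorem lam_pow_bounds (hs : 0 ≤ s) {f : ℝ → ℝ} (hf : A.PowComb s f)
    (hcont : ContinuousOn f A.S) {n : ℕ} (hn : n ≠ 0) :
    A.lam s ^ n ≤ exp (2 * s / A.chi * (A.bInf - A.aInf)) ^ 2 * ((A.rtransfer s)^[n] f A.aInf) /
      f A.aInf ∧
    (A.rtransfer s)^[n] f A.aInf / (exp (2 * s / A.chi * (A.bInf - A.aInf)) ^ 2 * f A.aInf) ≤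
      A.lam s ^ n := by
  set K := exp (2 * s / A.chi * (A.bInf - A.aInf)) with hK
  have hK0 : 0 < K := exp_pos _
  set α := (A.rtransfer s)^[n] f A.aInf with hα
  have hfn := hf.iterate n
  have hα0 : 0 < α := hfn.pos _ aInf_mem
  have hf0 : 0 < f A.aInf := hf.pos _ aInf_mem
  have hup : ∀ x ∈ A.S, f x ≤ K * f A.aInf := fun x hx => hf.le_exp_mul hs hx aInf_mem
  have hlo : ∀ x ∈ A.S, f A.aInf ≤ K * f x := fun x hx => hf.le_exp_mul hs aInf_mem hx
  constructor
  · set ρ := K ^ 2 * α / f A.aInf with hρ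
    have hρ0 : 0 ≤ ρ := by positivity
    have h1 : ∀ x ∈ A.S, (A.rtransfer s)^[n] f x ≤ ρ * f x := by
      intro x hx
      have h2 := hfn.le_exp_mul hs hx aInf_mem
      have h3 := mul_le_mul_of_nonneg_left (hlo x hx) (by positivity : 0 ≤ K * α / f A.aInf)
      have e1 : K * α / f A.aInf * f A.aInf = K * α := by field_simp
      rw [e1] at h3
      refine h2.trans (h3.trans (le_of_eq ?_))
      rw [hρ]
      ring
    have h2 := iterate_mul_le hρ0 h1
    refine lam_pow_le_of_norm_le hn (by positivity : 0 < K ^ 2) hρ0 fun k => ?_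
    refine ContinuousLinearMap.opNorm_le_bound _ (by positivity) fun g => ?_
    rw [ContinuousMap.norm_le _ (by positivity)]
    intro x
    have h3 := norm_transfer_pow_apply_le (s := s) (g := g) (φ := fun x => ‖g‖ * (K / f A.aInf) * f x)
      (fun x => by
        have h4 := mul_le_mul_of_nonneg_left (hlo x x.2)
          (by positivity : 0 ≤ ‖g‖ / f A.aInf)
        have e1 : ‖g‖ / f A.aInf * f A.aInf = ‖g‖ := by field_simp
        rw [e1] at h4
        refine (g.norm_coe_le_norm x).trans (h4.trans (le_of_eq ?_))
        ring) (n * k) x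
    rw [iterate_rtransfer_const_mul] at h3
    refine h3.trans ?_
    have h4 := (h2 k x x.2).trans (mul_le_mul_of_nonneg_left (hup x x.2) (pow_nonneg hρ0 k))
    have h5 := mul_le_mul_of_nonneg_left h4 (by positivity : 0 ≤ ‖g‖ * (K / f A.aInf))
    refine h5.trans (le_of_eq ?_)
    field_simp
  · set ρ := α / (K ^ 2 * f A.aInf) with hρ
    have hρ0 : 0 ≤ ρ := by positivity
    have h1 : ∀ x ∈ A.S, ρ * f x ≤ (A.rtransfer s)^[n] f x := by
      intro x hx
      have h2 := hfn.le_exp_mul hs aInf_mem hx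
      have h3 := mul_le_mul_of_nonneg_left (hup x hx) hρ0
      have e1 : ρ * (K * f A.aInf) = α / K := by
        rw [hρ]
        field_simp
      rw [e1] at h3
      refine h3.trans ?_
      rw [div_le_iff₀ hK0, mul_comm]
      exact h2
    have h2 := le_iterate_mul hρ0 h1
    let F : C(A.S, ℂ) := ⟨fun x => (f x : ℝ),
      Complex.continuous_ofReal.comp (continuousOn_iff_continuous_domRestrict.1 hcont)⟩
    have hF := transfer_pow_apply_of_eq (s := s) (g := F) (φ := f) fun _ => rfl
    have hFn : 0 < ‖F‖ := by
      have h3 := F.norm_coe_le_norm ⟨A.aInf, aInf_mem⟩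
      have h4 : ‖F ⟨A.aInf, aInf_mem⟩‖ = f A.aInf := by
        change ‖((f A.aInf : ℝ) : ℂ)‖ = _
        rw [Complex.norm_real, norm_of_nonneg hf0.le]
      linarith
    refine le_lam_pow_of_le_norm hn (by positivity : 0 < f A.aInf / ‖F‖) hρ0 fun k => ?_
    rw [div_mul_eq_mul_div, div_le_iff₀ hFn]
    refine le_trans ?_ (ContinuousLinearMap.le_opNorm _ F)
    refine le_trans ?_ (ContinuousMap.norm_coe_le_norm _ ⟨A.aInf, aInf_mem⟩)
    rw [hF, Complex.norm_real]
    refine le_trans ?_ (le_abs_self _)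
    rw [mul_comm]
    exact h2 k _ aInf_mem

/-- Approximate eigenfunctions: Cesàro means of `λ^{-νk} L^{νk} f` have the eigenvalue `λ^ν` of
`L^ν` up to `O(1/N)`, and stay between two positive constants. -/
theorem exists_approx_eigenfunctions (hs : 0 ≤ s) {ν : ℕ} (hν : 1 ≤ ν) :
    0 < A.lam s ∧ ∃ (V : ℕ → ℝ → ℝ) (c C : ℝ), 0 < c ∧ (∀ N, A.PowComb s (V N)) ∧
      (∀ N, ∀ x ∈ A.S, V N x ∈ Icc c C) ∧
      ∀ x ∈ A.S, Tendsto (fun N => (A.rtransfer s)^[ν] (V N) x - A.lam s ^ ν * V N x) atTop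
        (𝓝 0) := by
  set f : ℝ → ℝ := fun x => (x + (A.aInf + A.gmin)) ^ (-(2 * s)) with hfdef
  have hf : A.PowComb s f := powComb_base s
  have hcont : ContinuousOn f A.S := by
    intro x hx
    refine ContinuousAt.continuousWithinAt (ContinuousAt.rpow_const (by fun_prop) (Or.inl ?_))
    exact (A.chi_pos.trans_le (Mesh.chi_le_add le_rfl hx)).ne'
  set K := exp (2 * s / A.chi * (A.bInf - A.aInf)) with hK
  have hK1 : 1 ≤ K := by
    have := A.chi_pos
    have := A.aInf_le_bInf
    exact one_le_exp (mul_nonneg (by positivity) (by linarith))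
  have hK0 : 0 < K := by linarith
  have hf0 : 0 < f A.aInf := hf.pos _ aInf_mem
  have hlam : 0 < A.lam s := by
    have h1 := (lam_pow_bounds hs hf hcont one_ne_zero).2
    have h2 := (hf.iterate 1).pos _ aInf_mem
    rw [pow_one] at h1
    exact lt_of_lt_of_le (by positivity) h1
  refine ⟨hlam, ?_⟩
  set q := A.lam s ^ ν with hq
  have hq0 : 0 < q := by positivity
  -- two-sided bounds for the normalized iterates
  have hbd : ∀ k, ∀ x ∈ A.S, (q ^ k)⁻¹ * (A.rtransfer s)^[ν * k] f x ∈
      Icc (f A.aInf / K ^ 3) (K ^ 3 * f A.aInf) := by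
    intro k x hx
    have hk := hf.iterate (ν * k)
    have h1 := hk.le_exp_mul hs hx aInf_mem
    have h2 := hk.le_exp_mul hs aInf_mem hx
    rw [← hK] at h1 h2
    have h3 : q ^ k ≤ K ^ 2 * ((A.rtransfer s)^[ν * k] f A.aInf) / f A.aInf ∧
        (A.rtransfer s)^[ν * k] f A.aInf / (K ^ 2 * f A.aInf) ≤ q ^ k := by
      rcases Nat.eq_zero_or_pos k with rfl | hk0
      · have hK2 : 1 ≤ K ^ 2 := one_le_pow₀ hK1
        constructor
        · simp only [pow_zero, mul_zero, Function.iterate_zero, id]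
          rwa [mul_div_cancel_right₀ _ hf0.ne']
        · simp only [pow_zero, mul_zero, Function.iterate_zero, id]
          rw [div_le_one (by positivity)]
          exact le_mul_of_one_le_left hf0.le hK2
      · rw [hq, ← pow_mul]
        exact lam_pow_bounds hs hf hcont (Nat.mul_ne_zero (by omega) (by omega))
    obtain ⟨h3, h4⟩ := h3
    rw [le_div_iff₀ hf0] at h3
    rw [div_le_iff₀ (by positivity)] at h4
    have hqk : 0 < q ^ k := by positivity
    constructor
    · rw [inv_mul_eq_div, div_le_div_iff₀ (by positivity) hqk]
      have := mul_le_mul_of_nonneg_left h2 (by positivity : 0 ≤ K ^ 2)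
      linarith
    · rw [inv_mul_eq_div, div_le_iff₀ hqk]
      have := mul_le_mul_of_nonneg_left h4 hK0.le
      linarith
  set W : ℕ → ℝ → ℝ := fun k x => (q ^ k)⁻¹ * (A.rtransfer s)^[ν * k] f x with hW
  have hWc : ∀ k, A.PowComb s (W k) := fun k => .smul _ _ (by positivity) (hf.iterate (ν * k))
  have hWL : ∀ k, (A.rtransfer s)^[ν] (W k) = fun x => q * W (k + 1) x := by
    intro k
    rw [hW]
    simp only
    rw [iterate_rtransfer_const_mul]
    funext x
    rw [← Function.iterate_add_apply, Nat.mul_succ, Nat.add_comm, pow_succ]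
    field_simp
  refine ⟨fun N x => ((N + 1 : ℝ))⁻¹ * ∑ k ∈ Finset.range (N + 1), W k x, f A.aInf / K ^ 3,
    K ^ 3 * f A.aInf, by positivity, fun N => .smul _ _ (by positivity) (PowComb.sum ⟨0, by simp⟩
      fun k _ => hWc k), ?_, ?_⟩
  · intro N x hx
    have hN : (0 : ℝ) < N + 1 := by positivity
    have h1 := Finset.card_nsmul_le_sum (Finset.range (N + 1)) (fun k => W k x) _
      fun k _ => (hbd k x hx).1
    have h2 := Finset.sum_le_card_nsmul (Finset.range (N + 1)) (fun k => W k x) _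
      fun k _ => (hbd k x hx).2
    rw [Finset.card_range, nsmul_eq_mul] at h1 h2
    push_cast at h1 h2
    simp only
    rw [inv_mul_eq_div]
    constructor
    · rw [le_div_iff₀ hN]
      linarith
    · rw [div_le_iff₀ hN]
      linarith
  · intro x hx
    have hsumL : ∀ N : ℕ, (A.rtransfer s)^[ν] (fun x => ∑ k ∈ Finset.range (N + 1), W k x) x =
        ∑ k ∈ Finset.range (N + 1), q * W (k + 1) x := by
      intro N
      have h1 : ∀ k, q * W (k + 1) x = (A.rtransfer s)^[ν] (W k) x := fun k => by rw [hWL]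
      rw [Finset.sum_congr rfl fun k _ => h1 k, iterate_rtransfer_eq ν _ x hx,
        Finset.sum_congr rfl fun k _ => iterate_rtransfer_eq ν _ x hx, Finset.sum_comm]
      simp only [Finset.mul_sum]
    have hdiff : ∀ N : ℕ, (A.rtransfer s)^[ν]
        (fun x => ((N + 1 : ℝ))⁻¹ * ∑ k ∈ Finset.range (N + 1), W k x) x -
          q * (((N + 1 : ℝ))⁻¹ * ∑ k ∈ Finset.range (N + 1), W k x) =
        ((N : ℝ) + 1)⁻¹ * (q * (W (N + 1) x - W 0 x)) := by
      intro N
      rw [iterate_rtransfer_const_mul]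
      simp only
      rw [hsumL, ← Finset.mul_sum, ← Finset.sum_range_sub (fun k => W k x) (N + 1),
        Finset.sum_sub_distrib]
      ring
    refine squeeze_zero_norm (a := fun N : ℕ => ((N : ℝ) + 1)⁻¹ * (q * (K ^ 3 * f A.aInf)))
      (fun N => ?_) ?_
    · rw [hdiff, norm_mul, norm_mul, norm_of_nonneg (by positivity : 0 ≤ ((N : ℝ) + 1)⁻¹),
        norm_of_nonneg hq0.le]
      refine mul_le_mul_of_nonneg_left (mul_le_mul_of_nonneg_left ?_ hq0.le) (by positivity)
      have h1 := hbd (N + 1) x hx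
      have h2 := hbd 0 x hx
      have h3 : 0 < f A.aInf / K ^ 3 := by positivity
      rw [norm_eq_abs, abs_le]
      constructor <;> linarith [h1.1, h1.2, h2.1, h2.2]
    · have h1 := (tendsto_one_div_add_atTop_nhds_zero_nat (𝕜 := ℝ)).mul_const
        (q * (K ^ 3 * f A.aInf))
      simpa [one_div] using h1

end Alphabet
end ContFrac

/-! ### Spectral radius of the collocation operator -/

namespace ContFrac
open Real

section Cone

variable {M M' : ℝ} {T : Finset ℝ} {F G : T → ℝ}

theorem add_mem_cone (hF : F ∈ cone M T) (hG : G ∈ cone M T) : F + G ∈ cone M T := by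
  intro ξ ζ
  have h1 := hF ξ ζ
  have h2 := hG ξ ζ
  simp only [Pi.add_apply, mul_add]
  exact add_le_add h1 h2

theorem smul_mem_cone {c : ℝ} (hc : 0 ≤ c) (hF : F ∈ cone M T) : c • F ∈ cone M T := by
  intro ξ ζ
  have := mul_le_mul_of_nonneg_left (hF ξ ζ) hc
  simp only [Pi.smul_apply, smul_eq_mul]
  linarith

theorem cone_mono (h0 : ∀ ξ, 0 ≤ F ξ) (hM : M ≤ M') (hF : F ∈ cone M T) : F ∈ cone M' T :=
  fun ξ ζ => (hF ξ ζ).trans (mul_le_mul_of_nonneg_right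
    (exp_le_exp.2 (mul_le_mul_of_nonneg_right hM (abs_nonneg _))) (h0 ζ))

theorem isClosed_cone (M : ℝ) (T : Finset ℝ) : IsClosed (cone M T) := by
  have : cone M T = ⋂ ξ : T, ⋂ ζ : T, {F | F ξ ≤ exp (M * |(ξ : ℝ) - ζ|) * F ζ} := by
    ext F
    simp [cone]
  rw [this]
  refine isClosed_iInter fun ξ => isClosed_iInter fun ζ => isClosed_le ?_ ?_ <;> fun_prop

/-- A positive element of a smaller cone is an order unit. -/
theorem exists_add_smul_mem_cone {v : T → ℝ} (hv : ∀ ξ, 0 < v ξ) (hvM : v ∈ cone M' T)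
    (hM : M' < M) (F : T → ℝ) : ∃ C : ℝ, 0 ≤ C ∧ F + C • v ∈ cone M T := by
  set gap : T → T → ℝ := fun ξ ζ => exp (M * |(ξ : ℝ) - ζ|) * v ζ - v ξ with hgap
  set defect : T → T → ℝ := fun ξ ζ => |F ξ - exp (M * |(ξ : ℝ) - ζ|) * F ζ| 
  have hgap0 : ∀ ξ ζ, ξ ≠ ζ → 0 < gap ξ ζ := by
    intro ξ ζ hne
    have h1 := hvM ξ ζ
    have h2 : exp (M' * |(ξ : ℝ) - ζ|) < exp (M * |(ξ : ℝ) - ζ|) := by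
      refine exp_lt_exp.2 (mul_lt_mul_of_pos_right hM (abs_pos.2 (sub_ne_zero.2 ?_)))
      exact fun h => hne (Subtype.ext h)
    have h3 := mul_lt_mul_of_pos_right h2 (hv ζ)
    rw [hgap]
    simp only
    linarith
  have hgap1 : ∀ ξ ζ, 0 ≤ gap ξ ζ := by
    intro ξ ζ
    rcases eq_or_ne ξ ζ with rfl | h
    · simp [hgap]
    · exact (hgap0 ξ ζ h).le
  refine ⟨∑ ξ, ∑ ζ, defect ξ ζ / gap ξ ζ, Finset.sum_nonneg fun ξ _ => Finset.sum_nonneg fun ζ _ =>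
    div_nonneg (abs_nonneg _) (hgap1 ξ ζ), ?_⟩
  set C := ∑ ξ, ∑ ζ, defect ξ ζ / gap ξ ζ with hC
  intro ξ ζ
  simp only [Pi.add_apply, Pi.smul_apply, smul_eq_mul]
  rcases eq_or_ne ξ ζ with rfl | hne
  · simp
  have h1 : defect ξ ζ / gap ξ ζ ≤ C := by
    refine le_trans ?_ (Finset.single_le_sum (f := fun ξ => ∑ ζ, defect ξ ζ / gap ξ ζ)
      (fun ξ _ => Finset.sum_nonneg fun ζ _ => div_nonneg (abs_nonneg _) (hgap1 ξ ζ))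
      (Finset.mem_univ ξ))
    exact Finset.single_le_sum (f := fun ζ => defect ξ ζ / gap ξ ζ)
      (fun ζ _ => div_nonneg (abs_nonneg _) (hgap1 ξ ζ)) (Finset.mem_univ ζ)
  rw [div_le_iff₀ (hgap0 ξ ζ hne)] at h1
  have h2 := (le_abs_self _).trans h1
  simp only [hgap] at h2
  linarith

end Cone

section Matrix

attribute [local instance] Matrix.linftyOpNormedRing Matrix.linftyOpNormedAlgebra

variable {n : Type*} [Fintype n] [DecidableEq n] (L : (n → ℝ) →ₗ[ℝ] (n → ℝ))

theorem toMatrix'_map_pow (k : ℕ) :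
    ((LinearMap.toMatrix' L).map ((↑) : ℝ → ℂ)) ^ k =
      (LinearMap.toMatrix' (L ^ k)).map ((↑) : ℝ → ℂ) := by
  have h1 := map_pow (Complex.ofRealHom.mapMatrix (m := n)) (LinearMap.toMatrix' L) k
  have h2 : LinearMap.toMatrix' (L ^ k) = LinearMap.toMatrix' L ^ k :=
    map_pow LinearMap.toMatrixAlgEquiv' L k
  rw [h2]
  exact h1.symm

/-- If the orbits of all basis vectors are bounded by `C bᵏ`, the spectral radius is at most `b`. -/
theorem spectralRadius_toMatrix'_le {b : ℝ} (hb : 0 ≤ b)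
    (h : ∀ F : n → ℝ, ∃ C, ∀ k i, |(L ^ k) F i| ≤ C * b ^ k) :
    (spectralRadius ℂ ((LinearMap.toMatrix' L).map ((↑) : ℝ → ℂ))).toReal ≤ b := by
  have : CompleteSpace (Matrix n n ℂ) := FiniteDimensional.complete ℂ _
  choose C hC using h
  set D := ∑ j, C (Pi.single j 1) with hD
  have key := spectralRadius_pow_le_of_norm_le
    (a := (LinearMap.toMatrix' L).map ((↑) : ℝ → ℂ)) one_ne_zero (C := |D| + 1) (ρ := b)
    (by positivity) hb fun k => by
      rw [one_mul, toMatrix'_map_pow, Matrix.linfty_opNorm_def, ← NNReal.coe_mk _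
        (by positivity : 0 ≤ (|D| + 1) * b ^ k), NNReal.coe_le_coe]
      refine Finset.sup_le fun i _ => ?_
      rw [← NNReal.coe_le_coe]
      push_cast
      have h1 : ∀ j, ‖(LinearMap.toMatrix' (L ^ k)).map ((↑) : ℝ → ℂ) i j‖ ≤
          C (Pi.single j 1) * b ^ k := by
        intro j
        rw [Matrix.map_apply, Complex.norm_real, LinearMap.toMatrix'_apply]
        have := hC (Pi.single j 1) k i
        rwa [← norm_eq_abs] at this
      refine (Finset.sum_le_sum fun j _ => h1 j).trans ?_
      rw [← Finset.sum_mul]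
      exact mul_le_mul_of_nonneg_right (by linarith [le_abs_self D]) (by positivity)
  rwa [pow_one] at key

/-- If the orbit of some vector grows at least like `bᵏ`, the spectral radius is at least `b`. -/
theorem le_spectralRadius_toMatrix' {b c : ℝ} (hb : 0 ≤ b) (hc : 0 < c) {F : n → ℝ} {i : n}
    (h : ∀ k, c * b ^ k ≤ (L ^ k) F i) :
    b ≤ (spectralRadius ℂ ((LinearMap.toMatrix' L).map ((↑) : ℝ → ℂ))).toReal := by
  have : CompleteSpace (Matrix n n ℂ) := FiniteDimensional.complete ℂ _
  set FC : n → ℂ := fun j => (F j : ℂ) with hFC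
  have hF : 0 < ‖FC‖ := by
    have h0 := h 0
    simp only [pow_zero, mul_one, Module.End.one_apply] at h0
    have h1 : ‖FC i‖ = |F i| := by
      rw [hFC]
      simp only
      rw [Complex.norm_real, norm_eq_abs]
    have h2 := norm_le_pi_norm FC i
    linarith [le_abs_self (F i)]
  have key := le_spectralRadius_pow_of_le_norm
    (a := (LinearMap.toMatrix' L).map ((↑) : ℝ → ℂ)) one_ne_zero (C := c / ‖FC‖) (ρ := b)
    (by positivity) hb fun k => by
      rw [one_mul, toMatrix'_map_pow, div_mul_eq_mul_div, div_le_iff₀ hF]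
      refine le_trans ?_ (Matrix.linfty_opNorm_mulVec _ _)
      refine le_trans ?_ (norm_le_pi_norm _ i)
      have e : ((LinearMap.toMatrix' (L ^ k)).map ((↑) : ℝ → ℂ)).mulVec FC i =
          (((L ^ k) F i : ℝ) : ℂ) := by
        rw [← LinearMap.toMatrix'_mulVec (L ^ k) F]
        simp [Matrix.mulVec, dotProduct, hFC]
      rw [e, Complex.norm_real]
      exact (h k).trans (le_abs_self _)
  rwa [pow_one] at key

end Matrix

namespace Mesh

variable {A : Alphabet} (P : Mesh A) {r ν : ℕ} {s M : ℝ}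

/-- Bounds for the spectral radius of `𝐋` from a positive `v`, interior to the cone `K(M; T)`, for
which `b v - 𝐋 v` or `𝐋 v - b v` lies in this cone. -/
theorem R_bounds (hr : 2 ≤ r) (hM : 0 < M) [Nonempty (P.T r)]
    (hL : ∀ F ∈ cone M (P.T r), P.colloc s ν r F ∈ cone M (P.T r)) {M' : ℝ} (hM' : M' < M)
    {v : P.T r → ℝ} (hv : ∀ ξ, 0 < v ξ) (hvM : v ∈ cone M' (P.T r)) {b₁ b₂ : ℝ}
    (hb : 0 ≤ b₂) (h1 : P.colloc s ν r v - b₁ • v ∈ cone M (P.T r))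
    (h2 : b₂ • v - P.colloc s ν r v ∈ cone M (P.T r)) :
    b₁ ≤ P.R s ν r ∧ P.R s ν r ≤ b₂ := by
  set L := P.colloc s ν r with hLdef
  have hLk : ∀ k, ∀ F ∈ cone M (P.T r), (L ^ k) F ∈ cone M (P.T r) := by
    intro k
    induction k with
    | zero => exact fun F hF => hF
    | succ k ih =>
      intro F hF
      rw [pow_succ', Module.End.mul_apply]
      exact hL _ (ih F hF)
  constructor
  · rcases lt_or_ge b₁ 0 with hneg | hb₁
    · exact hneg.le.trans ENNReal.toReal_nonneg
    have hpow : ∀ k, (L ^ k) v - b₁ ^ k • v ∈ cone M (P.T r) := by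
      intro k
      induction k with
      | zero =>
        intro ξ ζ
        simp
      | succ k ih =>
        have e : (L ^ (k + 1)) v - b₁ ^ (k + 1) • v =
            L ((L ^ k) v - b₁ ^ k • v) + b₁ ^ k • (L v - b₁ • v) := by
          rw [pow_succ', Module.End.mul_apply, map_sub, map_smul, smul_sub, smul_smul, pow_succ]
          abel
        rw [e]
        exact add_mem_cone (hL _ ih) (smul_mem_cone (by positivity) h1)
    obtain ⟨ξ⟩ := (inferInstance : Nonempty (P.T r))
    refine le_spectralRadius_toMatrix' L hb₁ (hv ξ) (F := v) (i := ξ) fun k => ?_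
    have := P.cone_nonneg hr hM (hpow k) ξ
    simp only [Pi.sub_apply, Pi.smul_apply, smul_eq_mul] at this
    linarith
  · have hpow : ∀ k, b₂ ^ k • v - (L ^ k) v ∈ cone M (P.T r) := by
      intro k
      induction k with
      | zero =>
        intro ξ ζ
        simp
      | succ k ih =>
        have e : b₂ ^ (k + 1) • v - (L ^ (k + 1)) v =
            L (b₂ ^ k • v - (L ^ k) v) + b₂ ^ k • (b₂ • v - L v) := by
          rw [pow_succ' L, Module.End.mul_apply, map_sub, map_smul, smul_sub, smul_smul, pow_succ]
          abel
        rw [e]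
        exact add_mem_cone (hL _ ih) (smul_mem_cone (by positivity) h2)
    refine spectralRadius_toMatrix'_le L hb fun F => ?_
    obtain ⟨C₁, hC₁, hF₁⟩ := exists_add_smul_mem_cone hv hvM hM' F
    obtain ⟨C₂, hC₂, hF₂⟩ := exists_add_smul_mem_cone hv hvM hM' (-F)
    refine ⟨(C₁ + C₂) * ∑ ξ, v ξ, fun k ξ => ?_⟩
    have g1 := P.cone_nonneg hr hM (hLk k _ hF₁) ξ
    have g2 := P.cone_nonneg hr hM (hLk k _ hF₂) ξ
    have g3 := P.cone_nonneg hr hM (hpow k) ξ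
    simp only [map_add, map_neg, map_smul, Pi.add_apply, Pi.neg_apply, Pi.smul_apply,
      Pi.sub_apply, smul_eq_mul] at g1 g2 g3
    have hsum : v ξ ≤ ∑ ξ, v ξ :=
      Finset.single_le_sum (fun i _ => (hv i).le) (Finset.mem_univ ξ)
    have hbk : 0 ≤ b₂ ^ k := by positivity
    have g4 : (L ^ k) v ξ ≤ b₂ ^ k * ∑ ξ, v ξ := by
      have := mul_le_mul_of_nonneg_left hsum hbk
      linarith
    have g5 := mul_le_mul_of_nonneg_left g4 hC₁
    have g6 := mul_le_mul_of_nonneg_left g4 hC₂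
    have hS : 0 ≤ b₂ ^ k * ∑ ξ, v ξ :=
      mul_nonneg hbk (Finset.sum_nonneg fun i _ => (hv i).le)
    have g7 := mul_nonneg hC₁ hS
    have g8 := mul_nonneg hC₂ hS
    rw [abs_le]
    constructor <;> linarith

/-- For positive combinations `f` of powers, `ε L^ν f ± (L^ν f - 𝐋 f)` lies in `K(M; T)`, where
`ε = H h^r`. -/
theorem error_mem_cone (hχ : 1 ≤ A.chi) (hs : 0 < s) (hs' : s ≤ 3 / 2) (hr : 2 ≤ r) (hν : 1 ≤ ν)
    (hP : P.Covers ν) (hh : P.h ≤ 0.2)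
    (hM : 2 * s / (A.aInf + A.a (ν - 1) + A.gmin) +
      A.c ν * (2 * s / A.chi * (1 + 2 * π * (r + 1)) / 0.85) ≤ M) {e : ℝ} (he : |e| = 1)
    {f : ℝ → ℝ} (hf : A.PowComb s f) :
    (fun ξ : P.T r => H P.mu A.chi s P.h r * P.h ^ r * (A.rtransfer s)^[ν] f ξ +
      e * ((A.rtransfer s)^[ν] f ξ - P.colloc s ν r (fun ξ => f ξ) ξ)) ∈ cone M (P.T r) := by
  set ε := H P.mu A.chi s P.h r * P.h ^ r with hε
  have hsum : ∀ f : ℝ → ℝ, ∀ ξ : P.T r, ε * (A.rtransfer s)^[ν] f ξ +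
      e * ((A.rtransfer s)^[ν] f ξ - P.colloc s ν r (fun ξ => f ξ) ξ) =
      ∑ ω : A.Word ν, Alphabet.gWord ω ξ ^ s * (ε * f (Alphabet.thetaWord ω ξ) +
        e * (f (Alphabet.thetaWord ω ξ) -
          P.interp r (Alphabet.thetaWord ω ξ) fun ξ => f ξ)) := by
    intro f ξ
    rw [Alphabet.iterate_rtransfer_eq ν f ξ (P.mem_S_of_mem_T hr ξ.2), P.colloc_apply,
      ← Finset.sum_sub_distrib, Finset.mul_sum, Finset.mul_sum, ← Finset.sum_add_distrib]
    exact Finset.sum_congr rfl fun ω _ => by ring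
  induction hf with
  | pow d h1 h2 =>
    have hB : 0 ≤ 2 * s / A.chi * (1 + 2 * π * (r + 1)) / 0.85 := by
      have := pi_pos
      positivity
    have key := P.memCone_sum_words hν hP (fun ω => Alphabet.memCone_gWord_rpow hν ω hs.le)
      (fun i => (P.memCone_error hχ hs hs' hr hh h1 he i).1) hB
      (fun i => (P.memCone_error hχ hs hs' hr hh h1 he i).2)
    refine MemCone.mem_cone hr (key.mono ?_ hM) (hsum _)
    intro x hx
    refine Finset.sum_nonneg fun ω _ => mul_nonneg (rpow_nonneg (Alphabet.gWord_nonneg ω x) s) ?_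
    obtain ⟨i, hi⟩ := hP ω
    exact (P.memCone_error hχ hs hs' hr hh h1 he i).1 _ (hi (mem_image_of_mem _ hx))
  | add f g _ _ ihf ihg =>
    have := add_mem_cone ihf ihg
    convert this using 1
    funext ξ
    simp only [Pi.add_apply]
    rw [hsum, hsum, hsum, ← Finset.sum_add_distrib]
    refine Finset.sum_congr rfl fun ω _ => ?_
    have e1 : (fun ξ : P.T r => f ξ + g ξ) = (fun ξ : P.T r => f ξ) + fun ξ : P.T r => g ξ := rfl
    rw [e1, map_add]
    ring
  | smul c f hc _ ih =>
    have := smul_mem_cone hc.le ih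
    convert this using 1
    funext ξ
    simp only [Pi.smul_apply, smul_eq_mul]
    rw [hsum, hsum, Finset.mul_sum]
    refine Finset.sum_congr rfl fun ω _ => ?_
    have e1 : (fun ξ : P.T r => c * f ξ) = c • fun ξ : P.T r => f ξ := rfl
    rw [e1, map_smul, smul_eq_mul]
    ring
  | congr f g h _ ih =>
    convert ih using 1
    funext ξ
    rw [hsum, hsum]
    refine Finset.sum_congr rfl fun ω _ => ?_
    have e1 : (fun ξ : P.T r => g ξ) = fun ξ : P.T r => f ξ :=
      funext fun ξ => (h ξ (P.mem_S_of_mem_T hr ξ.2)).symm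
    rw [e1, h _ (Alphabet.thetaWord_mem ω (P.mem_S_of_mem_T hr ξ.2))]

/-- The two-sided estimate for the spectral radius of the collocation operator. -/
theorem R_estimate (hχ : 1 ≤ A.chi) (hs : 0 < s) (hs' : s ≤ 3 / 2) (hr : 2 ≤ r) (hν : 1 ≤ ν)
    (hP : P.Covers ν) (hh : P.h ≤ 0.2) [Nonempty (P.T r)]
    (hM : 2 * s / (A.aInf + A.a (ν - 1) + A.gmin) +
      A.c ν * (2 * s / A.chi * (1 + 2 * π * (r + 1)) / 0.85) ≤ M) (hMχ : 2 * s / A.chi < M)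
    (hε : 0 ≤ H P.mu A.chi s P.h r * P.h ^ r)
    (hL : ∀ F ∈ cone M (P.T r), P.colloc s ν r F ∈ cone M (P.T r)) :
    A.lam s ^ ν * (1 - H P.mu A.chi s P.h r * P.h ^ r) ≤ P.R s ν r ∧
      P.R s ν r ≤ A.lam s ^ ν * (1 + H P.mu A.chi s P.h r * P.h ^ r) := by
  obtain ⟨hlam, V, c, C, hc, hV, hVb, hVt⟩ := A.exists_approx_eigenfunctions hs.le hν
  set ε := H P.mu A.chi s P.h r * P.h ^ r with hεdef
  set q := A.lam s ^ ν with hq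
  set w : ℕ → P.T r → ℝ := fun N ξ => V N ξ with hw
  have hwS : ∀ ξ : P.T r, (ξ : ℝ) ∈ A.S := fun ξ => P.mem_S_of_mem_T hr ξ.2
  have hwmem : ∀ N, w N ∈ Icc (fun _ : P.T r => c) fun _ => C := fun N =>
    ⟨fun ξ => (hVb N ξ (hwS ξ)).1, fun ξ => (hVb N ξ (hwS ξ)).2⟩
  obtain ⟨v, hv, φ, hφ, hlim⟩ := isCompact_Icc.tendsto_subseq hwmem
  have hcont : Continuous (P.colloc s ν r) := LinearMap.continuous_of_finiteDimensional _
  have hLlim : Tendsto (fun N => P.colloc s ν r (w (φ N))) atTop (𝓝 (P.colloc s ν r v)) :=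
    (hcont.tendsto v).comp hlim
  have hTlim : Tendsto (fun N => fun ξ : P.T r => (A.rtransfer s)^[ν] (V (φ N)) ξ) atTop
      (𝓝 (q • v)) := by
    rw [tendsto_pi_nhds]
    intro ξ
    have h1 := (hVt ξ (hwS ξ)).comp hφ.tendsto_atTop
    have h2 := ((tendsto_pi_nhds.1 hlim) ξ).const_mul q
    have h3 := h1.add h2
    rw [zero_add] at h3
    refine h3.congr fun N => ?_
    simp only [Function.comp, hw]
    ring
  have hvpos : ∀ ξ, 0 < v ξ := fun ξ => hc.trans_le (hv.1 ξ)
  have hvM : v ∈ cone (2 * s / A.chi) (P.T r) :=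
    (isClosed_cone _ _).mem_of_tendsto hlim (Eventually.of_forall fun N =>
      MemCone.mem_cone hr ((hV (φ N)).memCone hs.le) fun ξ => rfl)
  have herr : ∀ e : ℝ, |e| = 1 →
      ε • (q • v) + e • (q • v - P.colloc s ν r v) ∈ cone M (P.T r) := by
    intro e he
    have h1 := (hTlim.const_smul ε).add ((hTlim.sub hLlim).const_smul e)
    refine (isClosed_cone _ _).mem_of_tendsto h1 (Eventually.of_forall fun N => ?_)
    exact P.error_mem_cone hχ hs hs' hr hν hP hh hM he (hV (φ N))
  have hq0 : 0 < q := by positivity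
  have hM0 : 0 < M := lt_of_le_of_lt (by have := A.chi_pos; positivity) hMχ
  refine P.R_bounds hr hM0 hL hMχ hvpos hvM (by positivity) ?_ ?_
  · have h1 := herr (-1) (by simp)
    have e1 : ε • (q • v) + (-1 : ℝ) • (q • v - P.colloc s ν r v) =
        P.colloc s ν r v - (q * (1 - ε)) • v := by
      module
    rwa [e1] at h1
  · have h1 := herr 1 (by simp)
    have e1 : ε • (q • v) + (1 : ℝ) • (q • v - P.colloc s ν r v) =
        (q * (1 + ε)) • v - P.colloc s ν r v := by
      module
    rwa [e1] at h1

end Mesh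
end ContFrac

/-! ### The constants -/

namespace ContFrac
open Real

theorem G_le {χ s h : ℝ} (hχ : 1 ≤ χ) (hs : 0 < s) (hs' : s ≤ 3 / 2) (hh : 0 < h)
    (hh' : h ≤ 0.2) {r : ℕ} (hr : 2 ≤ r) : G χ s h r ≤ 0.9 := by
  have hca := cos_pi_div_pos hr
  obtain ⟨ha0, ha1⟩ := pi_div_mem_Ioc hr
  have hpi := pi_pos
  have hexp : exp (2 * s * h / χ) ≤ 1.83 := by
    have h1 : 2 * s * h / χ ≤ 0.6 := by
      rw [div_le_iff₀ (by linarith)]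
      nlinarith
    refine (exp_le_exp.2 h1).trans (le_of_lt ?_)
    refine lt_of_pow_lt_pow_left₀ 5 (by norm_num) ?_
    have e : exp (0.6 : ℝ) ^ 5 = exp 1 ^ 3 := by
      rw [← exp_nat_mul, ← exp_nat_mul]
      norm_num
    rw [e]
    refine (pow_le_pow_left₀ (exp_pos _).le exp_one_lt_d9.le 3).trans_lt ?_
    norm_num
  have hprod : ∏ j ∈ Finset.range (r + 1), (2 * s + j) / (2 * j + 2) ≤ 1.25 := by
    rw [← Finset.prod_range_mul_prod_Ico _ (by omega : 3 ≤ r + 1)]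
    have h1 : ∏ j ∈ Finset.Ico 3 (r + 1), (2 * s + j) / (2 * j + 2) ≤ 1 := by
      refine Finset.prod_le_one (fun j _ => by positivity) fun j hj => ?_
      have : (3 : ℝ) ≤ j := by exact_mod_cast (Finset.mem_Ico.1 hj).1
      rw [div_le_one (by positivity)]
      linarith
    have h2 : ∏ j ∈ Finset.range 3, (2 * s + j) / (2 * (j : ℝ) + 2) ≤ 1.25 := by
      have h3 : ∏ j ∈ Finset.range 3, (2 * s + j) / (2 * (j : ℝ) + 2) ≤
          ∏ j ∈ Finset.range 3, (3 + j : ℝ) / (2 * (j : ℝ) + 2) := by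
        refine Finset.prod_le_prod (fun j _ => by positivity) fun j _ => ?_
        gcongr
        linarith
      refine h3.trans (le_of_eq ?_)
      norm_num [Finset.prod_range_succ]
    calc _ ≤ (1.25 : ℝ) * 1 := by
          gcongr
      _ = 1.25 := by norm_num
  have hcos : (1 / (2 * cos (π / (2 * r + 2)))) ^ (r + 1) ≤ 0.1926 := by
    have h1 : √3 / 2 ≤ cos (π / (2 * r + 2)) := by
      rw [← cos_pi_div_six]
      exact cos_le_cos_of_nonneg_of_le_pi ha0.le (by linarith) ha1
    have h2 : (1.732 : ℝ) ≤ √3 := le_sqrt_of_sq_le (by norm_num)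
    have h3 : 1 / (2 * cos (π / (2 * r + 2))) ≤ 0.57737 := by
      rw [div_le_iff₀ (by positivity)]
      linarith
    calc (1 / (2 * cos (π / (2 * r + 2)))) ^ (r + 1) ≤ 0.57737 ^ (r + 1) := by gcongr
      _ ≤ 0.57737 ^ 3 := pow_le_pow_of_le_one (by norm_num) (by norm_num) (by omega)
      _ ≤ 0.1926 := by norm_num
  have hχr : (1 / χ) ^ (r + 1) ≤ 1 :=
    pow_le_one₀ (by positivity) (by rw [div_le_one (by linarith)]; exact hχ)
  have h0 : 0 ≤ ∏ j ∈ Finset.range (r + 1), (2 * s + j) / (2 * j + 2) :=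
    Finset.prod_nonneg fun j _ => by positivity
  calc G χ s h r ≤ 2 * 1.83 * 1.25 * 1 * 0.1926 := by
        unfold G
        gcongr
    _ ≤ 0.9 := by norm_num

/-- The constant `M₂` is `2 s / χ` times a quantity below the left side of the inequality which
defines `h₁`. -/
theorem M2_lt {μ χ s h : ℝ} (hμ : 1 ≤ μ) (hχ : 1 ≤ χ) (hs : 0 < s) (hs' : s ≤ 3 / 2) (hh : 0 < h)
    (hh' : h ≤ 0.2) {r : ℕ} (hr : 2 ≤ r) : M2 μ χ s h r <
      2 * s / χ * (2 + H μ χ s h r * h ^ r * (1 + h ^ (2 * r + 2)) + h ^ 2) := by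
  have hχ0 : 0 < χ := by linarith
  have hμ0 : 0 < μ := by linarith
  have hG := G_pos (h := h) hχ0 hs hr
  have hG9 := G_le hχ hs hs' hh hh' hr
  have hH := H_pos (h := h) hμ0 hχ0 hs hr
  have hsa := sin_pi_div_pos hr
  have hsa' := sin_pi_div_le_half hr
  set S := sin (π / (2 * r + 2)) with hS
  have hHdef : H μ χ s h r = μ * ((1 / S) ^ 2 * G χ s h r) * (χ / (2 * s)) := rfl
  set g := G χ s h r with hg
  set η := H μ χ s h r with hη
  have hratio : g / η = 2 * s * S ^ 2 / (μ * χ) := by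
    rw [hHdef]
    field_simp
  have hZ0 : 0 < h ^ (2 * r + 2) := by positivity
  have hZ : h ^ (2 * r + 2) ≤ 0.04 := by
    calc h ^ (2 * r + 2) ≤ h ^ 2 := pow_le_pow_of_le_one hh.le (by linarith) (by omega)
      _ ≤ 0.2 ^ 2 := by gcongr
      _ = 0.04 := by norm_num
  set Z := h ^ (2 * r + 2) with hZdef
  have hg2 : g ^ 2 ≤ 0.81 := by nlinarith
  have hgZ : g ^ 2 * Z ≤ 0.81 * Z := mul_le_mul_of_nonneg_right hg2 hZ0.le
  have h1 : 1 / (1 - g ^ 2 * Z) ≤ 1 + Z := by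
    rw [div_le_iff₀ (by linarith)]
    have := mul_le_mul_of_nonneg_right hgZ hZ0.le
    have := mul_le_mul_of_nonneg_right hZ hZ0.le
    linarith
  have ht0 : 0 ≤ g / η := by positivity
  have ht : g / η ≤ 3 / 4 := by
    rw [hratio, div_le_iff₀ (by positivity)]
    have h2 : S ^ 2 ≤ (1 / 2) ^ 2 := pow_le_pow_left₀ hsa.le hsa' 2
    have h3 : 1 * 1 ≤ μ * χ := mul_le_mul hμ hχ (by norm_num) hμ0.le
    have h4 : 2 * s * S ^ 2 ≤ 3 * (1 / 2) ^ 2 := by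
      gcongr
      linarith
    linarith
  have hy : (g / η * h) ^ 2 ≤ 9 / 16 * h ^ 2 := by
    rw [mul_pow]
    have : (g / η) ^ 2 ≤ (3 / 4) ^ 2 := pow_le_pow_left₀ ht0 ht 2
    have := mul_le_mul_of_nonneg_right this (sq_nonneg h)
    linarith
  have hh2 : h ^ 2 ≤ 0.04 := by nlinarith
  have hh20 : 0 < h ^ 2 := by positivity
  set y := (g / η * h) ^ 2 with hydef
  have h2 : 1 / (1 - y) < 1 + h ^ 2 := by
    rw [div_lt_iff₀ (by linarith)]
    have h3 := mul_le_mul_of_nonneg_right hy hh20.le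
    have h4 := mul_le_mul_of_nonneg_right hh2 hh20.le
    linarith
  have e : M2 μ χ s h r =
      2 * s / χ * (1 + η * h ^ r * (1 / (1 - g ^ 2 * Z)) + 1 / (1 - y)) := by
    have e1 : μ * (g * h ^ r / (1 - g ^ 2 * Z)) * (1 / S) ^ 2 =
        2 * s / χ * (η * h ^ r * (1 / (1 - g ^ 2 * Z))) := by
      have e3 : χ / (2 * s) * (2 * s / χ) = 1 := by field_simp
      rw [hHdef]
      calc _ = μ * (g * h ^ r / (1 - g ^ 2 * Z)) * (1 / S) ^ 2 *
            (χ / (2 * s) * (2 * s / χ)) := by rw [e3, mul_one]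
        _ = _ := by ring
    have e2 : g / η * (μ / (1 - y)) * (1 / S ^ 2) = 2 * s / χ * (1 / (1 - y)) := by
      rw [hratio]
      field_simp
    have e4 : M2 μ χ s h r = μ * (g * h ^ r / (1 - g ^ 2 * Z)) * (1 / S) ^ 2 + 2 * s / χ +
        g / η * (μ / (1 - y)) * (1 / S ^ 2) := rfl
    rw [e4, e1, e2]
    ring
  rw [e]
  refine mul_lt_mul_of_pos_left ?_ (by positivity)
  have h3 := mul_le_mul_of_nonneg_left h1 (by positivity : 0 ≤ η * h ^ r)
  linarith

end ContFrac

theorem theorem8p1 (A : ContFrac.Alphabet) (hχ : 1 ≤ A.chi)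
    (r : ℕ) (hr : 2 ≤ r) (s : ℝ) (hs₀ : 0 < s) (hs : s ≤ 3 / 2)
    (ν : ℕ) (hν : 1 ≤ ν)
    (κ₁ : ℝ) (hκ₁ : κ₁ = A.c ν * (2 * ContFrac.eta r * (r : ℝ) ^ 2 * ContFrac.psi r))
    (hκ₁_lt : κ₁ < 1)
    (κ₂ : ℝ) (hκ₁₂ : κ₁ < κ₂) (hκ₂ : κ₂ < 1)
    (M₀ : ℝ) (hM₀ : A.IsM0 ν M₀)
    (M : ℝ) (hM : M = 4 * s / (A.aInf + A.a (ν - 1) + A.gmin) * (1 / (κ₂ - κ₁)))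
    (P : ContFrac.Mesh A) (hP : P.Covers ν)
    (h₀ : ℝ) (hh₀ : ContFrac.IsH0 r κ₁ κ₂ s M₀ M h₀)
    (h₁ : ℝ) (hh₁ : ContFrac.IsH1 r κ₁ κ₂ s P.mu A.chi h₁)
    (hh : P.h ≤ min (min h₀ h₁) 0.2) :
    ContFrac.ConeCond1 r (M * ContFrac.eta r * P.h) ∧
    ContFrac.ConeCond2 r κ₁ κ₂ s M₀ M (M * ContFrac.eta r * P.h) ∧
    ContFrac.M2 P.mu A.chi s P.h r < M ∧
    κ₂ * M < M ∧
    P.colloc s ν r '' ContFrac.cone M (P.T r) ⊆ ContFrac.cone (κ₂ * M) (P.T r) ∧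
    A.lam s ^ ν * (1 - ContFrac.H P.mu A.chi s P.h r * P.h ^ r) ≤ P.R s ν r ∧
    P.R s ν r ≤ A.lam s ^ ν * (1 + ContFrac.H P.mu A.chi s P.h r * P.h ^ r) := by
  obtain ⟨β, hβ⟩ := A.nontrivial.nonempty
  obtain ⟨i, -⟩ := hP fun _ => ⟨β, hβ⟩
  have : Nonempty (P.T r) :=
    ⟨⟨_, P.node_mem r ⟨i, ⟨0, P.N_pos i⟩⟩ 0⟩⟩
  have hh2 : P.h ≤ 0.2 := hh.trans (min_le_right _ _)
  have hhh₀ : P.h ≤ h₀ := hh.trans ((min_le_left _ _).trans (min_le_left _ _))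
  have hhh₁ : P.h ≤ h₁ := hh.trans ((min_le_left _ _).trans (min_le_right _ _))
  have hpos := P.h_pos i
  have hμ := P.one_le_mu i
  have hχ0 : 0 < A.chi := by linarith
  obtain ⟨hc1, hc2⟩ := hh₀ P.h hpos hhh₀
  have hH1 := hh₁ P.h hpos hhh₁
  obtain ⟨hMσ, hκ0, hσ⟩ := ContFrac.constant_le hs₀ hr hκ₁ hκ₁₂ hκ₂ hM
  have hMeq : M = 2 * s / (A.aInf + A.a (ν - 1) + A.gmin) * (2 / (κ₂ - κ₁)) := by
    rw [hM]
    ring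
  have hσ0 : 0 < 2 * s / A.chi := by positivity
  have hm0 : 0 < 2 / (κ₂ - κ₁) := div_pos two_pos (by linarith)
  have hMlow : 2 * s / A.chi * (2 / (κ₂ - κ₁)) ≤ M := by
    rw [hMeq]
    exact mul_le_mul_of_nonneg_right hσ hm0.le
  have hM2 := (ContFrac.M2_lt hμ hχ hs₀ hs hpos hh2 hr).trans_le
    ((mul_le_mul_of_nonneg_left hH1 hσ0.le).trans hMlow)
  have hMχ : 2 * s / A.chi < M := by
    have : 1 < 2 / (κ₂ - κ₁) := by
      rw [lt_div_iff₀ (by linarith)]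
      linarith
    have := mul_lt_mul_of_pos_left this hσ0
    linarith
  have hM0 : 0 < M := hσ0.trans hMχ
  have hκM : κ₂ * M < M := mul_lt_of_lt_one_left hM0 hκ₂
  have hcone : ∀ F ∈ ContFrac.cone M (P.T r),
      P.colloc s ν r F ∈ ContFrac.cone (κ₂ * M) (P.T r) := fun F hF =>
    P.colloc_mem_cone hr hν hP hs₀.le hM0 hM₀ hκ₁ hc1 hc2 hF
  refine ⟨hc1, hc2, hM2, hκM, ?_, ?_⟩
  · rintro _ ⟨F, hF, rfl⟩
    exact hcone F hF
  · refine P.R_estimate hχ hs₀ hs hr hν hP hh2 hMσ hMχ ?_ fun F hF => ?_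
    · exact (mul_pos (ContFrac.H_pos (by linarith) hχ0 hs₀ hr) (by positivity)).le
    · exact ContFrac.cone_mono (P.cone_nonneg hr (mul_pos (by linarith) hM0) (hcone F hF)) hκM.le
        (hcone F hF)
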